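/- Let $(X,\mu)$ be a measure space with $\mu(X)<+\infty$, let $H=L^2(X,\mu)$ be the real Hilbert space of square-integrable real-valued functions, and let $A$ be a nonnegative self-adjoint linear operator on $H$ with dense domain $D(A)$. Let $A^{1/2}$ be its nonnegative self-adjoint square root, and equip $D(A^{1/2})$ with the graph norm $|u|_{D(A^{1/2})}=(\|u\|_{L^2}^2+\|A^{1/2}u\|_{L^2}^2)^{1/2}$. Assume that $\ker A\neq\{0\}$ and that there is $\nu>0$ such that $$\|A^{1/2}u\|_{L^2}^2\ge\nu\|u\|_{L^2}^2\qquad\text{for all }u\in D(A^{1/2})\cap(\ker A)^\perp .$$ Let $p>0$ be real, and assume that: (i) $D(A^{1/2})\subseteq L^{2(p+1)}(X,\mu)$, and there is a constant $K_1$ such that $\|u\|_{L^{2(p+1)}}\le K_1|u|_{D(A^{1/2})}$ for all $u\in D(A^{1/2})$; (ii) there is a constant $K_2$ such that, for all $u,v\in D(A^{1/2})$, $$\big\||u|^pv^2\big\|_{L^1}\le K_2|u|_{D(A^{1/2})}^p\,|v|_{D(A^{1/2})}\,\|v\|_{L^2},\qquad \big\||u|^{2p}v^2\big\|_{L^1}\le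 K_2|u|_{D(A^{1/2})}^{2p}\,|v|_{D(A^{1/2})}^2 .$$ Consider the problem $$u''(t)+u'(t)+Au(t)+|u(t)|^pu(t)=0\quad(t\ge0),\qquad u(0)=u_0,\quad u'(0)=u_1. \tag{P}$$ A global weak solution of (P) is a function $u\in C^0([0,+\infty);D(A^{1/2}))\cap C^1([0,+\infty);H)$ with $u(0)=u_0$, $u'(0)=u_1$ such that for every $\varphi\in D(A^{1/2})$ the function $t\mapsto\langle u'(t),\varphi\rangle_H$ is differentiable on $[0,+\infty)$ (one-sided at $0$) and $$\frac{d}{dt}\langle u',\varphi\rangle_H+\langle u',\varphi\rangle_H+\langle A^{1/2}u,A^{1/2}\varphi\rangle_H+\int_X|u|^pu\,\varphi\,d\mu=0\qquad\text{for all }t\ge0 .$$ Then: (1) For every $(u_0,u_1)\in D(A^{1/2})\times H$, problem (P) has a unique global weak solution $u$. Moreover there is a constant $M_1$ (depending on the solution) such that $$\|u(t)\|_{L^2(X,\mu)}\le\frac{M_1}{(1+t)^{1/p}}\qquad\text{for all }t\ge0 .$$ (2) There exist a nonempty open set $\mathcal S\subseteq D(A^{1/2})\times H$ and positive constants $M_2,M_3$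 such that, for every $(u_0,u_1)\in\mathcal S$, the unique global weak solution of (P) satisfies $$\frac{M_2}{(1+t)^{1/p}}\le\|u(t)\|_{L^2(X,\mu)}\le\frac{M_3}{(1+t)^{1/p}}\qquad\text{for all }t\ge0 .$$ -/

import Mathlib

open MeasureTheory Set
open scoped ENNReal InnerProductSpace

noncomputable section

namespace DampedWave

section Operators

variable {H : Type*} [NormedAddCommGroup H] [InnerProductSpace ℝ H] [CompleteSpace H]

/-- `A` is a nonnegative self-adjoint (possibly unbounded) operator with dense domain. -/
structure IsNonnegSelfAdjoint (A : H →ₗ.[ℝ] H) : Prop where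
  dense_domain : Dense (A.domain : Set H)
  isSelfAdjoint : IsSelfAdjoint A
  nonneg : ∀ x : A.domain, 0 ≤ ⟪A x, (x : H)⟫_ℝ

/-- `B` is a nonnegative self-adjoint operator with `B ∘ B = A` as unbounded operators: the domain
of `A` is `{x ∈ D(B) | B x ∈ D(B)}`, and there `A x = B (B x)`. -/
structure IsNonnegSqrt (A B : H →ₗ.[ℝ] H) : Prop where
  isNonnegSelfAdjoint : IsNonnegSelfAdjoint B
  sq_eq : ∀ x y : H, (x, y) ∈ A.graph ↔ ∃ z : H, (x, z) ∈ B.graph ∧ (z, y) ∈ B.graph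

open Classical in
/-- The operator `A^{1/2}`: the nonnegative self-adjoint square root of `A`. Every nonnegative
self-adjoint operator has exactly one; the other branch is never used for such operators. -/
def opSqrt (A : H →ₗ.[ℝ] H) : H →ₗ.[ℝ] H :=
  if h : ∃ B : H →ₗ.[ℝ] H, IsNonnegSqrt A B then h.choose else ⊥

/-- The kernel of `A`, as a subspace of `H`. -/
def opKer (A : H →ₗ.[ℝ] H) : Submodule ℝ H :=
  (LinearMap.ker A.toFun).map A.domain.subtype

/-- The space `D(A^{1/2})`, as a type of its own, since it carries the graph norm and not the
norm of `H`. -/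
def SqrtDomain (A : H →ₗ.[ℝ] H) : Type _ := ↥(opSqrt A).domain

namespace SqrtDomain

variable {A : H →ₗ.[ℝ] H}

instance : AddCommGroup (SqrtDomain A) := inferInstanceAs (AddCommGroup ↥(opSqrt A).domain)

instance : Module ℝ (SqrtDomain A) := inferInstanceAs (Module ℝ ↥(opSqrt A).domain)

/-- The inclusion of `D(A^{1/2})` in `H`. -/
def toH : SqrtDomain A →ₗ[ℝ] H := (opSqrt A).domain.subtype

/-- The operator `A^{1/2}` on its domain. -/
def half : SqrtDomain A →ₗ[ℝ] H := (opSqrt A).toFun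

theorem toH_injective : Function.Injective (toH : SqrtDomain A → H) :=
  Subtype.val_injective

/-- The inner product `⟨u, v⟩ + ⟨A^{1/2} u, A^{1/2} v⟩` on `D(A^{1/2})`. -/
abbrev innerCore : InnerProductSpace.Core ℝ (SqrtDomain A) where
  inner u v := ⟪toH u, toH v⟫_ℝ + ⟪half u, half v⟫_ℝ
  conj_inner_symm u v := by simp [real_inner_comm]
  re_inner_nonneg u := by
    simpa using add_nonneg (real_inner_self_nonneg (x := toH u))
      (real_inner_self_nonneg (x := half u))
  add_left u v w := by simp only [map_add, inner_add_left]; ring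
  smul_left u v r := by simp only [map_smul, real_inner_smul_left]; simp; ring
  definite u h := by
    have h1 := real_inner_self_nonneg (x := toH u)
    have h2 := real_inner_self_nonneg (x := half u)
    have h3 : ⟪toH u, toH u⟫_ℝ = 0 := by linarith
    exact toH_injective (by simpa using h3)

instance : NormedAddCommGroup (SqrtDomain A) := innerCore.toNormedAddCommGroup

instance : InnerProductSpace ℝ (SqrtDomain A) := InnerProductSpace.ofCore innerCore.toCore

/-- The norm of `D(A^{1/2})` is the graph norm. -/
theorem norm_eq (u : SqrtDomain A) : ‖u‖ = √(‖toH u‖ ^ 2 + ‖half u‖ ^ 2) := by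
  rw [← real_inner_self_eq_norm_sq, ← real_inner_self_eq_norm_sq, norm_eq_sqrt_real_inner]
  rfl

end SqrtDomain

end Operators

section Equation

variable {X : Type*} [MeasurableSpace X] {μ : Measure X}

/-- `u` is a global weak solution of `u'' + u' + A u + |u|^p u = 0` in `H = L²(X, μ)` with
`u(0) = u₀`, `u'(0) = u₁`: it belongs to `C⁰([0,∞); D(A^{1/2})) ∩ C¹([0,∞); H)`, the nonlinear
term is in `H`, and for every test vector `φ ∈ D(A^{1/2})` and every `t ≥ 0`
`d/dt ⟨u', φ⟩ + ⟨u', φ⟩ + ⟨A^{1/2} u, A^{1/2} φ⟩ + ∫ |u|^p u φ dμ = 0`.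
Here `v` is the time derivative `u'`; derivatives at `t = 0` are one-sided, and values at
`t < 0` are irrelevant. -/
structure IsGlobalWeakSolution (A : Lp ℝ 2 μ →ₗ.[ℝ] Lp ℝ 2 μ) (p : ℝ)
    (u₀ : SqrtDomain A) (u₁ : Lp ℝ 2 μ) (u : ℝ → SqrtDomain A) : Prop where
  continuousOn : ContinuousOn u (Ici 0)
  init : u 0 = u₀
  memLp : ∀ t, 0 ≤ t → MemLp (fun x => |(u t).toH x| ^ p * (u t).toH x) 2 μ
  weak : ∃ v : ℝ → Lp ℝ 2 μ,
    ContinuousOn v (Ici 0) ∧ v 0 = u₁ ∧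
    (∀ t, 0 ≤ t → HasDerivWithinAt (fun s => (u s).toH) (v t) (Ici 0) t) ∧
    ∀ φ : SqrtDomain A, ∀ t, 0 ≤ t →
      HasDerivWithinAt (fun s => ⟪v s, φ.toH⟫_ℝ)
        (-(⟪v t, φ.toH⟫_ℝ + ⟪(u t).half, φ.half⟫_ℝ
          + ∫ x, |(u t).toH x| ^ p * (u t).toH x * φ.toH x ∂μ)) (Ici 0) t

end Equation

end DampedWave

end

/-! Write V = D(A^{1/2}), H = L², ι : V → H for the inclusion, f(u) = |u|^p u, and Φ for the
potential of f. The inner product of V is the form of 1 + A, so the adjoint ι† is (1 + A)⁻¹ and the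
equation reads u'' + ι†⁻¹u = ιu − u' − f(u). The inverse K of the wave generator on V × H
(`waveInv`) is bounded and skew, with dense range. Hence x' = K⁻¹x + F(x) can be stated as (Kx)' = x
+ K F(x), with bounded operators only, and (K − ε)⁻¹ approximates K⁻¹ by bounded dissipative
operators. This gives solvability for Lipschitz forces (`exists_isForced`) and an energy identity
for every weak solution (`energy_identity`).

The energy E = ‖A^{1/2}u‖²/2 + ‖u'‖²/2 + Φ(u) satisfies E' = −‖u'‖². Because μ is finite, Φ(u) ≥
c‖u‖^{p+2}, so E bounds the norm of V. Truncating f outside a large ball then gives global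
existence, and Gronwall gives uniqueness.

Upper bound (`exists_decay_bound`): with W = ⟪u, u'⟫ and b = p/(p+2), the function E^{-b} minus a
small multiple of W/E grows at least linearly. Hence E = O(t^{-(p+2)/p}) and ‖u‖ = O(t^{-1/p}).

Lower bound (`exists_slow_solutions`): near small data in ker A the solution is driven by its kernel
component. Let D be the linear energy plus a multiple of ⟪Qu, u'⟫, with Q the projection onto (ker
A)^⊥, and let y = ‖u‖². The spectral gap makes D decay exponentially up to a source of order
y^{p+1}, so the inequality D ≤ q y^{p+1} persists in time. Then |y'| ≤ 4√q y^{1+p/2}, and y^{-p/2} =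
‖u‖^{-p} grows at most linearly. -/

noncomputable section

set_option linter.unusedSectionVars false

namespace DampedWave

/-! ### Approximate inverses of a skew operator; Lipschitz ordinary differential equations. -/

section Evolution
open Filter Topology

variable {E : Type*} [NormedAddCommGroup E] [InnerProductSpace ℝ E] [CompleteSpace E]

/-- Resolvents of the inverse of a skew operator: `L = (K - ε)⁻¹` is bounded and dissipative. -/
theorem exists_yosida (K : E →L[ℝ] E) (hK : ∀ x, ⟪K x, x⟫_ℝ = 0) {ε : ℝ} (hε : 0 < ε) :
    ∃ L : E →L[ℝ] E, (∀ x, L (K x - ε • x) = x) ∧ (∀ x, K (L x) - ε • L x = x) := by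
  have hu : IsUnit (K - ε • ContinuousLinearMap.id ℝ E) := by
    refine ContinuousLinearMap.isUnit_of_forall_le_norm_inner_map _ (c := ⟨ε, hε.le⟩) hε ?_
    intro x
    have : ⟪(K - ε • ContinuousLinearMap.id ℝ E) x, x⟫_ℝ = -(‖x‖ ^ 2 * ε) := by
      simp [inner_sub_left, hK, real_inner_smul_left]; ring
    rw [this, norm_neg, Real.norm_eq_abs, abs_of_nonneg (by positivity)]
    rfl
  obtain ⟨u, hu⟩ := hu
  refine ⟨(↑u⁻¹ : E →L[ℝ] E), fun x => ?_, fun x => ?_⟩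
  · have := DFunLike.congr_fun (u.inv_mul) x
    rw [hu] at this
    simpa using this
  · have := DFunLike.congr_fun (u.mul_inv) x
    rw [hu] at this
    simpa using this

/-- A globally Lipschitz autonomous equation has a solution on `[0, ∞)`. -/
theorem exists_ode_solution (G : E → E) {k : ℝ} (hk : 0 ≤ k)
    (hG : ∀ x y, ‖G x - G y‖ ≤ k * ‖x - y‖) (x₀ : E) :
    ∃ x : ℝ → E, Continuous x ∧ x 0 = x₀ ∧
      ∀ t, 0 ≤ t → HasDerivWithinAt x (G (x t)) (Ici 0) t := by
  have hGc : Continuous G :=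
    (LipschitzWith.of_dist_le_mul (K := k.toNNReal) (fun x y => by
      simpa [dist_eq_norm, Real.coe_toNNReal k hk] using hG x y)).continuous
  -- The unknown is rescaled to y(t) = e^{-lt} x(t). In the sup norm of y the Picard map has
  -- constant k / l, and this l is positive with k / l ≤ 1/2.
  set l : ℝ := 2 * k + 1 with hl
  have hlpos : 0 < l := by positivity
  have key : ∀ t, 0 ≤ t → (∫ s in (0:ℝ)..t, Real.exp (l * s)) ≤ Real.exp (l * t) / l := by
    intro t ht
    rw [intervalIntegral.integral_comp_mul_left (fun x => Real.exp x) hlpos.ne', integral_exp]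
    simp only [mul_zero, Real.exp_zero, smul_eq_mul]
    rw [inv_mul_eq_div]
    gcongr; linarith
  have hcont : ∀ y : BoundedContinuousFunction ℝ E,
      Continuous fun s => G (Real.exp (l * s) • y s) := fun y =>
    hGc.comp ((Real.continuous_exp.comp (by fun_prop)).smul y.continuous)
  have hint : ∀ y : BoundedContinuousFunction ℝ E, ∀ a b,
      IntervalIntegrable (fun s => G (Real.exp (l * s) • y s)) volume a b := fun y a b =>
    (hcont y).intervalIntegrable a b
  have hI : ∀ y : BoundedContinuousFunction ℝ E,
      Continuous fun t => ∫ s in (0:ℝ)..t, G (Real.exp (l * s) • y s) := fun y =>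
    intervalIntegral.continuous_primitive (fun a b => hint y a b) 0
  have hbd : ∀ y : BoundedContinuousFunction ℝ E, ∀ t, 0 ≤ t →
      ‖Real.exp (-(l * t)) • (x₀ + ∫ s in (0:ℝ)..t, G (Real.exp (l * s) • y s))‖
        ≤ ‖x₀‖ + (‖G 0‖ + k * ‖y‖) / l := by
    intro y t ht
    have h1 : ‖∫ s in (0:ℝ)..t, G (Real.exp (l * s) • y s)‖ ≤
        ∫ s in (0:ℝ)..t, (‖G 0‖ + k * ‖y‖) * Real.exp (l * s) := by
      refine intervalIntegral.norm_integral_le_of_norm_le ht (Eventually.of_forall ?_) ?_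
      · intro s hs
        have he : 1 ≤ Real.exp (l * s) := Real.one_le_exp (by have := hs.1; positivity)
        have h2 := hG (Real.exp (l * s) • y s) 0
        rw [sub_zero, norm_smul, Real.norm_of_nonneg (Real.exp_pos _).le] at h2
        have h3 := norm_sub_norm_le (G (Real.exp (l * s) • y s)) (G 0)
        have h4 : Real.exp (l * s) * ‖y s‖ ≤ Real.exp (l * s) * ‖y‖ := by
          gcongr; exact y.norm_coe_le_norm s
        have h5 := mul_le_mul_of_nonneg_left h4 hk
        have h6 := mul_le_mul_of_nonneg_left he (norm_nonneg (G 0))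
        linarith
      · exact (by fun_prop : Continuous fun s : ℝ =>
          (‖G 0‖ + k * ‖y‖) * Real.exp (l * s)).intervalIntegrable _ _
    rw [intervalIntegral.integral_const_mul] at h1
    rw [norm_smul, Real.norm_of_nonneg (Real.exp_pos _).le]
    have h2 : Real.exp (-(l * t)) ≤ 1 := Real.exp_le_one_iff.2 (by
      have := mul_nonneg hlpos.le ht; linarith)
    calc Real.exp (-(l * t)) * ‖x₀ + ∫ s in (0:ℝ)..t, G (Real.exp (l * s) • y s)‖
        ≤ Real.exp (-(l * t)) * (‖x₀‖ + (‖G 0‖ + k * ‖y‖) * (Real.exp (l * t) / l)) := by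
          gcongr
          refine (norm_add_le _ _).trans ?_
          gcongr
          exact h1.trans (by gcongr; exact key t ht)
      _ = Real.exp (-(l * t)) * ‖x₀‖ + (‖G 0‖ + k * ‖y‖) / l := by
          have : Real.exp (-(l * t)) * Real.exp (l * t) = 1 := by
            rw [← Real.exp_add]; simp
          rw [mul_add]
          congr 1
          rw [show Real.exp (-(l * t)) * ((‖G 0‖ + k * ‖y‖) * (Real.exp (l * t) / l)) =
            (Real.exp (-(l * t)) * Real.exp (l * t)) * ((‖G 0‖ + k * ‖y‖) / l) by ring, this, one_mul]
      _ ≤ _ := by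
          gcongr
          exact mul_le_of_le_one_left (norm_nonneg _) h2
  -- Replacing t by max t 0 keeps the image bounded on the whole line; only t ≥ 0 is used.
  let Ψ : BoundedContinuousFunction ℝ E → BoundedContinuousFunction ℝ E := fun y =>
    BoundedContinuousFunction.ofNormedAddCommGroup
      (fun t => Real.exp (-(l * max t 0)) •
        (x₀ + ∫ s in (0:ℝ)..(max t 0), G (Real.exp (l * s) • y s)))
      (by
        refine Continuous.smul (by fun_prop) (continuous_const.add ?_)
        exact (hI y).comp (by fun_prop))
      (‖x₀‖ + (‖G 0‖ + k * ‖y‖) / l)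
      (fun t => hbd y _ (le_max_right _ _))
  have hΨ : ContractingWith (1 / 2) Ψ := by
    refine ⟨by norm_num [← NNReal.coe_lt_coe], LipschitzWith.of_dist_le_mul fun y z => ?_⟩
    rw [BoundedContinuousFunction.dist_le (by positivity)]
    intro t
    set τ := max t 0 with hτ
    have hτ0 : 0 ≤ τ := le_max_right _ _
    have : Ψ y t - Ψ z t = Real.exp (-(l * τ)) • ∫ s in (0:ℝ)..τ,
        (G (Real.exp (l * s) • y s) - G (Real.exp (l * s) • z s)) := by
      rw [intervalIntegral.integral_sub (hint y _ _) (hint z _ _)]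
      have e : ∀ y, Ψ y t = Real.exp (-(l * τ)) •
        (x₀ + ∫ s in (0:ℝ)..τ, G (Real.exp (l * s) • y s)) := fun y => rfl
      rw [e, e, ← smul_sub]; congr 1; abel
    rw [dist_eq_norm, this, norm_smul, Real.norm_of_nonneg (Real.exp_pos _).le]
    have h1 : ‖∫ s in (0:ℝ)..τ, (G (Real.exp (l * s) • y s) - G (Real.exp (l * s) • z s))‖ ≤
        ∫ s in (0:ℝ)..τ, (k * dist y z) * Real.exp (l * s) := by
      refine intervalIntegral.norm_integral_le_of_norm_le hτ0 (Eventually.of_forall ?_) ?_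
      · intro s hs
        refine (hG _ _).trans ?_
        rw [← smul_sub, norm_smul, Real.norm_of_nonneg (Real.exp_pos _).le, ← dist_eq_norm]
        have := BoundedContinuousFunction.dist_coe_le_dist (f := y) (g := z) s
        have h3 := mul_le_mul_of_nonneg_left this (mul_nonneg hk (Real.exp_pos (l * s)).le)
        linarith
      · exact (by fun_prop : Continuous fun s : ℝ =>
          (k * dist y z) * Real.exp (l * s)).intervalIntegrable _ _
    rw [intervalIntegral.integral_const_mul] at h1
    calc _ ≤ Real.exp (-(l * τ)) * ((k * dist y z) * (Real.exp (l * τ) / l)) := by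
          gcongr
          exact h1.trans (by gcongr; exact key _ hτ0)
      _ = (k / l) * dist y z := by
          rw [show Real.exp (-(l * τ)) * ((k * dist y z) * (Real.exp (l * τ) / l)) =
            (Real.exp (-(l * τ)) * Real.exp (l * τ)) * (k / l * dist y z) by ring,
            ← Real.exp_add]; simp
      _ ≤ _ := by
          gcongr
          simp only [NNReal.coe_div, NNReal.coe_one, NNReal.coe_ofNat]
          rw [div_le_div_iff₀ hlpos two_pos]; linarith
  obtain ⟨y, hy⟩ : ∃ y, Ψ y = y := ⟨_, hΨ.fixedPoint_isFixedPt⟩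
  have hyt : ∀ t, 0 ≤ t → Real.exp (l * t) • y t =
      x₀ + ∫ s in (0:ℝ)..t, G (Real.exp (l * s) • y s) := by
    intro t ht
    have h1 : Ψ y t = y t := by rw [hy]
    have h2 : Ψ y t = Real.exp (-(l * t)) •
        (x₀ + ∫ s in (0:ℝ)..t, G (Real.exp (l * s) • y s)) := by
      change Real.exp (-(l * max t 0)) • (x₀ + ∫ s in (0:ℝ)..(max t 0), _) = _
      rw [max_eq_left ht]
    rw [← h1, h2, smul_smul, ← Real.exp_add]; simp
  refine ⟨fun t => Real.exp (l * t) • y t, (Real.continuous_exp.comp (by fun_prop)).smul y.continuous,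
    (hyt 0 le_rfl).trans (by simp), fun t ht => ?_⟩
  have hd : HasDerivAt (fun t => x₀ + ∫ s in (0:ℝ)..t, G (Real.exp (l * s) • y s))
      (G (Real.exp (l * t) • y t)) t :=
    (intervalIntegral.integral_hasDerivAt_right (hint y _ _)
      ((hcont y).stronglyMeasurableAtFilter _ _) (hcont y).continuousAt).const_add _
  exact hd.hasDerivWithinAt.congr (fun s hs => hyt s hs) (hyt t ht)

end Evolution

/-! ### Gronwall, Yosida approximation and the energy identity for mild solutions. -/

section Evolution
open Filter Topology

/-- Under the differential inequality, e^{-at} z(t) − bt has derivative at most (e^{-at} − 1) b ≤ 0.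
-/
theorem gronwall_of_hasDerivWithinAt {z z' : ℝ → ℝ} {a b T : ℝ} (ha : 0 ≤ a) (hb : 0 ≤ b)
    (hz : ∀ t ∈ Icc 0 T, HasDerivWithinAt z (z' t) (Ici 0) t)
    (hle : ∀ t ∈ Icc 0 T, z' t ≤ a * z t + b) :
    ∀ t ∈ Icc 0 T, z t ≤ Real.exp (a * t) * (z 0 + b * t) := by
  intro t ht
  have hd : ∀ s ∈ Icc 0 T, HasDerivWithinAt (fun s => Real.exp (-(a * s)) * z s - b * s)
      ((-a * Real.exp (-(a * s))) * z s + Real.exp (-(a * s)) * z' s - b) (Ici 0) s := by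
    intro s hs
    have h1 : HasDerivAt (fun s => Real.exp (-(a * s))) (-a * Real.exp (-(a * s))) s := by
      have := (((hasDerivAt_id s).const_mul a).neg).exp
      simpa [mul_comm] using this
    have h2 : HasDerivAt (fun s => b * s) b s := by simpa using (hasDerivAt_id s).const_mul b
    exact (h1.hasDerivWithinAt.mul (hz s hs)).sub h2.hasDerivWithinAt
  have hanti : AntitoneOn (fun s => Real.exp (-(a * s)) * z s - b * s) (Icc 0 T) := by
    refine antitoneOn_of_hasDerivWithinAt_nonpos (convex_Icc 0 T)
      (fun s hs => (hd s hs).continuousWithinAt.mono Icc_subset_Ici_self)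
      (fun s hs => (hd s (interior_subset hs)).mono
        (interior_subset.trans Icc_subset_Ici_self)) ?_
    intro s hs
    have hs := interior_subset hs
    have h1 := hle s hs
    have h2 : Real.exp (-(a * s)) ≤ 1 := Real.exp_le_one_iff.2 (by
      have := mul_nonneg ha hs.1; linarith)
    have h3 := mul_le_mul_of_nonneg_left h1 (Real.exp_pos (-(a * s))).le
    have h4 := mul_le_mul_of_nonneg_right h2 hb
    linarith
  have h := hanti ⟨le_rfl, ht.1.trans ht.2⟩ ht ht.1
  simp only [mul_zero, neg_zero, Real.exp_zero, one_mul, sub_zero] at h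
  have h1 : Real.exp (a * t) * Real.exp (-(a * t)) = 1 := by rw [← Real.exp_add]; simp
  have h2 : Real.exp (-(a * t)) * z t ≤ z 0 + b * t := by linarith
  calc z t = Real.exp (a * t) * (Real.exp (-(a * t)) * z t) := by rw [← mul_assoc, h1, one_mul]
    _ ≤ _ := by gcongr

variable {E : Type*} [NormedAddCommGroup E] [InnerProductSpace ℝ E] [CompleteSpace E]

/-- A sequence of Yosida approximations of `K⁻¹`, with `L n = (K - εₙ)⁻¹`. -/
theorem exists_yosida_seq (K : E →L[ℝ] E) (hK : ∀ x, ⟪K x, x⟫_ℝ = 0) :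
    ∃ (ε : ℕ → ℝ) (L : ℕ → E →L[ℝ] E), (∀ n, 0 < ε n) ∧ Tendsto ε atTop (𝓝 0) ∧
      (∀ n x, L n (K x) = x + ε n • L n x) ∧ (∀ n x, K (L n x) = x + ε n • L n x) ∧
      (∀ n x, ⟪L n x, x⟫_ℝ ≤ 0) ∧ (∀ n x, ‖L n (K x)‖ ≤ ‖x‖) := by
  have hpos : ∀ n : ℕ, (0:ℝ) < 1 / ((n:ℝ) + 1) := fun n => by positivity
  choose L hL1 hL2 using fun n : ℕ => exists_yosida K hK (hpos n)
  have h1 : ∀ n x, L n (K x) = x + (1 / ((n:ℝ) + 1)) • L n x := fun n x => by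
    have := hL1 n x
    rw [map_sub, map_smul, sub_eq_iff_eq_add] at this
    exact this
  have h2 : ∀ n x, K (L n x) = x + (1 / ((n:ℝ) + 1)) • L n x := fun n x => by
    have := hL2 n x
    rwa [sub_eq_iff_eq_add] at this
  refine ⟨fun n => 1 / ((n:ℝ) + 1), L, hpos, tendsto_one_div_add_atTop_nhds_zero_nat, h1, h2,
    fun n x => ?_, fun n x => ?_⟩
  · have h3 : x = K (L n x) - (1 / ((n:ℝ) + 1)) • L n x := (hL2 n x).symm
    have h4 : ⟪L n x, x⟫_ℝ = -(1 / ((n:ℝ) + 1) * ‖L n x‖ ^ 2) := by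
      rw [show ⟪L n x, x⟫_ℝ = ⟪L n x, K (L n x) - (1 / ((n:ℝ) + 1)) • L n x⟫_ℝ by rw [← h3]]
      rw [inner_sub_right, real_inner_comm, hK, real_inner_smul_right, real_inner_self_eq_norm_sq]
      ring
    rw [h4]
    have := hpos n
    exact neg_nonpos.2 (by positivity)
  -- In x = K(Lx) − εLx the two terms are orthogonal because K is skew, so Pythagoras bounds K(Lx) =
  -- L(Kx).
  · rw [h1, ← h2]
    have h3 : ‖x‖ ^ 2 = ‖K (L n x)‖ ^ 2 + (1 / ((n:ℝ) + 1)) ^ 2 * ‖L n x‖ ^ 2 := by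
      conv_lhs => rw [← hL2 n x]
      rw [norm_sub_sq_real, real_inner_smul_right, hK, norm_smul, mul_pow, Real.norm_eq_abs, sq_abs]
      ring
    refine le_of_sq_le_sq ?_ (norm_nonneg _)
    rw [h3]
    have : 0 ≤ (1 / ((n:ℝ) + 1)) ^ 2 * ‖L n x‖ ^ 2 := by positivity
    linarith

/-- On the range of K the error is explicit: L(K(Kz)) − Kz = εL(Kz), of norm at most ε‖z‖. The
uniform contraction bound carries the convergence over to the closure of the range, which is
everything. -/
theorem yosida_tendsto {K : E →L[ℝ] E} (hd : DenseRange K) {ε : ℕ → ℝ} {L : ℕ → E →L[ℝ] E}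
    (hε : ∀ n, 0 < ε n) (hε0 : Tendsto ε atTop (𝓝 0))
    (h1 : ∀ n x, L n (K x) = x + ε n • L n x) (h2 : ∀ n x, ‖L n (K x)‖ ≤ ‖x‖) (x : E) :
    Tendsto (fun n => L n (K x)) atTop (𝓝 x) := by
  rw [Metric.tendsto_atTop]
  intro δ hδ
  obtain ⟨z, hz⟩ := hd.exists_dist_lt x (show 0 < δ / 3 by positivity)
  have h3 : Tendsto (fun n => ε n * ‖z‖) atTop (𝓝 0) := by simpa using hε0.mul_const ‖z‖
  obtain ⟨N, hN⟩ := (Metric.tendsto_atTop.1 h3) (δ / 3) (by positivity)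
  refine ⟨N, fun n hn => ?_⟩
  have h4 := hN n hn
  rw [Real.dist_0_eq_abs, abs_of_nonneg (mul_nonneg (hε n).le (norm_nonneg _))] at h4
  rw [dist_eq_norm] at hz ⊢
  have e : L n (K x) - x = L n (K (x - K z)) + (L n (K (K z)) - K z) - (x - K z) := by
    simp only [map_sub]; abel
  have h5 : ‖L n (K (K z)) - K z‖ ≤ ε n * ‖z‖ := by
    rw [h1, add_sub_cancel_left, norm_smul, Real.norm_of_nonneg (hε n).le]
    exact mul_le_mul_of_nonneg_left (h2 n z) (hε n).le
  have h6 := h2 n (x - K z)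
  have h7 := norm_sub_le (L n (K (x - K z)) + (L n (K (K z)) - K z)) (x - K z)
  have h8 := norm_add_le (L n (K (x - K z))) (L n (K (K z)) - K z)
  rw [e]
  linarith

/-- The energy identity for `(K x)' = x + K g`, with `K` skew. -/
theorem energy_identity {K : E →L[ℝ] E} (hK : ∀ x, ⟪K x, x⟫_ℝ = 0) (hd : DenseRange K)
    {x g : ℝ → E} (hx : Continuous x) (hg : Continuous g)
    (h : ∀ t, 0 ≤ t → K (x t) = K (x 0) + ∫ s in (0:ℝ)..t, (x s + K (g s))) {t : ℝ} (ht : 0 ≤ t) :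
    ‖x t‖ ^ 2 = ‖x 0‖ ^ 2 + ∫ s in (0:ℝ)..t, 2 * ⟪x s, g s⟫_ℝ := by
  obtain ⟨ε, L, hε, hε0, h1, h2, -, h3⟩ := exists_yosida_seq K hK
  have hlim := fun x => yosida_tendsto hd hε hε0 h1 h3 x
  have hc : Continuous fun s => x s + K (g s) := hx.add (K.continuous.comp hg)
  -- The curve x need not be differentiable, but L(Kx) is. Since L(Kx) = K(Lx), the linear part of
  -- the derivative of its squared norm is a multiple of ⟪K(Lx), Lx⟫ = 0. Dominated convergence then
  -- gives the identity for x.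
  have main : ∀ n, ‖L n (K (x t))‖ ^ 2 - ‖L n (K (x 0))‖ ^ 2 =
      ∫ s in (0:ℝ)..t, 2 * ⟪L n (K (x s)), L n (K (g s))⟫_ℝ := by
    intro n
    symm
    have hcn : Continuous fun s => L n (K (x s)) := (L n).continuous.comp (K.continuous.comp hx)
    have hgn : Continuous fun s => L n (K (g s)) := (L n).continuous.comp (K.continuous.comp hg)
    refine intervalIntegral.integral_eq_sub_of_hasDeriv_right_of_le ht
      (f := fun s => ‖L n (K (x s))‖ ^ 2) (hcn.norm.pow 2).continuousOn ?_
      ((continuous_const.mul (hcn.inner hgn)).intervalIntegrable _ _)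
    intro s hs
    have hd1 : HasDerivWithinAt (fun s => K (x s)) (x s + K (g s)) (Ici 0) s := by
      have : HasDerivAt (fun t => K (x 0) + ∫ s in (0:ℝ)..t, (x s + K (g s)))
          (x s + K (g s)) s :=
        (intervalIntegral.integral_hasDerivAt_right (hc.intervalIntegrable _ _)
          (hc.stronglyMeasurableAtFilter _ _) hc.continuousAt).const_add _
      exact this.hasDerivWithinAt.congr (fun r hr => h r hr) (h s hs.1.le)
    have hd2 : HasDerivWithinAt (fun s => L n (K (x s))) (L n (x s + K (g s))) (Ici 0) s :=
      (L n).hasFDerivAt.comp_hasDerivWithinAt s hd1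
    have hd3 := (hd2.norm_sq).mono (show Ioi s ⊆ Ici 0 from fun r hr =>
      (hs.1.trans (show s < r from hr)).le)
    refine hd3.congr_deriv ?_
    rw [map_add, inner_add_right, h1 n (x s), ← h2, hK, zero_add]
  have hl : Tendsto (fun n => ‖L n (K (x t))‖ ^ 2 - ‖L n (K (x 0))‖ ^ 2) atTop
      (𝓝 (‖x t‖ ^ 2 - ‖x 0‖ ^ 2)) :=
    (((hlim (x t)).norm).pow 2).sub (((hlim (x 0)).norm).pow 2)
  have hr : Tendsto (fun n => ∫ s in (0:ℝ)..t, 2 * ⟪L n (K (x s)), L n (K (g s))⟫_ℝ) atTop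
      (𝓝 (∫ s in (0:ℝ)..t, 2 * ⟪x s, g s⟫_ℝ)) := by
    refine intervalIntegral.tendsto_integral_filter_of_dominated_convergence
      (fun s => 2 * (‖x s‖ * ‖g s‖)) (Eventually.of_forall fun n => ?_)
      (Eventually.of_forall fun n => Eventually.of_forall fun s _ => ?_)
      ((continuous_const.mul (hx.norm.mul hg.norm)).intervalIntegrable _ _)
      (Eventually.of_forall fun s _ => ?_)
    · have hcn : Continuous fun s => L n (K (x s)) := (L n).continuous.comp (K.continuous.comp hx)
      have hgn : Continuous fun s => L n (K (g s)) := (L n).continuous.comp (K.continuous.comp hg)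
      exact (continuous_const.mul (hcn.inner hgn)).aestronglyMeasurable
    · rw [norm_mul, Real.norm_two]
      gcongr
      exact (norm_inner_le_norm _ _).trans
        (mul_le_mul (h3 n _) (h3 n _) (norm_nonneg _) (norm_nonneg _))
    · exact ((hlim (x s)).inner (hlim (g s))).const_mul 2
  have := tendsto_nhds_unique hl (by simpa only [main] using hr)
  linarith

/-- `x` solves `x' = K⁻¹ x + F x` on `[0, ∞)`, in the form `(K x)' = x + K (F x)`. -/
structure IsMildSolution (K : E →L[ℝ] E) (F : E → E) (x : ℝ → E) : Prop where
  continuous : Continuous x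
  eq : ∀ t, 0 ≤ t → K (x t) = K (x 0) + ∫ s in (0:ℝ)..t, (x s + K (F (x s)))

theorem continuous_of_norm_sub_le {E' : Type*} [NormedAddCommGroup E'] {F : E → E'} {k : ℝ} (hk : 0 ≤ k)
    (hF : ∀ x y, ‖F x - F y‖ ≤ k * ‖x - y‖) : Continuous F :=
  (LipschitzWith.of_dist_le_mul (K := k.toNNReal) (fun x y => by
    simpa [dist_eq_norm, Real.coe_toNNReal k hk] using hF x y)).continuous

theorem norm_le_of_sq_le_exp {a b c : ℝ} (hb : 0 ≤ b)
    (h : a ^ 2 ≤ Real.exp (2 * c) * b ^ 2) : a ≤ Real.exp c * b := by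
  refine le_of_sq_le_sq ?_ (by positivity)
  rwa [mul_pow, ← Real.exp_nat_mul]

/-- The difference solves the linear problem with g = F(x) − F(y), so in the energy identity K⁻¹
contributes nothing and (‖x − y‖²)' ≤ 2k‖x − y‖². -/
theorem IsMildSolution.norm_sub_le {K : E →L[ℝ] E} (hK : ∀ x, ⟪K x, x⟫_ℝ = 0)
    (hd : DenseRange K) {F : E → E} {k : ℝ} (hk : 0 ≤ k)
    (hF : ∀ x y, ‖F x - F y‖ ≤ k * ‖x - y‖) {x y : ℝ → E} (hx : IsMildSolution K F x)
    (hy : IsMildSolution K F y) {t : ℝ} (ht : 0 ≤ t) :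
    ‖x t - y t‖ ≤ Real.exp (k * t) * ‖x 0 - y 0‖ := by
  have hFc := continuous_of_norm_sub_le hk hF
  have hxc := hx.continuous
  have hyc := hy.continuous
  have hc : Continuous fun s => 2 * ⟪x s - y s, F (x s) - F (y s)⟫_ℝ :=
    continuous_const.mul ((hxc.sub hyc).inner ((hFc.comp hxc).sub (hFc.comp hyc)))
  have hid : ∀ t, 0 ≤ t → ‖x t - y t‖ ^ 2 = ‖x 0 - y 0‖ ^ 2 +
      ∫ s in (0:ℝ)..t, 2 * ⟪x s - y s, F (x s) - F (y s)⟫_ℝ := by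
    intro t ht
    refine energy_identity (x := fun t => x t - y t) (g := fun t => F (x t) - F (y t)) hK hd
      (hxc.sub hyc) ((hFc.comp hxc).sub (hFc.comp hyc)) (fun t ht => ?_) ht
    have h1 : Continuous fun s => x s + K (F (x s)) :=
      hxc.add (K.continuous.comp (hFc.comp hxc))
    have h2 : Continuous fun s => y s + K (F (y s)) :=
      hyc.add (K.continuous.comp (hFc.comp hyc))
    rw [map_sub, map_sub, hx.eq t ht, hy.eq t ht]
    have : (fun s => x s - y s + K (F (x s) - F (y s))) =
        fun s => (x s + K (F (x s))) - (y s + K (F (y s))) := by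
      funext s; rw [map_sub]; abel
    rw [this, intervalIntegral.integral_sub (h1.intervalIntegrable _ _)
      (h2.intervalIntegrable _ _)]
    abel
  have := gronwall_of_hasDerivWithinAt (z := fun t => ‖x t - y t‖ ^ 2)
    (z' := fun s => 2 * ⟪x s - y s, F (x s) - F (y s)⟫_ℝ) (a := 2 * k) (b := 0) (T := t)
    (by positivity) le_rfl (fun s hs => ?_) (fun s hs => ?_) t ⟨ht, le_rfl⟩
  · refine norm_le_of_sq_le_exp (norm_nonneg _) ?_
    simpa [mul_assoc] using this
  · have : HasDerivAt (fun t => ‖x 0 - y 0‖ ^ 2 +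
        ∫ s in (0:ℝ)..t, 2 * ⟪x s - y s, F (x s) - F (y s)⟫_ℝ) _ s :=
      (intervalIntegral.integral_hasDerivAt_right (hc.intervalIntegrable _ _)
        (hc.stronglyMeasurableAtFilter _ _) hc.continuousAt).const_add _
    exact this.hasDerivWithinAt.congr (fun r hr => hid r hr) (hid s hs.1)
  · have h1 := real_inner_le_norm (x s - y s) (F (x s) - F (y s))
    have h2 := mul_le_mul_of_nonneg_left (hF (x s) (y s)) (norm_nonneg (x s - y s))
    nlinarith

end Evolution

/-! ### Existence of mild solutions as limits of dissipative approximations. -/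

section Evolution
open Filter Topology
variable {E : Type*} [NormedAddCommGroup E] [InnerProductSpace ℝ E] [CompleteSpace E]

/-- The dissipative part can only shrink the distance. The rate does not involve ‖L‖, so it is
uniform along the approximations. -/
theorem dissipative_norm_sub_le {L : E →L[ℝ] E} (hL : ∀ x, ⟪L x, x⟫_ℝ ≤ 0) {F : E → E} {k : ℝ}
    (hk : 0 ≤ k) (hF : ∀ x y, ‖F x - F y‖ ≤ k * ‖x - y‖) {x y : ℝ → E}
    (hx : ∀ t, 0 ≤ t → HasDerivWithinAt x (L (x t) + F (x t)) (Ici 0) t)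
    (hy : ∀ t, 0 ≤ t → HasDerivWithinAt y (L (y t) + F (y t)) (Ici 0) t) {t : ℝ} (ht : 0 ≤ t) :
    ‖x t - y t‖ ≤ Real.exp (k * t) * ‖x 0 - y 0‖ := by
  have := gronwall_of_hasDerivWithinAt (z := fun t => ‖x t - y t‖ ^ 2)
    (a := 2 * k) (b := 0) (T := t)
    (by positivity) le_rfl (fun s hs => ((hx s hs.1).sub (hy s hs.1)).norm_sq)
    (fun s hs => ?_) t ⟨ht, le_rfl⟩
  · refine norm_le_of_sq_le_exp (norm_nonneg _) ?_
    simpa [mul_assoc] using this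
  · have h1 := real_inner_le_norm (x s - y s) (F (x s) - F (y s))
    have h2 := mul_le_mul_of_nonneg_left (hF (x s) (y s)) (norm_nonneg (x s - y s))
    have h3 := hL (x s - y s)
    have e : L (x s) + F (x s) - (L (y s) + F (y s)) = L (x s - y s) + (F (x s) - F (y s)) := by
      rw [map_sub]; abel
    rw [real_inner_comm] at h3
    simp only [Pi.sub_apply] at *
    rw [e, inner_add_right]
    nlinarith

/-- The equation is autonomous, so x(· + h) is again a solution. Dividing the distance estimate for
x(· + h) and x by h and letting h → 0+ propagates the bound on the speed. -/
theorem dissipative_norm_deriv_le {L : E →L[ℝ] E} (hL : ∀ x, ⟪L x, x⟫_ℝ ≤ 0) {F : E → E} {k : ℝ}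
    (hk : 0 ≤ k) (hF : ∀ x y, ‖F x - F y‖ ≤ k * ‖x - y‖) {x : ℝ → E}
    (hx : ∀ t, 0 ≤ t → HasDerivWithinAt x (L (x t) + F (x t)) (Ici 0) t) {t : ℝ} (ht : 0 ≤ t) :
    ‖L (x t) + F (x t)‖ ≤ Real.exp (k * t) * ‖L (x 0) + F (x 0)‖ := by
  have shift : ∀ h, 0 ≤ h → ∀ s, 0 ≤ s → HasDerivWithinAt (fun s => x (s + h))
      (L (x (s + h)) + F (x (s + h))) (Ici 0) s := by
    intro h hh s hs
    have h1 : HasDerivWithinAt (fun s : ℝ => s + h) 1 (Ici 0) s :=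
      ((hasDerivAt_id s).add_const h).hasDerivWithinAt
    have := (hx (s + h) (add_nonneg hs hh)).scomp s h1 (fun r hr => add_nonneg hr hh)
    simpa [Function.comp_def] using this
  have slope_lim : ∀ s, 0 ≤ s → Tendsto (fun h => ‖h⁻¹ • (x (s + h) - x s)‖) (𝓝[>] 0)
      (𝓝 ‖L (x s) + F (x s)‖) := by
    intro s hs
    have h1 := (shift s hs 0 le_rfl).mono (Ioi_subset_Ici_self)
    rw [hasDerivWithinAt_iff_tendsto_slope' (by simp)] at h1
    refine (h1.norm).congr' ?_ |>.trans (by simp)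
    refine Eventually.of_forall fun h => ?_
    simp [slope_def_module, add_comm]
  have h0 := (slope_lim 0 le_rfl).const_mul (Real.exp (k * t))
  refine le_of_tendsto_of_tendsto (slope_lim t ht) h0 ?_
  filter_upwards [self_mem_nhdsWithin] with h hh
  have hh : 0 < h := hh
  have := dissipative_norm_sub_le hL hk hF (shift h hh.le) hx ht
  rw [norm_smul, norm_smul, mul_left_comm]
  gcongr

/-- Locally uniform limits of mild solutions are mild solutions. -/
theorem exists_isMildSolution_of_cauchy {K : E →L[ℝ] E} {Kn : ℕ → E →L[ℝ] E}
    (hKn : Tendsto Kn atTop (𝓝 K)) {F : E → E} (hF : Continuous F) {k : ℝ} (hk : 0 ≤ k)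
    (hFl : ∀ x y, ‖F x - F y‖ ≤ k * ‖x - y‖) {X : ℕ → ℝ → E}
    (hX : ∀ n, IsMildSolution (Kn n) F (X n))
    (hc : ∀ T, 0 ≤ T → UniformCauchySeqOn X atTop (Iic T)) :
    ∃ x, IsMildSolution K F x ∧ ∀ t, Tendsto (fun n => X n t) atTop (𝓝 (x t)) := by
  have hlim : ∀ t, ∃ y, Tendsto (fun n => X n t) atTop (𝓝 y) := fun t =>
    cauchySeq_tendsto_of_complete
      ((hc |t| (abs_nonneg t)).cauchySeq (show t ∈ Iic |t| from le_abs_self t))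
  choose x hx using hlim
  have hu : ∀ T, 0 ≤ T → TendstoUniformlyOn X x atTop (Iic T) := fun T hT =>
    (hc T hT).tendstoUniformlyOn_of_tendsto fun t _ => hx t
  have hxc : Continuous x := by
    refine continuous_iff_continuousAt.2 fun t => ?_
    have h1 : ContinuousOn x (Iic (|t| + 1)) :=
      (hu _ (by positivity)).continuousOn
        (Frequently.of_forall fun n => (hX n).continuous.continuousOn)
    exact h1.continuousAt (Iic_mem_nhds (by have := le_abs_self t; linarith))
  refine ⟨x, ⟨hxc, fun t ht => ?_⟩, hx⟩
  have clm : ∀ (y : ℕ → E) (z : E), Tendsto y atTop (𝓝 z) →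
      Tendsto (fun n => Kn n (y n)) atTop (𝓝 (K z)) := fun y z hy =>
    (isBoundedBilinearMap_apply.continuous.tendsto (K, z)).comp (hKn.prodMk_nhds hy)
  have hKx : ∀ t, Tendsto (fun n => Kn n (X n t)) atTop (𝓝 (K (x t))) := fun t =>
    clm _ _ (hx t)
  have hint : Tendsto (fun n => ∫ s in (0:ℝ)..t, (X n s + Kn n (F (X n s)))) atTop
      (𝓝 (∫ s in (0:ℝ)..t, (x s + K (F (x s))))) := by
    have hb1 : ∀ᶠ n in atTop, ∀ s ∈ Iic t, dist (x s) (X n s) < 1 :=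
      (Metric.tendstoUniformlyOn_iff.1 (hu t ht)) 1 one_pos
    have hb2 : ∀ᶠ n in atTop, ‖Kn n‖ < ‖K‖ + 1 :=
      hKn.norm.eventually_lt_const (by linarith)
    refine intervalIntegral.tendsto_integral_filter_of_dominated_convergence
      (fun s => (‖x s‖ + 1) + (‖K‖ + 1) * (‖F (x s)‖ + k)) (Eventually.of_forall fun n => ?_)
      ?_ ?_ (Eventually.of_forall fun s _ => ?_)
    · exact ((hX n).continuous.add ((Kn n).continuous.comp
        (hF.comp (hX n).continuous))).aestronglyMeasurable
    · filter_upwards [hb1, hb2] with n h1 h2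
      refine Eventually.of_forall fun s hs => ?_
      rw [uIoc_of_le ht] at hs
      have h3 := h1 s hs.2
      rw [dist_eq_norm, norm_sub_rev] at h3
      have h4 : ‖X n s‖ ≤ ‖x s‖ + 1 := by
        have := norm_sub_norm_le (X n s) (x s); linarith
      have h5 : ‖F (X n s)‖ ≤ ‖F (x s)‖ + k := by
        have h6 := norm_sub_norm_le (F (X n s)) (F (x s))
        have h7 := hFl (X n s) (x s)
        have := mul_le_mul_of_nonneg_left h3.le hk
        linarith
      refine (norm_add_le _ _).trans (add_le_add h4 ?_)
      exact ((Kn n).le_opNorm _).trans (mul_le_mul h2.le h5 (norm_nonneg _) (by positivity))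
    · exact (by fun_prop : Continuous fun s =>
        (‖x s‖ + 1) + (‖K‖ + 1) * (‖F (x s)‖ + k)).intervalIntegrable _ _
    · exact (hx s).add (clm _ _ ((hF.tendsto _).comp (hx s)))
  refine tendsto_nhds_unique (hKx t) ?_
  simpa only [(hX _).eq t ht] using (hKx 0).add hint

/-- The range of K plays the role of the domain of the generator. There ‖L n (K z)‖ ≤ ‖z‖ bounds the
initial speeds uniformly in n, so L n (X n) stays bounded on compact time intervals, and ‖X n − X
m‖² = O(ε n + ε m). -/
theorem exists_isMildSolution_of_range {K : E →L[ℝ] E} (hK : ∀ x, ⟪K x, x⟫_ℝ = 0)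
    {F : E → E} {k : ℝ} (hk : 0 ≤ k)
    (hF : ∀ x y, ‖F x - F y‖ ≤ k * ‖x - y‖) (z : E) :
    ∃ x, IsMildSolution K F x ∧ ∀ t ≤ 0, x t = K z := by
  obtain ⟨ε, L, hε, hε0, h1, h2, h3, h4⟩ := exists_yosida_seq K hK
  have hFc := continuous_of_norm_sub_le hk hF
  have hode : ∀ n, ∃ x : ℝ → E, Continuous x ∧ x 0 = K z ∧
      ∀ t, 0 ≤ t → HasDerivWithinAt x (L n (x t) + F (x t)) (Ici 0) t := by
    intro n
    refine exists_ode_solution (fun x => L n x + F x) (k := ‖L n‖ + k) (by positivity) ?_ (K z)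
    intro x y
    have e : L n x + F x - (L n y + F y) = L n (x - y) + (F x - F y) := by rw [map_sub]; abel
    rw [e, add_mul]
    exact (norm_add_le _ _).trans (add_le_add ((L n).le_opNorm _) (hF x y))
  choose X hXc hX0 hX using hode
  set M := ‖z‖ + ‖F (K z)‖ with hM
  have hder : ∀ n t, 0 ≤ t → ‖L n (X n t) + F (X n t)‖ ≤ Real.exp (k * t) * M := by
    intro n t ht
    refine (dissipative_norm_deriv_le (h3 n) hk hF (hX n) ht).trans ?_
    gcongr
    rw [hX0]
    exact (norm_add_le _ _).trans (add_le_add (h4 n z) le_rfl)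
  have hLb : ∀ T, 0 ≤ T → ∃ m, 0 ≤ m ∧ ∀ n, ∀ t ∈ Icc 0 T, ‖L n (X n t)‖ ≤ m := by
    intro T hT
    refine ⟨Real.exp (k * T) * M + (‖F (K z)‖ + k * (Real.exp (k * T) * M * T)), by positivity,
      fun n t ht => ?_⟩
    have hder' : ∀ s ∈ Icc 0 T, ‖L n (X n s) + F (X n s)‖ ≤ Real.exp (k * T) * M := by
      intro s hs
      refine (hder n s hs.1).trans ?_
      gcongr
      exact hs.2
    have h5 := (convex_Icc 0 T).norm_image_sub_le_of_norm_hasDerivWithin_le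
      (fun s hs => (hX n s hs.1).mono Icc_subset_Ici_self) hder' ⟨le_rfl, hT⟩ ht
    rw [hX0, sub_zero, Real.norm_of_nonneg ht.1] at h5
    have h6 := hF (X n t) (K z)
    have h7 := norm_sub_norm_le (F (X n t)) (F (K z))
    have h8 : ‖L n (X n t)‖ ≤ ‖L n (X n t) + F (X n t)‖ + ‖F (X n t)‖ := by
      have := norm_sub_le (L n (X n t) + F (X n t)) (F (X n t))
      rwa [add_sub_cancel_right] at this
    have h9 : Real.exp (k * T) * M * t ≤ Real.exp (k * T) * M * T := by
      gcongr
      exact ht.2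
    have h10 := mul_le_mul_of_nonneg_left (h5.trans h9) hk
    have := hder' t ht
    linarith
  have hdiff : ∀ T, 0 ≤ T → ∃ C, 0 ≤ C ∧ ∀ n m, ∀ t ∈ Icc 0 T,
      ‖X n t - X m t‖ ^ 2 ≤ C * (ε n + ε m) := by
    intro T hT
    obtain ⟨m₀, hm0, hm⟩ := hLb T hT
    refine ⟨Real.exp (2 * k * T) * (2 * m₀ ^ 2 * T), by positivity, fun n m t ht => ?_⟩
    have hεn := hε n
    have hεm := hε m
    have := gronwall_of_hasDerivWithinAt (z := fun t => ‖X n t - X m t‖ ^ 2)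
      (a := 2 * k) (b := 2 * m₀ ^ 2 * (ε n + ε m)) (T := T)
      (by positivity) (by positivity)
      (fun s hs => ((hX n s hs.1).sub (hX m s hs.1)).norm_sq)
      (fun s hs => ?_) t ht
    · simp only [hX0, sub_self, norm_zero, ne_eq, OfNat.ofNat_ne_zero, not_false_eq_true,
        zero_pow, zero_add] at this
      refine this.trans ?_
      rw [show Real.exp (2 * k * T) * (2 * m₀ ^ 2 * T) * (ε n + ε m) =
        Real.exp (2 * k * T) * (2 * m₀ ^ 2 * (ε n + ε m) * T) by ring]
      have := ht.1
      gcongr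
      exacts [ht.2, ht.2]
    · have i1 := real_inner_le_norm (X n s - X m s) (F (X n s) - F (X m s))
      have i2 := mul_le_mul_of_nonneg_left (hF (X n s) (X m s)) (norm_nonneg (X n s - X m s))
      set a := L n (X n s) with ha
      set b := L m (X m s) with hb
      have e1 : X n s = K a - ε n • a := by rw [ha, h2]; simp
      have e2 : X m s = K b - ε m • b := by rw [hb, h2]; simp
      -- Writing X n = K a − ε n a and X m = K b − ε m b removes K by skewness; only terms carrying
      -- a factor ε remain.
      have e3 : ⟪X n s - X m s, a - b⟫_ℝ = -(ε n * ‖a‖ ^ 2) - ε m * ‖b‖ ^ 2 +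
          (ε n + ε m) * ⟪a, b⟫_ℝ := by
        have : X n s - X m s = K (a - b) - (ε n • a - ε m • b) := by
          rw [e1, e2, map_sub]; abel
        rw [this, inner_sub_left, hK]
        simp only [inner_sub_left, inner_sub_right, real_inner_smul_left,
          real_inner_self_eq_norm_sq]
        rw [real_inner_comm a b]; ring
      have i3 : ⟪a, b⟫_ℝ ≤ m₀ ^ 2 := by
        refine (real_inner_le_norm a b).trans ?_
        rw [sq]
        exact mul_le_mul (hm n s hs) (hm m s hs) (norm_nonneg _) hm0
      have i4 := mul_le_mul_of_nonneg_left i3 (add_pos hεn hεm).le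
      have i5 : 0 ≤ ε n * ‖a‖ ^ 2 := by positivity
      have i6 : 0 ≤ ε m * ‖b‖ ^ 2 := by positivity
      have e : a + F (X n s) - (b + F (X m s)) = (a - b) + (F (X n s) - F (X m s)) := by abel
      simp only [Pi.sub_apply]
      rw [e, inner_add_right, e3]
      nlinarith
  -- `L n` inverts K − ε n, so `X n` is a mild solution for that operator, and these operators
  -- converge to K in norm.
  have hmild : ∀ n, IsMildSolution (K - ε n • ContinuousLinearMap.id ℝ E) F
      (fun t => X n (max t 0)) := by
    intro n
    have hc : Continuous fun t => X n (max t 0) := (hXc n).comp (by fun_prop)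
    refine ⟨hc, fun t ht => ?_⟩
    set Kn := K - ε n • ContinuousLinearMap.id ℝ E with hKn
    have hKn' : ∀ x, Kn x = K x - ε n • x := fun x => by simp [hKn]
    have hcc : Continuous fun s => X n (max s 0) + Kn (F (X n (max s 0))) :=
      hc.add (Kn.continuous.comp (hFc.comp hc))
    have := intervalIntegral.integral_eq_sub_of_hasDeriv_right_of_le ht
      (f := fun s => Kn (X n (max s 0)))
      (f' := fun s => X n (max s 0) + Kn (F (X n (max s 0))))
      (Kn.continuous.comp hc).continuousOn (fun s hs => ?_) (hcc.intervalIntegrable _ _)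
    · rw [this]; abel
    · have hd1 : HasDerivWithinAt (fun s => Kn (X n s)) (Kn (L n (X n s) + F (X n s))) (Ici 0) s :=
        Kn.hasFDerivAt.comp_hasDerivWithinAt s (hX n s hs.1.le)
      have hsub : Ioi s ⊆ Ici 0 := fun r hr => (hs.1.trans (show s < r from hr)).le
      refine ((hd1.mono hsub).congr_deriv ?_).congr (fun r hr => ?_) ?_
      · rw [map_add, max_eq_left hs.1.le, hKn' (L n (X n s)), h2]; simp
      · rw [max_eq_left (hsub hr)]
      · rw [max_eq_left hs.1.le]
  have hKn : Tendsto (fun n => K - ε n • ContinuousLinearMap.id ℝ E) atTop (𝓝 K) := by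
    simpa using tendsto_const_nhds.sub (hε0.smul_const (ContinuousLinearMap.id ℝ E))
  have hcau : ∀ T, 0 ≤ T → UniformCauchySeqOn (fun n t => X n (max t 0)) atTop (Iic T) := by
    intro T hT
    obtain ⟨C, hC, hCb⟩ := hdiff T hT
    rw [Metric.uniformCauchySeqOn_iff]
    intro δ hδ
    have hl : Tendsto (fun n => C * ε n) atTop (𝓝 0) := by simpa using hε0.const_mul C
    obtain ⟨N, hN⟩ := eventually_atTop.1
      (hl.eventually_lt_const (show 0 < δ ^ 2 / 2 by positivity))
    refine ⟨N, fun n hn m hm t ht => ?_⟩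
    rw [dist_eq_norm]
    refine lt_of_pow_lt_pow_left₀ 2 hδ.le ?_
    have h5 := hCb n m (max t 0) ⟨le_max_right _ _, max_le ht hT⟩
    have h6 := hN n hn
    have h7 := hN m hm
    linarith
  obtain ⟨x, hx, hxl⟩ := exists_isMildSolution_of_cauchy hKn hFc hk hF hmild hcau
  refine ⟨x, hx, fun t ht => tendsto_nhds_unique (hxl t) ?_⟩
  simp [max_eq_right ht, hX0]

/-- The equation `x' = K⁻¹ x + F x` with a Lipschitz `F` has a global mild solution. -/
theorem exists_isMildSolution {K : E →L[ℝ] E} (hK : ∀ x, ⟪K x, x⟫_ℝ = 0) (hd : DenseRange K)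
    {F : E → E} {k : ℝ} (hk : 0 ≤ k)
    (hF : ∀ x y, ‖F x - F y‖ ≤ k * ‖x - y‖) (x₀ : E) :
    ∃ x, IsMildSolution K F x ∧ x 0 = x₀ := by
  have hz : ∀ n : ℕ, ∃ z, dist x₀ (K z) < 1 / ((n:ℝ) + 1) := fun n =>
    hd.exists_dist_lt x₀ (by positivity)
  choose z hz using hz
  have hzl : Tendsto (fun n => K (z n)) atTop (𝓝 x₀) := by
    rw [tendsto_iff_dist_tendsto_zero]
    refine squeeze_zero (fun _ => dist_nonneg) (fun n => ?_)
      (tendsto_one_div_add_atTop_nhds_zero_nat (𝕜 := ℝ))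
    rw [dist_comm]; exact (hz n).le
  choose X hX hX0 using fun n => exists_isMildSolution_of_range hK hk hF (z n)
  -- General data are limits of data in the range of K, and Lipschitz dependence on the data makes
  -- the solutions converge.
  have hcau : ∀ T, 0 ≤ T → UniformCauchySeqOn X atTop (Iic T) := by
    intro T hT
    rw [Metric.uniformCauchySeqOn_iff]
    intro δ hδ
    obtain ⟨N, hN⟩ := Metric.cauchySeq_iff.1 hzl.cauchySeq (δ / Real.exp (k * T)) (by positivity)
    refine ⟨N, fun n hn m hm t ht => ?_⟩
    have h1 := hN n hn m hm
    rw [lt_div_iff₀ (Real.exp_pos _), mul_comm] at h1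
    have h2 : dist (X n t) (X m t) ≤ Real.exp (k * T) * dist (K (z n)) (K (z m)) := by
      rcases le_total 0 t with h0 | h0
      · have := IsMildSolution.norm_sub_le hK hd hk hF (hX n) (hX m) h0
        rw [hX0 n 0 le_rfl, hX0 m 0 le_rfl, ← dist_eq_norm, ← dist_eq_norm] at this
        refine this.trans ?_
        gcongr
        exact ht
      · rw [hX0 n t h0, hX0 m t h0]
        exact le_mul_of_one_le_left dist_nonneg (Real.one_le_exp (by positivity))
    exact h2.trans_lt h1
  obtain ⟨x, hx, hxl⟩ := exists_isMildSolution_of_cauchy (Kn := fun _ => K) (X := X)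
    tendsto_const_nhds (continuous_of_norm_sub_le hk hF) hk hF hX hcau
  refine ⟨x, hx, tendsto_nhds_unique (hxl 0) ?_⟩
  simpa only [hX0 _ 0 le_rfl] using hzl

end Evolution

/-! ### The wave equation with a force in V × H. -/

section Wave
open Filter Topology

/-- Pairing with each ψ reduces this to the scalar fundamental theorem of calculus. It upgrades a
weak derivative that is continuous to a strong one. -/
theorem eq_add_integral_of_weak {E : Type*} [NormedAddCommGroup E] [InnerProductSpace ℝ E]
    [CompleteSpace E] {y w : ℝ → E} (hw : Continuous w)
    (h : ∀ ψ : E, ∀ t, 0 ≤ t → HasDerivWithinAt (fun s => ⟪y s, ψ⟫_ℝ) ⟪w t, ψ⟫_ℝ (Ici 0) t)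
    {t : ℝ} (ht : 0 ≤ t) : y t = y 0 + ∫ s in (0:ℝ)..t, w s := by
  refine ext_inner_right ℝ fun ψ => ?_
  have h1 := intervalIntegral.integral_eq_sub_of_hasDeriv_right_of_le ht
    (f := fun s => ⟪y s, ψ⟫_ℝ) (f' := fun s => ⟪w s, ψ⟫_ℝ)
    (fun s hs => (h ψ s hs.1).continuousWithinAt.mono Icc_subset_Ici_self)
    (fun s hs => (h ψ s hs.1.le).mono fun r hr => (hs.1.trans (show s < r from hr)).le)
    ((hw.inner continuous_const).intervalIntegrable _ _)
  have h2 : ⟪∫ s in (0:ℝ)..t, w s, ψ⟫_ℝ = ∫ s in (0:ℝ)..t, ⟪w s, ψ⟫_ℝ := by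
    rw [real_inner_comm]
    have := (innerSL ℝ ψ).intervalIntegral_comp_comm (hw.intervalIntegrable (μ := volume) 0 t)
    simp only [innerSL_apply_apply] at this
    rw [← this]
    simp only [real_inner_comm]
  rw [inner_add_left, h2, h1]; ring

variable {V H : Type*} [NormedAddCommGroup V] [InnerProductSpace ℝ V] [CompleteSpace V]
  [NormedAddCommGroup H] [InnerProductSpace ℝ H] [CompleteSpace H]

/-- The inverse of the generator `(u, v) ↦ (v, -ι†⁻¹ u)` of the wave group on `V × H`. -/
def waveInv (ι : V →L[ℝ] H) : WithLp 2 (V × H) →L[ℝ] WithLp 2 (V × H) :=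
  (WithLp.prodContinuousLinearEquiv 2 ℝ V H).symm.toContinuousLinearMap ∘L
    ((-((ContinuousLinearMap.adjoint ι) ∘L ContinuousLinearMap.snd ℝ V H)).prod
      (ι ∘L ContinuousLinearMap.fst ℝ V H)) ∘L
    (WithLp.prodContinuousLinearEquiv 2 ℝ V H).toContinuousLinearMap

theorem waveInv_fst (ι : V →L[ℝ] H) (x : WithLp 2 (V × H)) :
    (waveInv ι x).fst = -(ContinuousLinearMap.adjoint ι x.snd) := rfl

theorem waveInv_snd (ι : V →L[ℝ] H) (x : WithLp 2 (V × H)) :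
    (waveInv ι x).snd = ι x.fst := rfl

theorem waveInv_inner (ι : V →L[ℝ] H) (x y : WithLp 2 (V × H)) :
    ⟪waveInv ι x, y⟫_ℝ = ⟪ι x.fst, y.snd⟫_ℝ - ⟪x.snd, ι y.fst⟫_ℝ := by
  rw [WithLp.prod_inner_apply]
  change ⟪(waveInv ι x).fst, y.fst⟫_ℝ + ⟪(waveInv ι x).snd, y.snd⟫_ℝ = _
  rw [waveInv_fst, waveInv_snd, inner_neg_left, ContinuousLinearMap.adjoint_inner_left]; ring

theorem waveInv_skew (ι : V →L[ℝ] H) (x : WithLp 2 (V × H)) : ⟪waveInv ι x, x⟫_ℝ = 0 := by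
  rw [waveInv_inner, real_inner_comm]; ring

/-- For y orthogonal to the range, the pair (0, ι y.fst) shows ι y.fst = 0, and the pairs (u, 0)
show that y.snd is orthogonal to the range of ι. Injectivity and density of ι finish. -/
theorem denseRange_waveInv {ι : V →L[ℝ] H} (hi : Function.Injective ι) (hd : DenseRange ι) :
    DenseRange (waveInv ι) := by
  have h : (LinearMap.range (waveInv ι).toLinearMap)ᗮ = ⊥ := by
    rw [Submodule.eq_bot_iff]
    intro y hy
    have h0 : ∀ x : WithLp 2 (V × H), ⟪ι x.fst, y.snd⟫_ℝ - ⟪x.snd, ι y.fst⟫_ℝ = 0 := fun x => by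
      rw [← waveInv_inner]; exact hy _ ⟨x, rfl⟩
    have h1 : ι y.fst = 0 := by
      have := h0 (WithLp.toLp 2 (0, ι y.fst))
      simpa using this
    have h2 : y.snd = 0 := by
      refine hd.induction_on (p := fun z => ⟪z, y.snd⟫_ℝ = 0) y.snd ?_ ?_ |> inner_self_eq_zero.1
      · exact isClosed_eq (continuous_id.inner continuous_const) continuous_const
      · intro u
        have := h0 (WithLp.toLp 2 (u, 0))
        simpa using this
    have h3 : y.fst = 0 := hi (by rw [h1, map_zero])
    exact (WithLp.equiv 2 (V × H)).injective (Prod.ext h3 h2)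
  have := (Submodule.topologicalClosure_eq_top_iff).2 h
  rw [← Submodule.dense_iff_topologicalClosure_eq_top] at this
  exact this

/-- `u` solves `u'' + ι†⁻¹ u = g` weakly on `[0, ∞)`, with `v = u'`. -/
structure IsForced (ι : V →L[ℝ] H) (u : ℝ → V) (v g : ℝ → H) : Prop where
  contU : ContinuousOn u (Ici 0)
  contV : ContinuousOn v (Ici 0)
  contG : ContinuousOn g (Ici 0)
  deriv : ∀ t, 0 ≤ t → HasDerivWithinAt (fun s => ι (u s)) (v t) (Ici 0) t
  weak : ∀ φ : V, ∀ t, 0 ≤ t → HasDerivWithinAt (fun s => ⟪v s, ι φ⟫_ℝ)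
    (⟪g t, ι φ⟫_ℝ - ⟪u t, φ⟫_ℝ) (Ici 0) t

variable {ι : V →L[ℝ] H} {u : ℝ → V} {v g : ℝ → H}

theorem IsForced.sub {u' : ℝ → V} {v' g' : ℝ → H} (h : IsForced ι u v g)
    (h' : IsForced ι u' v' g') :
    IsForced ι (fun t => u t - u' t) (fun t => v t - v' t) (fun t => g t - g' t) where
  contU := h.contU.sub h'.contU
  contV := h.contV.sub h'.contV
  contG := h.contG.sub h'.contG
  deriv t ht := by simp only [map_sub]; exact (h.deriv t ht).sub (h'.deriv t ht)
  weak φ t ht := by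
    simp only [inner_sub_left]
    exact ((h.weak φ t ht).sub (h'.weak φ t ht)).congr_deriv (by ring)

theorem IsForced.congr {g' : ℝ → H} (h : IsForced ι u v g) (hg : ∀ t, 0 ≤ t → g t = g' t) :
    IsForced ι u v g' where
  contU := h.contU
  contV := h.contV
  contG := h.contG.congr fun t ht => (hg t ht).symm
  deriv := h.deriv
  weak φ t ht := by rw [← hg t ht]; exact h.weak φ t ht

theorem continuous_comp_max {α : Type*} [TopologicalSpace α] {f : ℝ → α}
    (hf : ContinuousOn f (Ici 0)) : Continuous fun t => f (max t 0) :=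
  hf.comp_continuous (by fun_prop) fun t => le_max_right t 0

/-- `v` is differentiable only against test vectors, so its squared norm cannot be differentiated
directly. The weak equations say precisely that (Kx)' = x + K(0, g) for x = (u, v) and K = `waveInv
ι`, and `energy_identity` applies. -/
theorem IsForced.hasDerivWithinAt_norm_sq (hi : Function.Injective ι) (hd : DenseRange ι) (h : IsForced ι u v g)
    {t : ℝ} (ht : 0 ≤ t) :
    HasDerivWithinAt (fun s => ‖u s‖ ^ 2 + ‖v s‖ ^ 2) (2 * ⟪g t, v t⟫_ℝ) (Ici 0) t := by
  have hu := continuous_comp_max h.contU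
  have hv := continuous_comp_max h.contV
  have hg := continuous_comp_max h.contG
  set x : ℝ → WithLp 2 (V × H) := fun t => WithLp.toLp 2 (u (max t 0), v (max t 0)) with hx
  set G : ℝ → WithLp 2 (V × H) := fun t => WithLp.toLp 2 (0, g (max t 0)) with hG
  have hxc : Continuous x := (WithLp.prod_continuous_toLp 2 V H).comp (hu.prodMk hv)
  have hGc : Continuous G := (WithLp.prod_continuous_toLp 2 V H).comp (continuous_const.prodMk hg)
  have hxs : ∀ t, ‖x t‖ ^ 2 = ‖u (max t 0)‖ ^ 2 + ‖v (max t 0)‖ ^ 2 := fun t =>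
    WithLp.prod_norm_sq_eq_of_L2 _
  have hin : ∀ t, ⟪x t, G t⟫_ℝ = ⟪g (max t 0), v (max t 0)⟫_ℝ := fun t => by
    rw [WithLp.prod_inner_apply, real_inner_comm (v (max t 0))]; simp [hx, hG]
  have key : ∀ t, 0 ≤ t → waveInv ι (x t) = waveInv ι (x 0) +
      ∫ s in (0:ℝ)..t, (x s + waveInv ι (G s)) := by
    intro t ht
    refine eq_add_integral_of_weak (y := fun t => waveInv ι (x t))
      (w := fun s => x s + waveInv ι (G s)) (hxc.add ((waveInv ι).continuous.comp hGc)) (fun ψ s hs => ?_) ht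
    simp only [waveInv_inner, inner_add_left]
    have h1 := ((h.deriv s hs).inner ℝ (hasDerivWithinAt_const s (Ici 0) ψ.snd)).sub
      (h.weak ψ.fst s hs)
    refine (h1.congr (fun r hr => ?_) ?_).congr_deriv ?_
    · simp only [hx, max_eq_left (show (0:ℝ) ≤ r from hr)]; rfl
    · simp only [hx, max_eq_left hs]; rfl
    · rw [inner_zero_right, WithLp.prod_inner_apply]
      simp only [hx, hG, max_eq_left hs]
      change _ = ⟪u s, ψ.fst⟫_ℝ + ⟪v s, ψ.snd⟫_ℝ + (⟪ι 0, ψ.snd⟫_ℝ - ⟪g s, ι ψ.fst⟫_ℝ)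
      rw [map_zero, inner_zero_left]
      ring
  have hid := fun t (ht : 0 ≤ t) => energy_identity (waveInv_skew ι) (denseRange_waveInv hi hd)
    hxc hGc key ht
  have hc : Continuous fun s => 2 * ⟪x s, G s⟫_ℝ := continuous_const.mul (hxc.inner hGc)
  have hD : HasDerivAt (fun t => ‖x 0‖ ^ 2 + ∫ s in (0:ℝ)..t, 2 * ⟪x s, G s⟫_ℝ) _ t :=
    (intervalIntegral.integral_hasDerivAt_right (hc.intervalIntegrable _ _)
      (hc.stronglyMeasurableAtFilter _ _) hc.continuousAt).const_add _
  have hD' := hD.hasDerivWithinAt (s := Ici 0) |>.congr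
    (f₁ := fun s => ‖u s‖ ^ 2 + ‖v s‖ ^ 2) (fun r hr => ?_) ?_
  · refine hD'.congr_deriv ?_
    rw [hin, max_eq_left ht]
  · rw [← hid r hr, hxs, max_eq_left (show (0:ℝ) ≤ r from hr)]
  · rw [← hid t ht, hxs, max_eq_left ht]

/-- Global solvability of `u'' + ι†⁻¹ u = F(u, u')` for Lipschitz `F`. -/
theorem exists_isForced (hi : Function.Injective ι) (hd : DenseRange ι)
    {F : WithLp 2 (V × H) → H} {k : ℝ} (hk : 0 ≤ k)
    (hF : ∀ x y, ‖F x - F y‖ ≤ k * ‖x - y‖) (u₀ : V) (u₁ : H) :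
    ∃ (u : ℝ → V) (v : ℝ → H), IsForced ι u v (fun t => F (WithLp.toLp 2 (u t, v t))) ∧
      u 0 = u₀ ∧ v 0 = u₁ := by
  have hF' : ∀ x y, ‖(WithLp.toLp 2 ((0:V), F x)) - WithLp.toLp 2 ((0:V), F y)‖ ≤ k * ‖x - y‖ := by
    intro x y
    rw [← WithLp.toLp_sub, Prod.mk_sub_mk, sub_zero, WithLp.norm_toLp_snd]
    exact hF x y
  obtain ⟨x, hx, hx0⟩ := exists_isMildSolution (waveInv_skew ι) (denseRange_waveInv hi hd)
    (F := fun x => WithLp.toLp 2 ((0:V), F x)) hk hF' (WithLp.toLp 2 (u₀, u₁))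
  have hxc := hx.continuous
  have hof := (WithLp.prod_continuous_ofLp 2 V H).comp hxc
  have hFc := continuous_of_norm_sub_le hk hF'
  have hder : ∀ t, 0 ≤ t → HasDerivWithinAt (fun s => waveInv ι (x s))
      (x t + waveInv ι (WithLp.toLp 2 ((0:V), F (x t)))) (Ici 0) t := by
    intro t ht
    have hc : Continuous fun s => x s + waveInv ι (WithLp.toLp 2 ((0:V), F (x s))) :=
      hxc.add ((waveInv ι).continuous.comp (hFc.comp hxc))
    have : HasDerivAt (fun t => waveInv ι (x 0) +
        ∫ s in (0:ℝ)..t, (x s + waveInv ι (WithLp.toLp 2 ((0:V), F (x s))))) _ t :=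
      (intervalIntegral.integral_hasDerivAt_right (hc.intervalIntegrable _ _)
        (hc.stronglyMeasurableAtFilter _ _) hc.continuousAt).const_add _
    exact this.hasDerivWithinAt.congr (fun r hr => hx.eq r hr) (hx.eq t ht)
  -- Pairing with (0, ψ) will give (ιu)' = v, and pairing with (φ, 0) the weak equation.
  have hsnd : ∀ ψ : WithLp 2 (V × H), ∀ t, 0 ≤ t → HasDerivWithinAt
      (fun s => ⟪ι (x s).fst, ψ.snd⟫_ℝ - ⟪(x s).snd, ι ψ.fst⟫_ℝ)
      (⟪(x t).fst, ψ.fst⟫_ℝ + ⟪(x t).snd, ψ.snd⟫_ℝ - ⟪F (x t), ι ψ.fst⟫_ℝ) (Ici 0) t := by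
    intro ψ t ht
    have h1 := (hder t ht).inner ℝ (hasDerivWithinAt_const t (Ici 0) ψ)
    simp only [waveInv_inner, inner_add_left, inner_zero_right, zero_add] at h1
    refine h1.congr_deriv ?_
    rw [WithLp.prod_inner_apply]
    simp
    rfl
  have hev : Continuous fun s => (x s).snd := hof.snd
  refine ⟨fun t => (x t).fst, fun t => (x t).snd,
    ⟨hof.fst.continuousOn, hof.snd.continuousOn, ?_, fun t ht => ?_, fun φ t ht => ?_⟩,
    by simp only [hx0]; rfl, by simp only [hx0]; rfl⟩
  · exact ((continuous_of_norm_sub_le hk hF).comp hxc).continuousOn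
  · have h1 : ∀ s, 0 ≤ s → ι (x s).fst = ι (x 0).fst + ∫ r in (0:ℝ)..s, (x r).snd := fun s hs =>
      eq_add_integral_of_weak (y := fun s => ι (x s).fst) hev (fun ψ r hr => by
        have := hsnd (WithLp.toLp 2 (0, ψ)) r hr
        simpa using this) hs
    have : HasDerivAt (fun s => ι (x 0).fst + ∫ r in (0:ℝ)..s, (x r).snd) _ t :=
      (intervalIntegral.integral_hasDerivAt_right (hev.intervalIntegrable _ _)
        (hev.stronglyMeasurableAtFilter _ _) hev.continuousAt).const_add _
    exact this.hasDerivWithinAt.congr (fun r hr => h1 r hr) (h1 t ht)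
  · have h1 : HasDerivWithinAt (fun s => ⟪ι (x s).fst, (0 : H)⟫_ℝ - ⟪(x s).snd, ι φ⟫_ℝ)
        (⟪(x t).fst, φ⟫_ℝ + ⟪(x t).snd, (0 : H)⟫_ℝ - ⟪F (x t), ι φ⟫_ℝ) (Ici 0) t :=
      hsnd (WithLp.toLp 2 (φ, 0)) t ht
    simp only [inner_zero_right, zero_sub, add_zero] at h1
    have := h1.neg
    refine (this.congr (fun r hr => ?_) ?_).congr_deriv ?_
    · exact (neg_neg _).symm.trans (by simp)
    · exact (neg_neg _).symm.trans (by simp)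
    · change -(⟪(x t).fst, φ⟫_ℝ - ⟪F (x t), ι φ⟫_ℝ) = ⟪F (x t), ι φ⟫_ℝ - ⟪(x t).fst, φ⟫_ℝ
      ring

/-- The product rule for `⟪a, v⟫` when `v` is only differentiable against the value `a t`. -/
theorem hasDerivWithinAt_inner_of_weak {a v : ℝ → H} {a' : H} {d t : ℝ} {S : Set ℝ}
    (ha : HasDerivWithinAt a a' S t) (hv : ContinuousWithinAt v S t)
    (hw : HasDerivWithinAt (fun s => ⟪v s, a t⟫_ℝ) d S t) :
    HasDerivWithinAt (fun s => ⟪a s, v s⟫_ℝ) (⟪a', v t⟫_ℝ + d) S t := by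
  -- The factor a s − a t vanishes at t, so continuity of v is enough here.
  have h1 : HasDerivWithinAt (fun s => ⟪a s - a t, v s⟫_ℝ) ⟪a', v t⟫_ℝ S t := by
    rw [hasDerivWithinAt_iff_tendsto_slope] at ha ⊢
    have h2 := ha.inner (𝕜 := ℝ) (hv.mono_left (nhdsWithin_mono t sdiff_subset))
    refine h2.congr fun s => ?_
    simp [slope_def_module, real_inner_smul_left]
  refine (h1.add hw).congr_of_eventuallyEq (Eventually.of_forall fun s => ?_) ?_
  · simp only [Pi.add_apply, inner_sub_left]; rw [real_inner_comm (v s) (a t)]; ring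
  · simp only [Pi.add_apply, inner_sub_left]; rw [real_inner_comm (v t) (a t)]; ring

end Wave

/-! ### The damped semilinear equation: energy, global existence, uniqueness. -/

section Semilinear
open Filter Topology

section Retraction
variable {V : Type*} [NormedAddCommGroup V] [NormedSpace ℝ V]

/-- The radial retraction onto the closed ball of radius `R`. -/
def ballRetract (R : ℝ) (x : V) : V := (R / max R ‖x‖) • x

theorem ballRetract_eq_self {R : ℝ} (hR : 0 < R) {x : V} (hx : ‖x‖ ≤ R) : ballRetract R x = x := by
  rw [ballRetract, max_eq_left hx, div_self hR.ne', one_smul]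

theorem norm_ballRetract_le {R : ℝ} (hR : 0 < R) (x : V) : ‖ballRetract R x‖ ≤ R := by
  have hm : 0 < max R ‖x‖ := lt_max_of_lt_left hR
  rw [ballRetract, norm_smul, Real.norm_of_nonneg (by positivity), div_mul_eq_mul_div,
    div_le_iff₀ hm]
  gcongr
  exact le_max_right _ _

/-- Changing the vector with the scalar fixed and changing the scalar with the vector fixed cost ‖x
− y‖ each. -/
theorem norm_ballRetract_sub_le {R : ℝ} (hR : 0 < R) (x y : V) :
    ‖ballRetract R x - ballRetract R y‖ ≤ 2 * ‖x - y‖ := by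
  set a := max R ‖x‖ with ha
  set b := max R ‖y‖ with hb
  have ha0 : 0 < a := lt_max_of_lt_left hR
  have hb0 : 0 < b := lt_max_of_lt_left hR
  have e : ballRetract R x - ballRetract R y = (R / a) • (x - y) + (R / a - R / b) • y := by
    rw [ballRetract, ballRetract, smul_sub, sub_smul]; abel
  have h1 : ‖(R / a) • (x - y)‖ ≤ ‖x - y‖ := by
    rw [norm_smul, Real.norm_of_nonneg (by positivity)]
    exact mul_le_of_le_one_left (norm_nonneg _) ((div_le_one ha0).2 (le_max_left _ _))
  have h2 : |b - a| ≤ ‖x - y‖ := by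
    have h3 := abs_max_sub_max_le_max R ‖y‖ R ‖x‖
    rw [sub_self, abs_zero, max_eq_right (abs_nonneg (‖y‖ - ‖x‖))] at h3
    refine h3.trans ?_
    rw [norm_sub_rev]
    exact abs_norm_sub_norm_le y x
  have h4 : ‖(R / a - R / b) • y‖ ≤ ‖x - y‖ := by
    have e2 : R / a - R / b = (R / a) * ((b - a) / b) := by field_simp
    rw [norm_smul, e2, norm_mul, Real.norm_of_nonneg (show 0 ≤ R / a by positivity), norm_div,
      Real.norm_of_nonneg hb0.le, Real.norm_eq_abs]
    calc R / a * (|b - a| / b) * ‖y‖ = (R / a) * (‖y‖ / b) * |b - a| := by ring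
      _ ≤ 1 * 1 * ‖x - y‖ := by
        gcongr
        · exact (div_le_one ha0).2 (le_max_left _ _)
        · exact (div_le_one hb0).2 (le_max_right _ _)
      _ = ‖x - y‖ := by ring
  rw [e]
  have := norm_add_le ((R / a) • (x - y)) ((R / a - R / b) • y)
  linarith

end Retraction

variable {V H : Type*} [NormedAddCommGroup V] [InnerProductSpace ℝ V] [CompleteSpace V]
  [NormedAddCommGroup H] [InnerProductSpace ℝ H] [CompleteSpace H]

/-- `f` is the gradient of the convex function `Φ`, homogeneous of degree `p + 2`, with the
continuity and growth of a power nonlinearity. -/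
structure IsPowerGradient (ι : V →L[ℝ] H) (p : ℝ) (f : V → H) (Φ : V → ℝ) : Prop where
  lip : ∀ R, ∃ k, 0 ≤ k ∧ ∀ u w, ‖u‖ ≤ R → ‖w‖ ≤ R → ‖f u - f w‖ ≤ k * ‖u - w‖
  convex : ∀ u w, ⟪f u, ι w - ι u⟫_ℝ ≤ Φ w - Φ u
  euler : ∀ u, ⟪f u, ι u⟫_ℝ = (p + 2) * Φ u
  lower : ∃ c, 0 < c ∧ ∀ u, c * ‖ι u‖ ^ (p + 2) ≤ Φ u
  growth : ∃ C, 0 ≤ C ∧ ∀ u, ‖f u‖ ≤ C * ‖u‖ ^ (p + 1)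

variable {ι : V →L[ℝ] H} {p : ℝ} {f : V → H} {Φ : V → ℝ} {u : ℝ → V} {v g : ℝ → H}

theorem IsPowerGradient.continuous (hf : IsPowerGradient ι p f Φ) : Continuous f := by
  refine continuous_iff_continuousAt.2 fun u => ?_
  obtain ⟨k, hk, h⟩ := hf.lip (‖u‖ + 1)
  have h1 : LipschitzOnWith k.toNNReal f (Metric.ball u 1) := by
    refine LipschitzOnWith.of_dist_le_mul fun x hx y hy => ?_
    have hb : ∀ x ∈ Metric.ball u 1, ‖x‖ ≤ ‖u‖ + 1 := fun x hx => by
      have h2 := norm_sub_norm_le x u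
      rw [Metric.mem_ball, dist_eq_norm] at hx
      linarith
    rw [dist_eq_norm, dist_eq_norm, Real.coe_toNNReal k hk]
    exact h x y (hb x hx) (hb y hy)
  exact h1.continuousOn.continuousAt (Metric.ball_mem_nhds u one_pos)

theorem IsPowerGradient.nonneg (hf : IsPowerGradient ι p f Φ) (u : V) : 0 ≤ Φ u := by
  obtain ⟨c, hc, h⟩ := hf.lower
  exact le_trans (by positivity) (h u)

/-- A chain rule that needs differentiability of u only in H. Convexity at u(t) and at u(s) traps
the Taylor remainder between 0 and ⟪f(u s) − f(u t), ιu(s) − ιu(t)⟫, a product of an o(1) and an O(s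
− t). -/
theorem IsPowerGradient.hasDerivWithinAt (hf : IsPowerGradient ι p f Φ) {a : H} {t : ℝ} {S : Set ℝ}
    (hu : ContinuousWithinAt u S t) (hd : HasDerivWithinAt (fun s => ι (u s)) a S t) :
    HasDerivWithinAt (fun s => Φ (u s)) ⟪f (u t), a⟫_ℝ S t := by
  have h1 : HasDerivWithinAt (fun s => ⟪f (u t), ι (u s)⟫_ℝ) ⟪f (u t), a⟫_ℝ S t := by
    simpa using (hasDerivWithinAt_const t S (f (u t))).inner ℝ hd
  have h2 : HasDerivWithinAt (fun s => Φ (u s) - ⟪f (u t), ι (u s)⟫_ℝ) 0 S t := by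
    rw [hasDerivWithinAt_iff_isLittleO]
    have hO : (fun s => ι (u s) - ι (u t)) =O[𝓝[S] t] fun s => s - t :=
      hd.hasFDerivWithinAt.isBigO_sub
    have ho : (fun s => f (u s) - f (u t)) =o[𝓝[S] t] fun _ => (1 : ℝ) := by
      rw [Asymptotics.isLittleO_one_iff]
      have : Tendsto (fun s => f (u s)) (𝓝[S] t) (𝓝 (f (u t))) :=
        hf.continuous.continuousAt.comp_continuousWithinAt hu
      simpa using this.sub_const (f (u t))
    have hp : (fun s => ‖f (u s) - f (u t)‖ * ‖ι (u s) - ι (u t)‖) =o[𝓝[S] t] fun s => s - t := by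
      simpa using ho.norm_left.mul_isBigO hO.norm_left
    refine (Asymptotics.IsBigO.of_bound' (Eventually.of_forall fun s => ?_)).trans_isLittleO hp
    have i1 := hf.convex (u t) (u s)
    have i2 := hf.convex (u s) (u t)
    have i3 := real_inner_le_norm (f (u s) - f (u t)) (ι (u s) - ι (u t))
    simp only [inner_sub_left, inner_sub_right] at i1 i2 i3
    rw [Real.norm_eq_abs, Real.norm_of_nonneg (by positivity), smul_zero, sub_zero, abs_le]
    constructor <;> nlinarith [mul_nonneg (norm_nonneg (f (u s) - f (u t)))
      (norm_nonneg (ι (u s) - ι (u t)))]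
  refine ((h1.add h2).congr (fun s _ => ?_) ?_).congr_deriv (add_zero _)
  · simp only [Pi.add_apply]; ring
  · simp only [Pi.add_apply]; ring

/-- The energy of the state `(u, v)`. -/
def energy (ι : V →L[ℝ] H) (Φ : V → ℝ) (u : V) (v : H) : ℝ :=
  (‖u‖ ^ 2 - ‖ι u‖ ^ 2) / 2 + ‖v‖ ^ 2 / 2 + Φ u

theorem IsForced.hasDerivWithinAt_energy (hi : Function.Injective ι) (hd : DenseRange ι)
    (hf : IsPowerGradient ι p f Φ) (h : IsForced ι u v g) {t : ℝ} (ht : 0 ≤ t) :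
    HasDerivWithinAt (fun s => energy ι Φ (u s) (v s))
      (⟪g t, v t⟫_ℝ - ⟪ι (u t), v t⟫_ℝ + ⟪f (u t), v t⟫_ℝ) (Ici 0) t := by
  have h1 := h.hasDerivWithinAt_norm_sq hi hd ht
  have h2 := (h.deriv t ht).norm_sq
  have h3 := hf.hasDerivWithinAt (h.contU t ht) (h.deriv t ht)
  refine ((((h1.sub h2).div_const 2).add h3).congr (fun s _ => ?_) ?_).congr_deriv ?_
  · simp only [energy, Pi.add_apply, Pi.sub_apply]; ring
  · simp only [energy, Pi.add_apply, Pi.sub_apply]; ring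
  · ring

/-- `u` solves `u'' + u' + A u + f u = 0` weakly on `[0, ∞)`, with `v = u'`, where
`1 + A = ι†⁻¹`. -/
def IsDampedSolution (ι : V →L[ℝ] H) (f : V → H) (u : ℝ → V) (v : ℝ → H) : Prop :=
  IsForced ι u v fun t => ι (u t) - v t - f (u t)

theorem IsDampedSolution.hasDerivWithinAt_energy (hi : Function.Injective ι) (hd : DenseRange ι)
    (hf : IsPowerGradient ι p f Φ) (h : IsDampedSolution ι f u v) {t : ℝ} (ht : 0 ≤ t) :
    HasDerivWithinAt (fun s => energy ι Φ (u s) (v s)) (-‖v t‖ ^ 2) (Ici 0) t := by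
  refine (IsForced.hasDerivWithinAt_energy hi hd hf h ht).congr_deriv ?_
  simp only [inner_sub_left, real_inner_self_eq_norm_sq]; ring

theorem IsDampedSolution.energy_antitoneOn (hi : Function.Injective ι) (hd : DenseRange ι)
    (hf : IsPowerGradient ι p f Φ) (h : IsDampedSolution ι f u v) :
    AntitoneOn (fun s => energy ι Φ (u s) (v s)) (Ici 0) :=
  antitoneOn_of_hasDerivWithinAt_nonpos (convex_Ici 0)
    (fun s hs => (h.hasDerivWithinAt_energy hi hd hf hs).continuousWithinAt)
    (fun s hs => (h.hasDerivWithinAt_energy hi hd hf (interior_subset hs)).mono interior_subset)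
    (fun s _ => neg_nonpos.2 (by positivity))

/-- The quadratic part of the energy controls only ‖u‖² − ‖ιu‖²; the missing ‖ιu‖ is controlled
through the lower bound on Φ. -/
theorem IsPowerGradient.norm_le_of_energy_le (hp : 0 < p) (hf : IsPowerGradient ι p f Φ)
    (hι : ∀ u, ‖ι u‖ ≤ ‖u‖) (e : ℝ) :
    ∃ R, 0 < R ∧ ∀ u v, energy ι Φ u v ≤ e → ‖u‖ < R := by
  obtain ⟨c, hc, h⟩ := hf.lower
  refine ⟨2 * |e| + (|e| / c) ^ (1 / (p + 2)) + 1 + 1, by positivity, fun u v he => ?_⟩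
  have h1 := h u
  have h2 : ‖ι u‖ ^ 2 ≤ ‖u‖ ^ 2 := by gcongr; exact hι u
  have h3 := hf.nonneg u
  have h4 := le_abs_self e
  rw [energy] at he
  have h5 : ‖ι u‖ ≤ (|e| / c) ^ (1 / (p + 2)) := by
    rw [one_div, Real.le_rpow_inv_iff_of_pos (norm_nonneg _) (by positivity) (by positivity),
      le_div_iff₀ hc, mul_comm]
    nlinarith [sq_nonneg ‖v‖]
  set q := (|e| / c) ^ (1 / (p + 2))
  have h6 : ‖u‖ ^ 2 ≤ 2 * |e| + q ^ 2 := by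
    have : ‖ι u‖ ^ 2 ≤ q ^ 2 := by gcongr
    nlinarith [sq_nonneg ‖v‖]
  have h7 : 0 ≤ q := (norm_nonneg _).trans h5
  refine lt_of_pow_lt_pow_left₀ 2 (by positivity) (h6.trans_lt ?_)
  nlinarith [abs_nonneg e, mul_nonneg (abs_nonneg e) h7]

/-- Global existence for the damped equation. -/
theorem exists_isDampedSolution (hi : Function.Injective ι) (hd : DenseRange ι)
    (hι : ∀ u, ‖ι u‖ ≤ ‖u‖) (hp : 0 < p) (hf : IsPowerGradient ι p f Φ) (u₀ : V) (u₁ : H) :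
    ∃ u v, IsDampedSolution ι f u v ∧ u 0 = u₀ ∧ v 0 = u₁ := by
  -- Precomposing f with the retraction onto the ball of radius R makes the force globally
  -- Lipschitz. States whose energy does not exceed the initial one lie strictly inside that ball,
  -- so the truncation is never felt.
  obtain ⟨R, hR, hRb⟩ := hf.norm_le_of_energy_le hp hι (energy ι Φ u₀ u₁)
  obtain ⟨k, hk, hkl⟩ := hf.lip R
  have hF : ∀ x y : WithLp 2 (V × H),
      ‖(ι x.fst - x.snd - f (ballRetract R x.fst)) - (ι y.fst - y.snd - f (ballRetract R y.fst))‖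
        ≤ (2 + 2 * k) * ‖x - y‖ := by
    intro x y
    have h1 : ‖x.fst - y.fst‖ ≤ ‖x - y‖ := WithLp.norm_fst_le (x := x - y)
    have h2 : ‖x.snd - y.snd‖ ≤ ‖x - y‖ := WithLp.norm_snd_le (x := x - y)
    have h3 := hkl _ _ (norm_ballRetract_le hR x.fst) (norm_ballRetract_le hR y.fst)
    have h4 := mul_le_mul_of_nonneg_left (norm_ballRetract_sub_le hR x.fst y.fst) hk
    have h5 := hι (x.fst - y.fst)
    have e : (ι x.fst - x.snd - f (ballRetract R x.fst)) -
        (ι y.fst - y.snd - f (ballRetract R y.fst)) = ι (x.fst - y.fst) - (x.snd - y.snd) -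
        (f (ballRetract R x.fst) - f (ballRetract R y.fst)) := by rw [map_sub]; abel
    rw [e]
    have h6 := norm_sub_le (ι (x.fst - y.fst) - (x.snd - y.snd))
      (f (ballRetract R x.fst) - f (ballRetract R y.fst))
    have h7 := norm_sub_le (ι (x.fst - y.fst)) (x.snd - y.snd)
    have h8 := mul_le_mul_of_nonneg_left h1 hk
    linarith
  obtain ⟨u, v, h, hu0, hv0⟩ := exists_isForced hi hd (by positivity) hF u₀ u₁
  have h : IsForced ι u v (fun t => ι (u t) - v t - f (ballRetract R (u t))) := h
  have hbound : ∀ t, 0 ≤ t → ‖u t‖ < R := by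
    -- At the first time τ with ‖u τ‖ ≥ R, the true energy has not increased on [0, τ], which gives
    -- ‖u τ‖ < R.
    by_contra! hcon
    obtain ⟨t₁, ht₁, hRt₁⟩ := hcon
    set S := {t ∈ Ici (0:ℝ) | R ≤ ‖u t‖} with hS
    have hSc : IsClosed S := by
      have := (h.contU.norm).preimage_isClosed_of_isClosed isClosed_Ici (isClosed_Ici (a := R))
      exact this
    have hSne : S.Nonempty := ⟨t₁, ht₁, hRt₁⟩
    have hSb : BddBelow S := ⟨0, fun t ht => ht.1⟩
    have hτ := hSc.csInf_mem hSne hSb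
    set τ := sInf S with hτd
    have hlt : ∀ s, 0 ≤ s → s < τ → ‖u s‖ < R := fun s hs hsτ => by
      by_contra! hc
      exact absurd (csInf_le hSb ⟨hs, hc⟩) (not_le.2 hsτ)
    have hanti : AntitoneOn (fun s => energy ι Φ (u s) (v s)) (Icc 0 τ) := by
      refine antitoneOn_of_hasDerivWithinAt_nonpos (convex_Icc 0 τ) (fun s hs =>
        (h.hasDerivWithinAt_energy hi hd hf hs.1).continuousWithinAt.mono Icc_subset_Ici_self)
        (fun s hs => (h.hasDerivWithinAt_energy hi hd hf (interior_subset hs).1).mono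
          (interior_subset.trans Icc_subset_Ici_self)) (fun s hs => ?_)
      rw [interior_Icc] at hs
      rw [ballRetract_eq_self hR (hlt s hs.1.le hs.2).le]
      simp only [inner_sub_left, real_inner_self_eq_norm_sq]
      nlinarith [sq_nonneg ‖v s‖]
    have := hanti ⟨le_rfl, hτ.1⟩ ⟨hτ.1, le_rfl⟩ hτ.1
    simp only [hu0, hv0] at this
    exact absurd (hRb _ _ this) (not_lt.2 hτ.2)
  refine ⟨u, v, h.congr fun t ht => ?_, hu0, hv0⟩
  rw [ballRetract_eq_self hR (hbound t ht).le]

/-- Solutions of the damped equation are determined by their initial data. -/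
theorem IsDampedSolution.unique (hi : Function.Injective ι) (hd : DenseRange ι)
    (hι : ∀ u, ‖ι u‖ ≤ ‖u‖) (hp : 0 < p) (hf : IsPowerGradient ι p f Φ)
    (h : IsDampedSolution ι f u v) {u' : ℝ → V} {v' : ℝ → H} (h' : IsDampedSolution ι f u' v')
    (hu : u 0 = u' 0) (hv : v 0 = v' 0) {t : ℝ} (ht : 0 ≤ t) : u t = u' t := by
  have hb : ∀ {u : ℝ → V} {v : ℝ → H}, IsDampedSolution ι f u v →
      ∃ R, ∀ s, 0 ≤ s → ‖u s‖ ≤ R := fun {u v} h => by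
    obtain ⟨R, -, hRb⟩ := hf.norm_le_of_energy_le hp hι (energy ι Φ (u 0) (v 0))
    exact ⟨R, fun s hs => (hRb _ _ (h.energy_antitoneOn hi hd hf self_mem_Ici hs hs)).le⟩
  obtain ⟨R, hR⟩ := hb h
  obtain ⟨R', hR'⟩ := hb h'
  obtain ⟨k, hk, hkl⟩ := hf.lip (max R R')
  have hw := IsForced.sub h h'
  have := gronwall_of_hasDerivWithinAt
    (z := fun s => ‖u s - u' s‖ ^ 2 + ‖v s - v' s‖ ^ 2) (a := 3 + k) (b := 0) (T := t)
    (by positivity) le_rfl (fun s hs => hw.hasDerivWithinAt_norm_sq hi hd hs.1) (fun s hs => ?_) t ⟨ht, le_rfl⟩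
  · simp only [hu, hv, sub_self, norm_zero, ne_eq, OfNat.ofNat_ne_zero, not_false_eq_true,
      zero_pow, add_zero, zero_mul, mul_zero] at this
    have h1 : ‖u t - u' t‖ ^ 2 ≤ 0 := by
      have := sq_nonneg ‖v t - v' t‖
      linarith
    have h2 : ‖u t - u' t‖ = 0 := by
      have := norm_nonneg (u t - u' t)
      nlinarith
    exact sub_eq_zero.1 (norm_eq_zero.1 h2)
  · have h1 := hkl _ _ ((hR s hs.1).trans (le_max_left _ _)) ((hR' s hs.1).trans (le_max_right _ _))
    have h2 := hι (u s - u' s)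
    have e : ι (u s) - v s - f (u s) - (ι (u' s) - v' s - f (u' s)) =
        ι (u s - u' s) - (v s - v' s) - (f (u s) - f (u' s)) := by rw [map_sub]; abel
    have h3 := norm_sub_le (ι (u s - u' s) - (v s - v' s)) (f (u s) - f (u' s))
    have h4 := norm_sub_le (ι (u s - u' s)) (v s - v' s)
    rw [e]
    have h5 := real_inner_le_norm
      (ι (u s - u' s) - (v s - v' s) - (f (u s) - f (u' s))) (v s - v' s)
    have h6 : ‖ι (u s - u' s) - (v s - v' s) - (f (u s) - f (u' s))‖ ≤
      (1 + k) * ‖u s - u' s‖ + ‖v s - v' s‖ := by linarith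
    have h7 := mul_le_mul_of_nonneg_right h6 (norm_nonneg (v s - v' s))
    have h8 := mul_nonneg (show 0 ≤ 1 + k by positivity) (sq_nonneg (‖u s - u' s‖ - ‖v s - v' s‖))
    nlinarith [sq_nonneg ‖u s - u' s‖, sq_nonneg ‖v s - v' s‖]

end Semilinear

/-! ### The upper decay rate. -/

section Decay
open Filter Topology

/-- Here `b * S'` is the derivative of S. The −2 in the bound for w' outweighs −w up to a multiple
of S', leaving w' ≤ D S' − 1; so for small ε the function S − εw increases at rate at least ε, and
|w| is itself controlled by S. -/
theorem linear_growth {S w S' w' : ℝ → ℝ} {b C S₀ T : ℝ} (hb : 0 < b) (hb1 : b ≤ 1)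
    (hS₀ : 0 < S₀) (hT : 0 ≤ T)
    (hS : ∀ t ∈ Icc 0 T, HasDerivWithinAt S (b * S' t) (Ici 0) t)
    (hw : ∀ t ∈ Icc 0 T, HasDerivWithinAt w (w' t) (Ici 0) t)
    (hlow : ∀ t ∈ Icc 0 T, S₀ ≤ S t) (hS'0 : ∀ t ∈ Icc 0 T, 0 ≤ S' t)
    (hS'S : ∀ t ∈ Icc 0 T, S' t ≤ 2 * S t) (hwS : ∀ t ∈ Icc 0 T, w t ^ 2 ≤ C * S' t)
    (hC : 0 ≤ C)
    (hw' : ∀ t ∈ Icc 0 T, w' t ≤ 2 * (S' t / S t) - w t - 2 + |w t| * (S' t / S t)) :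
    1 + T ≤ (2 * ((3 * C + 3 / S₀ + 1) / b) + 3 / S₀) * S T := by
  -- D collects the coefficients of S' in the bound for w'; ε = b / D makes b S' and ε D S' cancel.
  set D := 3 * C + 3 / S₀ + 1 with hD
  have hDpos : 0 < D := by positivity
  set ε := b / D with hε
  have hεpos : 0 < ε := by positivity
  have hεD : ε * D = b := by rw [hε]; field_simp
  have hw1 : ∀ t ∈ Icc 0 T, |w t| ≤ 1 + 2 * C * S t := fun t ht => by
    have h1 := hwS t ht
    have h2 := mul_le_mul_of_nonneg_left (hS'S t ht) hC
    nlinarith [sq_abs (w t), sq_nonneg (|w t| - 1), abs_nonneg (w t)]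
  have hεw : ∀ t ∈ Icc 0 T, ε * |w t| ≤ ε + S t := fun t ht => by
    have h1 := mul_le_mul_of_nonneg_left (hw1 t ht) hεpos.le
    have h2 : 0 < S t := hS₀.trans_le (hlow t ht)
    have h3 : ε * (2 * C) ≤ 1 := by
      have : 2 * C ≤ D := by
        have : 0 < 3 / S₀ := by positivity
        linarith
      have := mul_le_mul_of_nonneg_left this hεpos.le
      linarith
    have h4 := mul_le_mul_of_nonneg_right h3 h2.le
    linarith
  have hmono : MonotoneOn (fun t => S t - ε * w t - ε * t) (Icc 0 T) := by
    have hd : ∀ t ∈ Icc 0 T, HasDerivWithinAt (fun t => S t - ε * w t - ε * t)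
        (b * S' t - ε * w' t - ε) (Ici 0) t := fun t ht => by
      have h2 : HasDerivAt (fun t => ε * t) ε t := by simpa using (hasDerivAt_id t).const_mul ε
      exact ((hS t ht).sub ((hw t ht).const_mul ε)).sub h2.hasDerivWithinAt
    refine monotoneOn_of_hasDerivWithinAt_nonneg (convex_Icc 0 T)
      (fun s hs => (hd s hs).continuousWithinAt.mono Icc_subset_Ici_self)
      (fun s hs => (hd s (interior_subset hs)).mono
        (interior_subset.trans Icc_subset_Ici_self)) ?_
    intro t ht
    have ht := interior_subset ht
    have hSp : 0 < S t := hS₀.trans_le (hlow t ht)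
    have h1 := hw' t ht
    have h2 : (2 + |w t|) * (S' t / S t) ≤ (3 / S₀ + 2 * C) * S' t := by
      have h3 : (2 + |w t|) / S t ≤ 3 / S₀ + 2 * C := by
        rw [div_le_iff₀ hSp]
        have h4 := hw1 t ht
        have h5 : 3 ≤ 3 / S₀ * S t := by
          rw [div_mul_eq_mul_div, le_div_iff₀ hS₀]
          have := hlow t ht; linarith
        linarith
      have := mul_le_mul_of_nonneg_right h3 (hS'0 t ht)
      calc _ = (2 + |w t|) / S t * S' t := by ring
        _ ≤ _ := this
    have h6 : -w t ≤ 1 + C * S' t := by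
      have h7 := hwS t ht
      nlinarith [sq_nonneg (w t + 1), sq_nonneg (w t)]
    have h8 : w' t ≤ D * S' t - 1 := by
      have := hS'0 t ht
      have e : D * S' t = (3 / S₀ + 2 * C) * S' t + C * S' t + S' t := by rw [hD]; ring
      linarith
    have h9 := mul_le_mul_of_nonneg_left h8 hεpos.le
    have h10 : ε * (D * S' t - 1) = b * S' t - ε := by rw [mul_sub, ← mul_assoc, hεD]; ring
    linarith
  have h := hmono ⟨le_rfl, hT⟩ ⟨hT, le_rfl⟩ hT
  simp only [mul_zero, sub_zero] at h
  have h1 := hεw 0 ⟨le_rfl, hT⟩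
  have h2 := hεw T ⟨hT, le_rfl⟩
  have h3 := mul_le_mul_of_nonneg_left (le_abs_self (w 0)) hεpos.le
  have h4 := mul_le_mul_of_nonneg_left (neg_le_abs (w T)) hεpos.le
  have h5 : ε * (T - 2) ≤ 2 * S T := by nlinarith
  have h6 : T - 2 ≤ 2 * (D / b) * S T := by
    have h7 : D / b * ε = 1 := by rw [hε]; field_simp
    have h8 := mul_le_mul_of_nonneg_left h5 (show 0 ≤ D / b by positivity)
    calc T - 2 = D / b * (ε * (T - 2)) := by rw [← mul_assoc, h7, one_mul]
      _ ≤ _ := h8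
      _ = _ := by ring
  have h7 : 3 ≤ 3 / S₀ * S T := by
    rw [div_mul_eq_mul_div, le_div_iff₀ hS₀]
    have := hlow T ⟨hT, le_rfl⟩; linarith
  rw [add_mul]
  linarith

/-- `linear_growth` is applied to S = E^{-b} and w = W / E. The value b = p / (p + 2) is what makes
a² ≤ C E^{2/(p+2)} yield w² ≤ C n² E^{-b-1}. Linear growth of S bounds E^b, and hence a^p, by a
multiple of 1 / (1 + T). -/
theorem exists_decay_bound {p c e : ℝ} (hp : 0 < p) (hc : 0 < c) (he : 0 < e) :
    ∃ M, 0 < M ∧ ∀ (E W W' n a : ℝ → ℝ) (T : ℝ), 0 ≤ T →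
      (∀ t ∈ Icc 0 T, HasDerivWithinAt E (-n t ^ 2) (Ici 0) t) →
      (∀ t ∈ Icc 0 T, HasDerivWithinAt W (W' t) (Ici 0) t) →
      (∀ t ∈ Icc 0 T, W' t ≤ 2 * n t ^ 2 - W t - 2 * E t) →
      (∀ t ∈ Icc 0 T, |W t| ≤ a t * n t) →
      (∀ t ∈ Icc 0 T, 0 ≤ a t ∧ c * a t ^ (p + 2) ≤ E t) →
      (∀ t ∈ Icc 0 T, n t ^ 2 ≤ 2 * E t) →
      (∀ t ∈ Icc 0 T, 0 < E t ∧ E t ≤ e) → a T ≤ M / (1 + T) ^ (1 / p) := by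
  set b := p / (p + 2) with hb
  have hbpos : 0 < b := by positivity
  have hb1 : b ≤ 1 := (div_le_one (by positivity)).2 (by linarith)
  set S₀ := e ^ (-b) with hS₀
  have hS₀pos : 0 < S₀ := by positivity
  set C := ((1 / c) ^ (1 / (p + 2))) ^ 2 with hC
  have hC0 : 0 ≤ C := by positivity
  set Q := 2 * ((3 * C + 3 / S₀ + 1) / b) + 3 / S₀ with hQ
  have hQpos : 0 < Q := by positivity
  refine ⟨(Q * c ^ (-b)) ^ (1 / p), by positivity, ?_⟩
  intro E W W' n a T hT hE hW hW' hWa ha hn hEp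
  have hS : ∀ t ∈ Icc 0 T, HasDerivWithinAt (fun t => E t ^ (-b))
      (b * (n t ^ 2 * E t ^ (-b - 1))) (Ici 0) t := fun t ht =>
    ((hE t ht).rpow_const (p := -b) (Or.inl (hEp t ht).1.ne')).congr_deriv (by ring)
  have hw : ∀ t ∈ Icc 0 T, HasDerivWithinAt (fun t => W t / E t)
      ((W' t * E t - W t * -n t ^ 2) / E t ^ 2) (Ici 0) t := fun t ht =>
    (hW t ht).div (hE t ht) (hEp t ht).1.ne'
  have hsplit : ∀ t ∈ Icc 0 T, E t ^ (-b) = E t ^ (-b - 1) * E t := fun t ht => by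
    have := Real.rpow_add (hEp t ht).1 (-b - 1) 1
    rw [Real.rpow_one] at this
    rw [← this]; ring_nf
  have hk : ∀ t ∈ Icc 0 T, 0 < E t ^ (-b - 1) := fun t ht => Real.rpow_pos_of_pos (hEp t ht).1 _
  have hratio : ∀ t ∈ Icc 0 T, n t ^ 2 * E t ^ (-b - 1) / E t ^ (-b) = n t ^ 2 / E t :=
    fun t ht => by
      have := (hk t ht).ne'
      have := (hEp t ht).1.ne'
      rw [hsplit t ht]; field_simp
  have ha2 : ∀ t ∈ Icc 0 T, a t ^ 2 ≤ C * (E t ^ (-b - 1) * E t ^ 2) := fun t ht => by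
    have hEt := (hEp t ht).1
    have h1 : a t ≤ (1 / c) ^ (1 / (p + 2)) * E t ^ (1 / (p + 2)) := by
      rw [← Real.mul_rpow (by positivity) hEt.le, one_div (p + 2),
        Real.le_rpow_inv_iff_of_pos (ha t ht).1 (by positivity) (by positivity),
        one_div_mul_eq_div, le_div_iff₀ hc, mul_comm]
      exact (ha t ht).2
    have h2 : E t ^ (-b - 1) * E t ^ 2 = (E t ^ (1 / (p + 2))) ^ 2 := by
      rw [← Real.rpow_natCast, ← Real.rpow_natCast, ← Real.rpow_mul hEt.le, ← Real.rpow_add hEt]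
      congr 1
      rw [hb]; field_simp; norm_num; ring
    rw [h2, hC, ← mul_pow]
    exact pow_le_pow_left₀ (ha t ht).1 h1 2
  have key := linear_growth hbpos hb1 hS₀pos hT hS hw (C := C)
    (fun t ht => Real.rpow_le_rpow_of_nonpos (hEp t ht).1 (hEp t ht).2 (by linarith))
    (fun t ht => mul_nonneg (sq_nonneg _) (hk t ht).le) (fun t ht => ?_) (fun t ht => ?_) hC0
    (fun t ht => ?_)
  · have hET := (hEp T ⟨hT, le_rfl⟩).1
    have haT := ha T ⟨hT, le_rfl⟩
    have h1T : 0 < 1 + T := by linarith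
    have h1 : (c * a T ^ (p + 2)) ^ b ≤ E T ^ b := by
      have := haT.1
      exact Real.rpow_le_rpow (by positivity) haT.2 hbpos.le
    have h2 : (c * a T ^ (p + 2)) ^ b = c ^ b * a T ^ p := by
      rw [Real.mul_rpow hc.le (Real.rpow_nonneg haT.1 _), ← Real.rpow_mul haT.1]
      congr 2; rw [hb]; field_simp
    have h3 : E T ^ (-b) * E T ^ b = 1 := by rw [← Real.rpow_add hET]; simp
    have h4 : a T ^ p ≤ Q * c ^ (-b) / (1 + T) := by
      rw [le_div_iff₀ h1T]
      have h5 : a T ^ p ≤ c ^ (-b) * E T ^ b := by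
        have h6 : c ^ (-b) * c ^ b = 1 := by rw [← Real.rpow_add hc]; simp
        have := mul_le_mul_of_nonneg_left (h2 ▸ h1) (show 0 ≤ c ^ (-b) by positivity)
        rwa [← mul_assoc, h6, one_mul] at this
      calc a T ^ p * (1 + T) ≤ (c ^ (-b) * E T ^ b) * (Q * E T ^ (-b)) := by
            have := Real.rpow_nonneg haT.1 p
            gcongr
        _ = Q * c ^ (-b) * (E T ^ (-b) * E T ^ b) := by ring
        _ = _ := by rw [h3, mul_one]
    rw [← Real.div_rpow (by positivity) h1T.le, one_div,
      Real.le_rpow_inv_iff_of_pos haT.1 (by positivity) hp]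
    exact h4
  · rw [hsplit t ht]
    have := mul_le_mul_of_nonneg_right (hn t ht) (hk t ht).le
    linarith
  · have hEt := (hEp t ht).1
    rw [div_pow, div_le_iff₀ (by positivity)]
    have h1 : W t ^ 2 ≤ (a t * n t) ^ 2 := by
      rw [← sq_abs]; exact pow_le_pow_left₀ (abs_nonneg _) (hWa t ht) 2
    have h2 := mul_le_mul_of_nonneg_right (ha2 t ht) (sq_nonneg (n t))
    rw [mul_pow] at h1
    linarith
  · have hEt := (hEp t ht).1
    rw [hratio t ht, abs_div, abs_of_pos hEt]
    have h1 := hW' t ht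
    have h2 : (W' t * E t - W t * -n t ^ 2) / E t ^ 2 =
        W' t / E t + W t / E t * (n t ^ 2 / E t) := by field_simp; ring
    have h3 : W' t / E t ≤ 2 * (n t ^ 2 / E t) - W t / E t - 2 := by
      rw [div_le_iff₀ hEt]
      have : (2 * (n t ^ 2 / E t) - W t / E t - 2) * E t = 2 * n t ^ 2 - W t - 2 * E t := by
        field_simp
      linarith
    have h4 : W t / E t * (n t ^ 2 / E t) ≤ |W t| / E t * (n t ^ 2 / E t) := by
      gcongr
      exact le_abs_self _
    rw [h2]; linarith

variable {V H : Type*} [NormedAddCommGroup V] [InnerProductSpace ℝ V] [CompleteSpace V]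
  [NormedAddCommGroup H] [InnerProductSpace ℝ H] [CompleteSpace H]
  {ι : V →L[ℝ] H} {p : ℝ} {f : V → H} {Φ : V → ℝ}

/-- The upper decay rate, uniform on sets of bounded energy. -/
theorem exists_upper_bound (hi : Function.Injective ι) (hd : DenseRange ι)
    (hι : ∀ u, ‖ι u‖ ≤ ‖u‖) (hp : 0 < p) (hf : IsPowerGradient ι p f Φ) {e : ℝ} (he : 0 < e) :
    ∃ M, 0 < M ∧ ∀ u v, IsDampedSolution ι f u v → energy ι Φ (u 0) (v 0) ≤ e →
      ∀ t, 0 ≤ t → ‖ι (u t)‖ ≤ M / (1 + t) ^ (1 / p) := by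
  obtain ⟨c, hc, hlow⟩ := hf.lower
  obtain ⟨M, hM, hdec⟩ := exists_decay_bound hp hc he
  refine ⟨M, hM, fun u v h h0 T hT => ?_⟩
  have hN : ∀ t, 0 ≤ ‖u t‖ ^ 2 - ‖ι (u t)‖ ^ 2 := fun t =>
    sub_nonneg.2 (pow_le_pow_left₀ (norm_nonneg _) (hι (u t)) 2)
  have hΦE : ∀ t, Φ (u t) ≤ energy ι Φ (u t) (v t) := fun t => by
    have := hN t
    rw [energy]; nlinarith [sq_nonneg ‖v t‖]
  have hanti := h.energy_antitoneOn hi hd hf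
  -- Energy positive at T is positive on all of [0, T]; otherwise the lower bound on Φ forces ιu(T)
  -- = 0.
  by_cases hET : 0 < energy ι Φ (u T) (v T)
  · refine hdec (fun t => energy ι Φ (u t) (v t)) (fun t => ⟪ι (u t), v t⟫_ℝ)
      (fun t => ⟪v t, v t⟫_ℝ + (⟪ι (u t) - v t - f (u t), ι (u t)⟫_ℝ - ⟪u t, u t⟫_ℝ))
      (fun t => ‖v t‖) (fun t => ‖ι (u t)‖) T hT
      (fun t ht => h.hasDerivWithinAt_energy hi hd hf ht.1)
      (fun t ht => hasDerivWithinAt_inner_of_weak (h.deriv t ht.1) (h.contV t ht.1)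
        (h.weak (u t) t ht.1))
      (fun t ht => ?_) (fun t ht => abs_real_inner_le_norm _ _)
      (fun t ht => ⟨norm_nonneg _, (hlow _).trans (hΦE t)⟩) (fun t ht => ?_)
      (fun t ht => ⟨hET.trans_le (hanti ht.1 hT ht.2), (hanti self_mem_Ici ht.1 ht.1).trans h0⟩)
    -- By Euler's identity Φ enters the derivative of ⟪u, v⟫ as −(p + 2)Φ, which is at most the −2Φ
    -- contained in −2E.
    · have h1 := hf.nonneg (u t)
      simp only [inner_sub_left, hf.euler, real_inner_self_eq_norm_sq, energy]
      rw [real_inner_comm (ι (u t)) (v t)]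
      nlinarith [hN t, mul_nonneg hp.le h1]
    · have h1 := hf.nonneg (u t)
      have := hN t
      simp only [energy]
      linarith
  · have h1 : ‖ι (u T)‖ ^ (p + 2) ≤ 0 := by
      have h2 := (hlow (u T)).trans (hΦE T)
      by_contra! h3
      have := mul_pos hc h3
      linarith
    have h2 : ‖ι (u T)‖ = 0 := by
      by_contra h3
      have := Real.rpow_pos_of_pos (lt_of_le_of_ne (norm_nonneg _) (Ne.symm h3)) (p + 2)
      linarith
    rw [h2]; positivity

end Decay

/-! ### The lower decay rate on an open set of data. -/

section Slow
open Filter Topology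

/-- A lower bound on an interval where the Dirichlet-type quotient can be controlled. -/
theorem slow_on_interval {D D' y y' : ℝ → ℝ} {p κ C q T : ℝ} (hp : 0 < p) (hq : 0 < q) (hT : 0 ≤ T)
    (hD : ∀ t, 0 ≤ t → HasDerivWithinAt D (D' t) (Ici 0) t)
    (hy : ∀ t, 0 ≤ t → HasDerivWithinAt y (y' t) (Ici 0) t)
    (hypos : ∀ t ∈ Icc 0 T, 0 < y t)
    (hD' : ∀ t, 0 ≤ t → D' t ≤ -κ * D t + C * y t ^ (p + 1))
    (hy' : ∀ t, 0 ≤ t → y' t ^ 2 ≤ 16 * (y t * D t))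
    (hsmall : ∀ t, 0 ≤ t → 4 * √q * q * (p + 1) * y t ^ (p / 2) < κ * q - C)
    (h0 : D 0 ≤ q * y 0 ^ (p + 1)) :
    y T ^ (-(p / 2)) ≤ y 0 ^ (-(p / 2)) + 2 * p * √q * T := by
  have hyb : ∀ t, 0 ≤ t → 0 < y t → D t ≤ q * y t ^ (p + 1) →
      |y' t| ≤ 4 * √q * (y t * y t ^ (p / 2)) := by
    intro t ht hyt hDt
    refine abs_le_of_sq_le_sq ?_ (by positivity)
    refine (hy' t ht).trans ?_
    have e1 : (y t ^ (p / 2)) ^ 2 = y t ^ p := by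
      rw [← Real.rpow_natCast, ← Real.rpow_mul hyt.le]; congr 1; push_cast; ring
    have e2 : y t ^ (p + 1) = y t ^ p * y t := Real.rpow_add_one hyt.ne' p
    have e3 : (4 * √q * (y t * y t ^ (p / 2))) ^ 2 = 16 * (y t * (q * y t ^ (p + 1))) := by
      rw [mul_pow, mul_pow, mul_pow, e1, Real.sq_sqrt hq.le, e2]; ring
    rw [e3]
    gcongr
  have hsub : ∀ {t : ℝ}, 0 ≤ t → Ici t ⊆ Ici 0 := fun ht => Ici_subset_Ici.2 ht
  -- At a contact point D = q y^{p+1}, the smallness condition makes D' strictly less than the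
  -- derivative of the barrier, so D cannot cross it.
  have hle : ∀ t ∈ Icc 0 T, D t ≤ q * y t ^ (p + 1) := by
    refine image_le_of_deriv_right_lt_deriv_boundary' (f := D) (f' := D')
      (fun t ht => (hD t ht.1).continuousWithinAt.mono Icc_subset_Ici_self)
      (fun t ht => (hD t ht.1).mono (hsub ht.1)) h0
      (B' := fun t => q * (y' t * (p + 1) * y t ^ (p + 1 - 1)))
      (fun t ht => (((hy t ht.1).rpow_const (Or.inl (hypos t ht).ne')).const_mul
        q).continuousWithinAt.mono Icc_subset_Ici_self)
      (fun t ht => (((hy t ht.1).rpow_const (Or.inl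
        (hypos t (Ico_subset_Icc_self ht)).ne')).const_mul q).mono (hsub ht.1)) ?_
    intro t ht heq
    have hyt := hypos t (Ico_subset_Icc_self ht)
    have h1 := hD' t ht.1
    have h2 := neg_le_of_abs_le (hyb t ht.1 hyt heq.le)
    have h3 := hsmall t ht.1
    rw [heq] at h1
    rw [add_sub_cancel_right]
    have e2 : y t ^ (p + 1) = y t ^ p * y t := Real.rpow_add_one hyt.ne' p
    have hyp : 0 < y t ^ p := Real.rpow_pos_of_pos hyt p
    have h4 := mul_le_mul_of_nonneg_left h2 (show 0 ≤ q * (p + 1) * y t ^ p by positivity)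
    have h5 := mul_lt_mul_of_pos_right h3 (mul_pos hyp hyt)
    rw [e2] at h1
    nlinarith
  have hd : ∀ t ∈ Icc 0 T, HasDerivWithinAt (fun t => y t ^ (-(p / 2)) - 2 * p * √q * t)
      (y' t * (-(p / 2)) * y t ^ (-(p / 2) - 1) - 2 * p * √q) (Ici 0) t := fun t ht => by
    have h2 : HasDerivAt (fun t => 2 * p * √q * t) (2 * p * √q) t := by
      simpa using (hasDerivAt_id t).const_mul (2 * p * √q)
    exact ((hy t ht.1).rpow_const (Or.inl (hypos t ht).ne')).sub h2.hasDerivWithinAt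
  -- Below the barrier y' ≥ −4√q y^{1+p/2}, so the slope of y^{-p/2} is at most 2p√q.
  have hanti : AntitoneOn (fun t => y t ^ (-(p / 2)) - 2 * p * √q * t) (Icc 0 T) := by
    refine antitoneOn_of_hasDerivWithinAt_nonpos (convex_Icc 0 T)
      (fun s hs => (hd s hs).continuousWithinAt.mono Icc_subset_Ici_self)
      (fun s hs => (hd s (interior_subset hs)).mono
        (interior_subset.trans Icc_subset_Ici_self)) ?_
    intro t ht
    have ht := interior_subset ht
    have hyt := hypos t ht
    have h2 := neg_le_of_abs_le (hyb t ht.1 hyt (hle t ht))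
    have h3 : y t ^ (-(p / 2) - 1) * (y t * y t ^ (p / 2)) = 1 := by
      have : y t * y t ^ (p / 2) = y t ^ (p / 2 + 1) := by
        rw [Real.rpow_add_one hyt.ne', mul_comm]
      rw [this, ← Real.rpow_add hyt]
      ring_nf; simp
    have h4 := mul_le_mul_of_nonneg_left h2
      (show 0 ≤ p / 2 * y t ^ (-(p / 2) - 1) by positivity)
    have h5 : p / 2 * y t ^ (-(p / 2) - 1) * -(4 * √q * (y t * y t ^ (p / 2))) =
        -(2 * p * √q) := by
      rw [show p / 2 * y t ^ (-(p / 2) - 1) * -(4 * √q * (y t * y t ^ (p / 2))) =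
        -(2 * p * √q * (y t ^ (-(p / 2) - 1) * (y t * y t ^ (p / 2)))) by ring, h3, mul_one]
    linarith
  have := hanti ⟨le_rfl, hT⟩ ⟨hT, le_rfl⟩ hT
  simp only [mul_zero, sub_zero] at this
  linarith

/-- The interval estimate assumes y > 0 but also protects it: before a first zero τ it keeps y above
a fixed positive number, and continuity excludes y τ ≤ 0. -/
theorem slow_lower_bound {D D' y y' : ℝ → ℝ} {p κ C q : ℝ} (hp : 0 < p) (hq : 0 < q)
    (hD : ∀ t, 0 ≤ t → HasDerivWithinAt D (D' t) (Ici 0) t)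
    (hy : ∀ t, 0 ≤ t → HasDerivWithinAt y (y' t) (Ici 0) t)
    (hy0 : 0 < y 0)
    (hD' : ∀ t, 0 ≤ t → D' t ≤ -κ * D t + C * y t ^ (p + 1))
    (hy' : ∀ t, 0 ≤ t → y' t ^ 2 ≤ 16 * (y t * D t))
    (hsmall : ∀ t, 0 ≤ t → 4 * √q * q * (p + 1) * y t ^ (p / 2) < κ * q - C)
    (h0 : D 0 ≤ q * y 0 ^ (p + 1)) {t : ℝ} (ht : 0 ≤ t) :
    0 < y t ∧ y t ^ (-(p / 2)) ≤ y 0 ^ (-(p / 2)) + 2 * p * √q * t := by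
  have hyc : ContinuousOn y (Ici 0) := fun s hs => (hy s hs).continuousWithinAt
  have hpos : ∀ t, 0 ≤ t → 0 < y t := by
    by_contra! hcon
    obtain ⟨t₁, ht₁, hyt₁⟩ := hcon
    set S := {t ∈ Ici (0:ℝ) | y t ≤ 0} with hS
    have hSc : IsClosed S := hyc.preimage_isClosed_of_isClosed isClosed_Ici isClosed_Iic
    have hSb : BddBelow S := ⟨0, fun t ht => ht.1⟩
    have hτ := hSc.csInf_mem ⟨t₁, ht₁, hyt₁⟩ hSb
    set τ := sInf S with hτd
    have hτ0 : 0 < τ := by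
      refine lt_of_le_of_ne hτ.1 fun h => ?_
      have := hτ.2
      rw [← h] at this
      linarith
    have hlt : ∀ s, 0 ≤ s → s < τ → 0 < y s := fun s hs hsτ => by
      by_contra! hc
      exact absurd (csInf_le hSb ⟨hs, hc⟩) (not_le.2 hsτ)
    set Z := y 0 ^ (-(p / 2)) + 2 * p * √q * τ with hZ
    have hZpos : 0 < Z := by positivity
    have hlow : ∀ s ∈ Ico 0 τ, (1 / Z) ^ (2 / p) ≤ y s := by
      intro s hs
      have hys := hlt s hs.1 hs.2
      have h1 := slow_on_interval hp hq hs.1 hD hy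
        (fun r hr => hlt r hr.1 (hr.2.trans_lt hs.2)) hD' hy' hsmall h0
      have h2 : y s ^ (-(p / 2)) ≤ Z := by
        refine h1.trans ?_
        rw [hZ]
        gcongr
        exact hs.2.le
      have h3 : 1 / Z ≤ y s ^ (p / 2) := by
        rw [Real.rpow_neg hys.le] at h2
        rw [one_div]
        exact inv_le_of_inv_le₀ (by positivity) h2
      have h4 := Real.rpow_le_rpow (by positivity) h3 (show 0 ≤ 2 / p by positivity)
      rwa [← Real.rpow_mul hys.le, show p / 2 * (2 / p) = 1 by field_simp, Real.rpow_one] at h4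
    have hne : (𝓝[Ico 0 τ] τ).NeBot := by
      rw [← mem_closure_iff_nhdsWithin_neBot, closure_Ico hτ0.ne]
      exact ⟨hτ0.le, le_rfl⟩
    have hge : (1 / Z) ^ (2 / p) ≤ y τ :=
      ge_of_tendsto ((hyc τ hτ.1).mono Ico_subset_Ici_self) (by
        filter_upwards [self_mem_nhdsWithin] with s hs using hlow s hs)
    have : 0 < (1 / Z) ^ (2 / p) := by positivity
    have := hτ.2
    linarith
  exact ⟨hpos t ht, slow_on_interval hp hq ht hD hy (fun r hr => hpos r hr.1) hD' hy' hsmall h0⟩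

variable {V H : Type*} [NormedAddCommGroup V] [InnerProductSpace ℝ V] [CompleteSpace V]
  [NormedAddCommGroup H] [InnerProductSpace ℝ H] [CompleteSpace H]
  {ι : V →L[ℝ] H} {p : ℝ} {f : V → H} {Φ : V → ℝ}

/-- `Q` is a bounded operator on `H` commuting with the form `‖u‖² - ‖ι u‖²`, which has a gap
`ν` on the range of `Q`. -/
structure HasSpectralGap (ι : V →L[ℝ] H) (Q : H →L[ℝ] H) (ν : ℝ) : Prop where
  pos : 0 < ν
  norm_le : ∀ h, ‖Q h‖ ≤ ‖h‖
  lift : ∀ u, ∃ φ, ι φ = Q (ι u) ∧ ⟪u, φ⟫_ℝ - ⟪ι u, ι φ⟫_ℝ = ‖u‖ ^ 2 - ‖ι u‖ ^ 2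
  gap : ∀ u, ν * ‖Q (ι u)‖ ^ 2 ≤ ‖u‖ ^ 2 - ‖ι u‖ ^ 2

/-- The linear energy modified by a small multiple of `⟪Q u, v⟫`. -/
def modEnergy (ι : V →L[ℝ] H) (Q : H →L[ℝ] H) (η : ℝ) (u : V) (v : H) : ℝ :=
  (‖u‖ ^ 2 - ‖ι u‖ ^ 2) / 2 + ‖v‖ ^ 2 / 2 + η * ⟪Q (ι u), v⟫_ℝ

/-- The gap bounds ‖Q(ιu)‖ by the quadratic form, so the cross term is a small fraction of the
linear energy and `modEnergy` is equivalent to it. -/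
theorem HasSpectralGap.abs_inner_le {Q : H →L[ℝ] H} {ν : ℝ} (hQ : HasSpectralGap ι Q ν)
    (hν : ν ≤ 1) (u : V) (v : H) :
    |ν / 8 * ⟪Q (ι u), v⟫_ℝ| ≤ ((‖u‖ ^ 2 - ‖ι u‖ ^ 2) / 2 + ‖v‖ ^ 2 / 2) / 8 := by
  have h1 := abs_real_inner_le_norm (Q (ι u)) v
  have h2 := hQ.gap u
  have h3 := hQ.pos
  rw [abs_mul, abs_of_pos (by positivity)]
  have h4 := mul_le_mul_of_nonneg_left h1 (show 0 ≤ ν / 8 by positivity)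
  have h5 : ν * (2 * (‖Q (ι u)‖ * ‖v‖)) ≤ ν * (‖Q (ι u)‖ ^ 2 + ‖v‖ ^ 2) := by
    gcongr
    nlinarith [sq_nonneg (‖Q (ι u)‖ - ‖v‖)]
  have h6 : ν * ‖v‖ ^ 2 ≤ ‖v‖ ^ 2 := mul_le_of_le_one_left (sq_nonneg _) hν
  linarith

/-- The damping alone dissipates only ‖v‖². Differentiating the cross term supplies the missing −(ν
/ 8)(‖u‖² − ‖ιu‖²), through the test vector φ with ιφ = Q(ιu); the errors are absorbed by the gap,
except for the square of ‖f(u)‖. -/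
theorem IsDampedSolution.hasDerivWithinAt_modEnergy (hi : Function.Injective ι)
    (hd : DenseRange ι) {Q : H →L[ℝ] H} {ν : ℝ} (hQ : HasSpectralGap ι Q ν) (hν : ν ≤ 1)
    {u : ℝ → V} {v : ℝ → H} (h : IsDampedSolution ι f u v) {t : ℝ} (ht : 0 ≤ t) :
    ∃ D', HasDerivWithinAt (fun s => modEnergy ι Q (ν / 8) (u s) (v s)) D' (Ici 0) t ∧
      D' ≤ -(ν / 16) * modEnergy ι Q (ν / 8) (u t) (v t) + 2 * ‖f (u t)‖ ^ 2 := by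
  obtain ⟨φ, hφ, hφu⟩ := hQ.lift (u t)
  have h1 := IsForced.hasDerivWithinAt_norm_sq hi hd h ht
  have h2 := (h.deriv t ht).norm_sq
  have h3 : HasDerivWithinAt (fun s => ⟪Q (ι (u s)), v s⟫_ℝ) _ (Ici 0) t :=
    hasDerivWithinAt_inner_of_weak (a := fun s => Q (ι (u s)))
      (Q.hasFDerivAt.comp_hasDerivWithinAt t (h.deriv t ht)) (h.contV t ht)
      (by rw [← hφ]; exact h.weak φ t ht)
  refine ⟨_, (((h1.sub h2).div_const 2).add (h3.const_mul (ν / 8))).congr (fun s _ => ?_) ?_, ?_⟩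
  · simp only [modEnergy, Pi.add_apply, Pi.sub_apply]; ring
  · simp only [modEnergy, Pi.add_apply, Pi.sub_apply]; ring
  · have hab := hQ.abs_inner_le hν (u t) (v t)
    have hν0 := hQ.pos
    have hub := le_of_abs_le hab
    set F := ‖f (u t)‖ with hF
    set n := ‖v t‖ with hn
    set m := ‖Q (ι (u t))‖ with hm
    set N := ‖u t‖ ^ 2 - ‖ι (u t)‖ ^ 2 with hN
    have i1 : -⟪f (u t), v t⟫_ℝ ≤ F * n := (neg_le_abs _).trans (abs_real_inner_le_norm _ _)
    have i2 : -⟪f (u t), ι φ⟫_ℝ ≤ F * m := by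
      rw [hφ]; exact (neg_le_abs _).trans (abs_real_inner_le_norm _ _)
    have i3 : -⟪v t, ι φ⟫_ℝ ≤ n * m := by
      rw [hφ]; exact (neg_le_abs _).trans (abs_real_inner_le_norm _ _)
    have i4 : ⟪Q (v t), v t⟫_ℝ ≤ n ^ 2 := by
      refine (real_inner_le_norm _ _).trans ?_
      rw [sq]
      exact mul_le_mul_of_nonneg_right (hQ.norm_le _) (norm_nonneg _)
    have i5 : ν * m ^ 2 ≤ N := hQ.gap (u t)
    have hE : modEnergy ι Q (ν / 8) (u t) (v t) = N / 2 + n ^ 2 / 2 + ν / 8 * ⟪Q (ι (u t)), v t⟫_ℝ :=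
      rfl
    have e1 : ⟪ι (u t) - v t - f (u t), v t⟫_ℝ = ⟪ι (u t), v t⟫_ℝ - n ^ 2 - ⟪f (u t), v t⟫_ℝ := by
      rw [inner_sub_left, inner_sub_left, real_inner_self_eq_norm_sq]
    have e2 : ⟪ι (u t) - v t - f (u t), ι φ⟫_ℝ - ⟪u t, φ⟫_ℝ =
        -N - ⟪v t, ι φ⟫_ℝ - ⟪f (u t), ι φ⟫_ℝ := by
      rw [inner_sub_left, inner_sub_left]; linarith
    rw [e1, e2, hE]
    have j1 : F * n ≤ n ^ 2 / 4 + F ^ 2 := by nlinarith [sq_nonneg (F - n / 2)]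
    have j2 : ν * (F * m) ≤ ν * m ^ 2 * ν / 4 + F ^ 2 := by nlinarith [sq_nonneg (F - ν * m / 2)]
    have j3 : ν * (n * m) ≤ ν * m ^ 2 * ν / 4 + n ^ 2 := by nlinarith [sq_nonneg (n - ν * m / 2)]
    have hNn : 0 ≤ N := le_trans (by positivity) i5
    have j4 : ν * m ^ 2 * ν ≤ N * ν := mul_le_mul_of_nonneg_right i5 hν0.le
    have j5 : ν * ⟪Q (v t), v t⟫_ℝ ≤ n ^ 2 := by
      have := mul_le_mul_of_nonneg_left i4 hν0.le
      have := mul_le_of_le_one_left (sq_nonneg n) hν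
      linarith
    have j6 := mul_le_mul_of_nonneg_left i2 hν0.le
    have j7 := mul_le_mul_of_nonneg_left i3 hν0.le
    have j8 := mul_le_mul_of_nonneg_left hub hν0.le
    have j9 := mul_le_of_le_one_left (sq_nonneg n) hν
    nlinarith [sq_nonneg F, sq_nonneg n, mul_nonneg hν0.le hNn]

/-- The convexity inequalities at u and at w squeeze Φ w between two functions tending to Φ u. -/
theorem IsPowerGradient.continuous_potential (hf : IsPowerGradient ι p f Φ) : Continuous Φ := by
  refine continuous_iff_continuousAt.2 fun u => ?_
  have hι := ι.continuous
  have h1 : Tendsto (fun w => ⟪f u, ι w - ι u⟫_ℝ + Φ u) (𝓝 u) (𝓝 (Φ u)) := by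
    have : Continuous fun w => ⟪f u, ι w - ι u⟫_ℝ + Φ u := by fun_prop
    simpa using this.tendsto u
  have h2 : Tendsto (fun w => ⟪f w, ι w - ι u⟫_ℝ + Φ u) (𝓝 u) (𝓝 (Φ u)) := by
    have hfc := hf.continuous
    have : Continuous fun w => ⟪f w, ι w - ι u⟫_ℝ + Φ u := by fun_prop
    simpa using this.tendsto u
  refine tendsto_of_tendsto_of_tendsto_of_le_of_le h1 h2 (fun w => ?_) (fun w => ?_)
  · have := hf.convex u w
    simp only; linarith
  · have := hf.convex w u
    rw [← neg_sub, inner_neg_right] at this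
    simp only; linarith

theorem add_rpow_le {a b r : ℝ} (ha : 0 ≤ a) (hb : 0 ≤ b) (hr : 0 ≤ r) :
    (a + b) ^ r ≤ 2 ^ r * (a ^ r + b ^ r) := by
  have h1 : a + b ≤ 2 * max a b := by
    have := le_max_left a b; have := le_max_right a b; linarith
  have hm : 0 ≤ max a b := le_max_of_le_left ha
  calc (a + b) ^ r ≤ (2 * max a b) ^ r := Real.rpow_le_rpow (by positivity) h1 hr
    _ = 2 ^ r * max a b ^ r := Real.mul_rpow (by norm_num) hm
    _ ≤ _ := by
      gcongr
      rcases le_total a b with h | h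
      · rw [max_eq_right h]; have := Real.rpow_nonneg ha r; linarith
      · rw [max_eq_left h]; have := Real.rpow_nonneg hb r; linarith

/-- An open set of data whose solutions decay exactly like `t ^ (-1 / p)`. -/
theorem exists_slow_solutions (hi : Function.Injective ι) (hd : DenseRange ι)
    (hι : ∀ u, ‖ι u‖ ≤ ‖u‖) (hp : 0 < p) (hf : IsPowerGradient ι p f Φ) {Q : H →L[ℝ] H} {ν : ℝ}
    (hQ : HasSpectralGap ι Q ν) (hν : ν ≤ 1) (hker : ∃ k, k ≠ 0 ∧ ‖k‖ = ‖ι k‖) :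
    ∃ (S : Set (V × H)) (M₂ M₃ : ℝ), IsOpen S ∧ S.Nonempty ∧ 0 < M₂ ∧ 0 < M₃ ∧
      ∀ u v, IsDampedSolution ι f u v → (u 0, v 0) ∈ S → ∀ t, 0 ≤ t →
        M₂ / (1 + t) ^ (1 / p) ≤ ‖ι (u t)‖ ∧ ‖ι (u t)‖ ≤ M₃ / (1 + t) ^ (1 / p) := by
  obtain ⟨K₀, hK₀, hgrow₀⟩ := hf.growth
  obtain ⟨c, hc, hlow⟩ := hf.lower
  obtain ⟨k, hk0, hk⟩ := hker
  have hν0 := hQ.pos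
  set K := K₀ + 1 with hK
  have hKpos : 0 < K := by positivity
  have hgrow : ∀ u, ‖f u‖ ^ 2 ≤ K ^ 2 * (‖u‖ ^ 2) ^ (p + 1) := fun u => by
    have h1 : ‖f u‖ ≤ K * ‖u‖ ^ (p + 1) :=
      (hgrow₀ u).trans (by gcongr; linarith)
    calc ‖f u‖ ^ 2 ≤ (K * ‖u‖ ^ (p + 1)) ^ 2 := by gcongr
      _ = K ^ 2 * (‖u‖ ^ 2) ^ (p + 1) := by
        rw [mul_pow, ← Real.rpow_natCast (‖u‖ ^ (p + 1)), ← Real.rpow_natCast ‖u‖ 2,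
          ← Real.rpow_mul (norm_nonneg _), ← Real.rpow_mul (norm_nonneg _), mul_comm (p + 1)]
  -- The 2 multiplies ‖f(u)‖² in the decay estimate for `modEnergy`; the factor 2^{p+1} comes from
  -- splitting ‖u‖² = (‖u‖² − ‖ιu‖²) + ‖ιu‖².
  set C := 2 * (K ^ 2 * 2 ^ (p + 1)) with hC
  have hCpos : 0 < C := by positivity
  set κ := ν / 32 with hκ
  have hκpos : 0 < κ := by positivity
  -- Chosen so that κq − C = C is positive, which leaves room for the smallness condition.
  set q := 2 * C / κ with hq
  have hqpos : 0 < q := by positivity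
  have hκq : κ * q - C = C := by rw [hq]; field_simp; ring
  -- smallness of the energy
  obtain ⟨e, he, he1, he2⟩ : ∃ e, 0 < e ∧ C * 4 * (2 * e) ^ p ≤ κ ∧
      4 * √q * q * (p + 1) * ((e / c) ^ (2 / (p + 2))) ^ (p / 2) < C := by
    have t1 : Tendsto (fun e : ℝ => C * 4 * (2 * e) ^ p) (𝓝 0) (𝓝 0) := by
      have : Continuous fun e : ℝ => C * 4 * (2 * e) ^ p :=
        continuous_const.mul ((continuous_const.mul continuous_id).rpow_const fun _ => Or.inr hp.le)
      simpa [Real.zero_rpow hp.ne'] using this.tendsto 0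
    have t2 : Tendsto (fun e : ℝ => 4 * √q * q * (p + 1) * ((e / c) ^ (2 / (p + 2))) ^ (p / 2))
        (𝓝 0) (𝓝 0) := by
      have hp1 : 0 < 2 / (p + 2) := by positivity
      have hp2 : 0 < p / 2 := by positivity
      have : Continuous fun e : ℝ => 4 * √q * q * (p + 1) * ((e / c) ^ (2 / (p + 2))) ^ (p / 2) :=
        continuous_const.mul (((continuous_id.div_const c).rpow_const
          fun _ => Or.inr hp1.le).rpow_const fun _ => Or.inr hp2.le)
      simpa [Real.zero_rpow hp1.ne', Real.zero_rpow hp2.ne'] using this.tendsto 0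
    have h1 := (t1.eventually_le_const hκpos).filter_mono (nhdsWithin_le_nhds (s := Ioi 0))
    have h2 := (t2.eventually_lt_const hCpos).filter_mono (nhdsWithin_le_nhds (s := Ioi 0))
    obtain ⟨e, h3, h4, h5⟩ := (h1.and (h2.and self_mem_nhdsWithin)).exists
    exact ⟨e, h5, h3, h4⟩
  obtain ⟨M₃, hM₃, hup⟩ := exists_upper_bound hi hd hι hp hf he
  have hΦc := hf.continuous_potential
  have hιk : ι k ≠ 0 := fun h => hk0 (hi (by rw [h, map_zero]))
  have hNk : ∀ s : ℝ, ‖s • k‖ ^ 2 - ‖ι (s • k)‖ ^ 2 = 0 := fun s => by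
    rw [map_smul, norm_smul, norm_smul, hk]; ring
  obtain ⟨s, hs0, hse⟩ : ∃ s : ℝ, 0 < s ∧ Φ (s • k) < e := by
    have h0 : Φ 0 = 0 := by
      have := hf.euler 0
      rw [map_zero, inner_zero_right] at this
      have hp2 : p + 2 ≠ 0 := by positivity
      exact (mul_eq_zero.1 this.symm).resolve_left hp2
    have t1 : Tendsto (fun s : ℝ => Φ (s • k)) (𝓝 0) (𝓝 0) := by
      have : Continuous fun s : ℝ => Φ (s • k) := by fun_prop
      simpa [h0] using this.tendsto 0
    have h1 := (t1.eventually_lt_const he).filter_mono (nhdsWithin_le_nhds (s := Ioi 0))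
    obtain ⟨s, h2, h3⟩ := (h1.and self_mem_nhdsWithin).exists
    exact ⟨s, h3, h2⟩
  -- Half the value at the model datum: ‖ιu₀‖² > σ is then an open condition, and the lower constant
  -- is uniform on S.
  set σ := ‖ι (s • k)‖ ^ 2 / 2 with hσ
  have hsk : 0 < ‖ι (s • k)‖ := by
    rw [map_smul, norm_pos_iff]; exact smul_ne_zero hs0.ne' hιk
  have hσpos : 0 < σ := by positivity
  set Z := σ ^ (-(p / 2)) + 2 * p * √q with hZ
  have hZpos : 0 < Z := by positivity
  set S : Set (V × H) := {d | energy ι Φ d.1 d.2 < e} ∩ ({d | σ < ‖ι d.1‖ ^ 2} ∩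
    {d | modEnergy ι Q (ν / 8) d.1 d.2 < q * (‖ι d.1‖ ^ 2) ^ (p + 1)}) with hS
  refine ⟨S, (1 / Z) ^ (1 / p), M₃, ?_, ?_, by positivity, hM₃, ?_⟩
  · refine IsOpen.inter ?_ (IsOpen.inter ?_ ?_)
    · exact isOpen_lt (by unfold energy; fun_prop) continuous_const
    · exact isOpen_lt continuous_const (by fun_prop)
    · refine isOpen_lt (by unfold modEnergy; fun_prop) (continuous_const.mul ?_)
      exact Continuous.rpow_const (by fun_prop) fun _ => Or.inr (by positivity)
  -- For a kernel vector at rest the linear energy and `modEnergy` vanish, so the energy is just Φ(s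
  -- • k).
  · refine ⟨(s • k, 0), ?_, ?_, ?_⟩
    · simp only [mem_ofPred_eq, energy, hNk]; simpa using hse
    · simp only [mem_ofPred_eq, hσ]
      nlinarith [pow_pos hsk 2]
    · simp only [mem_ofPred_eq, modEnergy, hNk]
      simp only [zero_div, norm_zero, ne_eq, OfNat.ofNat_ne_zero, not_false_eq_true, zero_pow,
        add_zero, inner_zero_right, mul_zero]
      positivity
  · intro u v h hS0 t ht
    refine ⟨?_, hup u v h hS0.1.le t ht⟩
    have hN : ∀ t, 0 ≤ ‖u t‖ ^ 2 - ‖ι (u t)‖ ^ 2 := fun t =>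
      sub_nonneg.2 (pow_le_pow_left₀ (norm_nonneg _) (hι (u t)) 2)
    have hEe : ∀ t, 0 ≤ t → energy ι Φ (u t) (v t) ≤ e := fun t ht =>
      (h.energy_antitoneOn hi hd hf self_mem_Ici ht ht).trans hS0.1.le
    have hNe : ∀ t, 0 ≤ t → ‖u t‖ ^ 2 - ‖ι (u t)‖ ^ 2 ≤ 2 * e := fun t ht => by
      have h1 := hEe t ht
      have h2 := hf.nonneg (u t)
      rw [energy] at h1
      linarith [sq_nonneg ‖v t‖]
    have hDlow : ∀ t, (‖u t‖ ^ 2 - ‖ι (u t)‖ ^ 2) + ‖v t‖ ^ 2 ≤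
        4 * modEnergy ι Q (ν / 8) (u t) (v t) := fun t => by
      have h1 := neg_le_of_abs_le (hQ.abs_inner_le hν (u t) (v t))
      have h2 := hN t
      rw [modEnergy]
      linarith [sq_nonneg ‖v t‖]
    choose! D' hD' hD'le using fun t (ht : 0 ≤ t) =>
      h.hasDerivWithinAt_modEnergy hi hd hQ hν ht
    have hmain := slow_lower_bound (D := fun t => modEnergy ι Q (ν / 8) (u t) (v t)) (D' := D')
      (y := fun t => ‖ι (u t)‖ ^ 2) (y' := fun t => 2 * ⟪ι (u t), v t⟫_ℝ) (κ := κ) (C := C)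
      hp hqpos hD' (fun t ht => (h.deriv t ht).norm_sq) (hσpos.trans hS0.2.1) (fun t ht => ?_)
      (fun t ht => ?_) (fun t ht => ?_) hS0.2.2.le ht
    · obtain ⟨h1, h2⟩ := hmain
      have h1t : 0 < 1 + t := by linarith
      have h3 : (‖ι (u t)‖ ^ 2) ^ (-(p / 2)) ≤ Z * (1 + t) := by
        refine h2.trans ?_
        have h4 : (‖ι (u 0)‖ ^ 2) ^ (-(p / 2)) ≤ σ ^ (-(p / 2)) :=
          Real.rpow_le_rpow_of_nonpos hσpos hS0.2.1.le (by linarith)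
        have h5 : 0 ≤ σ ^ (-(p / 2)) * t := by positivity
        have h6 : 0 ≤ 2 * p * √q := by positivity
        rw [hZ]
        nlinarith
      have hpos : 0 < ‖ι (u t)‖ := by
        refine lt_of_le_of_ne (norm_nonneg _) fun h => ?_
        rw [← h] at h1; simp at h1
      have h7 : (‖ι (u t)‖ ^ 2) ^ (-(p / 2)) = (‖ι (u t)‖ ^ p)⁻¹ := by
        rw [← Real.rpow_natCast, ← Real.rpow_mul hpos.le, ← Real.rpow_neg hpos.le]
        congr 1; push_cast; ring
      rw [h7] at h3
      have h8 : 1 / Z / (1 + t) ≤ ‖ι (u t)‖ ^ p := by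
        rw [div_div, one_div]
        exact inv_le_of_inv_le₀ (by positivity) h3
      rw [← Real.div_rpow (by positivity) h1t.le]
      have h9 := Real.rpow_le_rpow (by positivity) h8 (show 0 ≤ 1 / p by positivity)
      rwa [← Real.rpow_mul hpos.le, mul_one_div_cancel hp.ne', Real.rpow_one] at h9
    · refine (hD'le t ht).trans ?_
      set N := ‖u t‖ ^ 2 - ‖ι (u t)‖ ^ 2 with hNd
      have h1 := hgrow (u t)
      have h2 := add_rpow_le (hN t) (sq_nonneg ‖ι (u t)‖) (show 0 ≤ p + 1 by positivity)
      rw [sub_add_cancel] at h2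
      -- Since N ≤ 2e, the part of the source in N is at most 4C(2e)^p times `modEnergy`. The choice
      -- of e absorbs it into half of the rate ν / 16 = 2κ.
      have h3 : N ^ (p + 1) ≤ (2 * e) ^ p * N := by
        rw [Real.rpow_add_one' (hN t) (by positivity)]
        exact mul_le_mul_of_nonneg_right (Real.rpow_le_rpow (hN t) (hNe t ht) hp.le) (hN t)
      have h4 := mul_le_mul_of_nonneg_left h2 (show 0 ≤ 2 * K ^ 2 by positivity)
      have h5 := mul_le_mul_of_nonneg_left h3 hCpos.le
      have h6 := hDlow t
      have h7 : N ≤ 4 * modEnergy ι Q (ν / 8) (u t) (v t) := by linarith [sq_nonneg ‖v t‖]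
      have h8 := mul_le_mul_of_nonneg_left h7 (show 0 ≤ C * (2 * e) ^ p by positivity)
      have hD0 : 0 ≤ modEnergy ι Q (ν / 8) (u t) (v t) := by
        linarith [hN t, sq_nonneg ‖v t‖]
      have h9 := mul_le_mul_of_nonneg_right he1 hD0
      have e1 : 2 * K ^ 2 * (2 ^ (p + 1) * (N ^ (p + 1) + (‖ι (u t)‖ ^ 2) ^ (p + 1))) =
        C * N ^ (p + 1) + C * (‖ι (u t)‖ ^ 2) ^ (p + 1) := by rw [hC]; ring
      have e2 : ν / 16 = 2 * κ := by rw [hκ]; ring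
      rw [e1] at h4
      rw [e2]
      linarith
    · have h1 := abs_real_inner_le_norm (ι (u t)) (v t)
      have h2 : ⟪ι (u t), v t⟫_ℝ ^ 2 ≤ ‖ι (u t)‖ ^ 2 * ‖v t‖ ^ 2 := by
        rw [← mul_pow, ← sq_abs]; exact pow_le_pow_left₀ (abs_nonneg _) h1 2
      have h3 := hDlow t
      have h4 := hN t
      have h5 := mul_le_mul_of_nonneg_left (show ‖v t‖ ^ 2 ≤
        4 * modEnergy ι Q (ν / 8) (u t) (v t) by linarith) (sq_nonneg ‖ι (u t)‖)
      linarith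
    · rw [hκq]
      refine lt_of_le_of_lt ?_ he2
      gcongr
      have h1 := hlow (u t)
      have h2 : c * ‖ι (u t)‖ ^ (p + 2) ≤ e := by
        have h3 := hEe t ht
        rw [energy] at h3
        linarith [sq_nonneg ‖v t‖, hN t]
      have h4 : ‖ι (u t)‖ ^ (p + 2) ≤ e / c := by rwa [le_div_iff₀ hc, mul_comm]
      have h5 := Real.rpow_le_rpow (by positivity) h4 (show 0 ≤ 2 / (p + 2) by positivity)
      rw [← Real.rpow_mul (norm_nonneg _), mul_div_cancel₀ _ (show p + 2 ≠ 0 by positivity)] at h5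
      simpa using h5

end Slow

/-! ### Square roots of bounded, then of unbounded nonnegative self-adjoint operators. -/

section SquareRoot
open Filter Topology

variable {H : Type*} [NormedAddCommGroup H] [InnerProductSpace ℝ H] [CompleteSpace H]

/-- The iteration converging to `1 - √(1 - K)`. -/
def sqrtIter (K : H →L[ℝ] H) : ℕ → H →L[ℝ] H
  | 0 => 0
  | n + 1 => (1 / 2 : ℝ) • (K + sqrtIter K n * sqrtIter K n)

/-- The scalar iteration dominating `sqrtIter`. -/
def sqrtIterBound : ℕ → ℝ
  | 0 => 0
  | n + 1 => (1 / 2 : ℝ) * (1 + sqrtIterBound n * sqrtIterBound n)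

theorem sqrtIterBound_mem (n : ℕ) : 0 ≤ sqrtIterBound n ∧ sqrtIterBound n ≤ 1 := by
  induction n with
  | zero => simp [sqrtIterBound]
  | succ n ih =>
    rw [sqrtIterBound]
    constructor <;> nlinarith [ih.1, ih.2]

theorem norm_sqrtIter_le {K : H →L[ℝ] H} (hK : ‖K‖ ≤ 1) (n : ℕ) :
    ‖sqrtIter K n‖ ≤ sqrtIterBound n := by
  induction n with
  | zero => simp [sqrtIter, sqrtIterBound]
  | succ n ih =>
    rw [sqrtIter, sqrtIterBound, norm_smul, Real.norm_of_nonneg (by norm_num)]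
    gcongr
    refine (norm_add_le _ _).trans (add_le_add hK ?_)
    exact (norm_mul_le _ _).trans (mul_le_mul ih ih (norm_nonneg _) (sqrtIterBound_mem n).1)

/-- The identity a² − b² = a(a − b) + (a − b)b needs no commutativity and is matched term by term by
the scalar iteration. The scalar increments telescope below 1, so they are summable even when ‖K‖ =
1. -/
theorem norm_sqrtIter_sub_le {K : H →L[ℝ] H} (hK : ‖K‖ ≤ 1) (n : ℕ) :
    ‖sqrtIter K (n + 1) - sqrtIter K n‖ ≤ sqrtIterBound (n + 1) - sqrtIterBound n := by
  induction n with
  | zero => simpa [sqrtIter, sqrtIterBound] using norm_sqrtIter_le hK 1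
  | succ n ih =>
    set a := sqrtIter K (n + 1) with ha
    set b := sqrtIter K n with hb
    set α := sqrtIterBound (n + 1) with hα
    set β := sqrtIterBound n with hβ
    have e : sqrtIter K (n + 1 + 1) - a = (1 / 2 : ℝ) • (a * (a - b) + (a - b) * b) := by
      have e1 : a = (1 / 2 : ℝ) • (K + b * b) := rfl
      have e2 : sqrtIter K (n + 1 + 1) = (1 / 2 : ℝ) • (K + a * a) := rfl
      rw [e2]
      nth_rewrite 3 [e1]
      rw [← smul_sub]
      congr 1
      noncomm_ring
    have e' : sqrtIterBound (n + 1 + 1) - α = (1 / 2 : ℝ) * (α * (α - β) + (α - β) * β) := by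
      have e1 : α = (1 / 2 : ℝ) * (1 + β * β) := rfl
      have e2 : sqrtIterBound (n + 1 + 1) = (1 / 2 : ℝ) * (1 + α * α) := rfl
      rw [e2]
      nth_rewrite 3 [e1]
      ring
    have hα0 := (sqrtIterBound_mem (n + 1)).1
    have hd0 : 0 ≤ α - β := (norm_nonneg _).trans ih
    rw [e, e', norm_smul, Real.norm_of_nonneg (by norm_num)]
    gcongr
    refine (norm_add_le _ _).trans (add_le_add ?_ ?_)
    · exact (norm_mul_le _ _).trans (mul_le_mul (norm_sqrtIter_le hK _) ih (norm_nonneg _) hα0)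
    · exact (norm_mul_le _ _).trans (mul_le_mul ih (norm_sqrtIter_le hK _) (norm_nonneg _) hd0)

/-- The nonnegative square root of `1 - K` for a symmetric contraction `K`. -/
theorem exists_sqrt_one_sub {K : H →L[ℝ] H} (hK : ‖K‖ ≤ 1)
    (hs : ∀ x y, ⟪K x, y⟫_ℝ = ⟪x, K y⟫_ℝ) :
    ∃ S : H →L[ℝ] H, S * S = 1 - K ∧ (∀ x y, ⟪S x, y⟫_ℝ = ⟪x, S y⟫_ℝ) ∧ (∀ x, 0 ≤ ⟪S x, x⟫_ℝ) ∧
      ‖1 - S‖ ≤ 1 ∧ ∀ T : H →L[ℝ] H, T * K = K * T → T * S = S * T := by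
  have hsum : Summable fun n => sqrtIterBound (n + 1) - sqrtIterBound n := by
    refine summable_of_sum_range_le (c := 1)
      (fun n => (norm_nonneg _).trans (norm_sqrtIter_sub_le hK n)) fun n => ?_
    rw [Finset.sum_range_sub]
    have := (sqrtIterBound_mem n).2
    simpa [sqrtIterBound] using this
  have hcau : CauchySeq (sqrtIter K) := cauchySeq_of_dist_le_of_summable _ (fun n => by
    rw [dist_comm, dist_eq_norm]; exact norm_sqrtIter_sub_le hK n) hsum
  obtain ⟨Y, hY⟩ := cauchySeq_tendsto_of_complete hcau
  have hYn : ‖Y‖ ≤ 1 := le_of_tendsto hY.norm (Eventually.of_forall fun n =>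
    (norm_sqrtIter_le hK n).trans (sqrtIterBound_mem n).2)
  have hYeq : Y = (1 / 2 : ℝ) • (K + Y * Y) := by
    have h1 : Tendsto (fun n => sqrtIter K (n + 1)) atTop (𝓝 Y) :=
      hY.comp (tendsto_add_atTop_nat 1)
    exact tendsto_nhds_unique h1 ((tendsto_const_nhds.add (hY.mul hY)).const_smul _)
  have happ : ∀ x, Tendsto (fun n => sqrtIter K n x) atTop (𝓝 (Y x)) := fun x =>
    ((ContinuousLinearMap.apply ℝ H x).continuous.tendsto Y).comp hY
  have hsym : ∀ n x y, ⟪sqrtIter K n x, y⟫_ℝ = ⟪x, sqrtIter K n y⟫_ℝ := by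
    intro n
    induction n with
    | zero => simp [sqrtIter]
    | succ n ih =>
      intro x y
      simp only [sqrtIter, smul_apply, add_apply,
        mul_apply_eq_comp, real_inner_smul_left, real_inner_smul_right,
        inner_add_left, inner_add_right, hs, ih]
  have hYs : ∀ x y, ⟪Y x, y⟫_ℝ = ⟪x, Y y⟫_ℝ := fun x y =>
    tendsto_nhds_unique ((happ x).inner tendsto_const_nhds)
      (by simpa only [hsym] using tendsto_const_nhds.inner (happ y))
  refine ⟨1 - Y, ?_, fun x y => ?_, fun x => ?_, by simpa using hYn, fun T hT => ?_⟩
  · have h2 : (2 : ℝ) • Y = K + Y * Y := by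
      conv_lhs => rw [hYeq]
      rw [smul_smul]; norm_num
    have h3 : Y * Y = (2 : ℝ) • Y - K := by rw [h2]; abel
    have : (1 - Y) * (1 - Y) = 1 - (2 : ℝ) • Y + Y * Y := by
      rw [two_smul]; noncomm_ring
    rw [this, h3]; abel
  · simp only [sub_apply, one_apply_eq_self, inner_sub_left,
      inner_sub_right, hYs]
  · simp only [sub_apply, one_apply_eq_self, inner_sub_left]
    have h1 := real_inner_le_norm (Y x) x
    have h2 := (Y.le_opNorm x).trans (mul_le_mul_of_nonneg_right hYn (norm_nonneg x))
    have h3 := mul_le_mul_of_nonneg_right h2 (norm_nonneg x)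
    rw [real_inner_self_eq_norm_sq]
    nlinarith
  · have hc : ∀ n, T * sqrtIter K n = sqrtIter K n * T := by
      intro n
      induction n with
      | zero => simp [sqrtIter]
      | succ n ih =>
        rw [sqrtIter, mul_smul_comm, smul_mul_assoc, mul_add, add_mul, hT]
        rw [← mul_assoc, ih, mul_assoc, ih, mul_assoc]
    have h1 : T * Y = Y * T := tendsto_nhds_unique (tendsto_const_nhds.mul hY)
      (by simpa only [hc] using hY.mul tendsto_const_nhds)
    rw [mul_sub, sub_mul, h1, mul_one, one_mul]

theorem mem_graph_iff_of_isSelfAdjoint {A : H →ₗ.[ℝ] H} (hA : IsSelfAdjoint A) {x y : H} :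
    (x, y) ∈ A.graph ↔ ∀ a b, (a, b) ∈ A.graph → ⟪b, x⟫_ℝ = ⟪a, y⟫_ℝ := by
  have h1 := LinearPMap.adjoint_graph_eq_graph_adjoint hA.dense_domain
  rw [LinearPMap.isSelfAdjoint_def.1 hA] at h1
  conv_lhs => rw [h1, Submodule.mem_adjoint_iff]
  simp only [sub_eq_zero]

theorem isSelfAdjoint_of_mem_graph_iff {A : H →ₗ.[ℝ] H} (hd : Dense (A.domain : Set H))
    (h : ∀ x y, (x, y) ∈ A.graph ↔ ∀ a b, (a, b) ∈ A.graph → ⟪b, x⟫_ℝ = ⟪a, y⟫_ℝ) :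
    IsSelfAdjoint A := by
  rw [LinearPMap.isSelfAdjoint_def]
  refine LinearPMap.eq_of_eq_graph ?_
  rw [LinearPMap.adjoint_graph_eq_graph_adjoint hd]
  ext ⟨x, y⟩
  rw [Submodule.mem_adjoint_iff, h]
  simp only [sub_eq_zero]

theorem IsNonnegSelfAdjoint.inner_nonneg {A : H →ₗ.[ℝ] H} (hA : IsNonnegSelfAdjoint A) {x y : H}
    (h : (x, y) ∈ A.graph) : 0 ≤ ⟪y, x⟫_ℝ := by
  rw [LinearPMap.mem_graph_iff] at h
  obtain ⟨z, rfl, rfl⟩ := h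
  exact hA.nonneg z

/-- The resolvent `(1 + A)⁻¹` of a nonnegative self-adjoint operator. -/
theorem IsNonnegSelfAdjoint.exists_resolvent {A : H →ₗ.[ℝ] H} (hA : IsNonnegSelfAdjoint A) :
    ∃ R : H →L[ℝ] H, (∀ x y, (x, y) ∈ A.graph ↔ ∃ z, x = R z ∧ y = z - R z) := by
  have hcl : IsClosed (A.graph : Set (H × H)) := hA.isSelfAdjoint.isClosed
  have : CompleteSpace A.graph := hcl.completeSpace_coe
  -- This is 1 + A, read on the graph. Nonnegativity of A bounds it below, so its range is closed; R
  -- is the first component of its inverse.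
  set M : A.graph →L[ℝ] H :=
    (ContinuousLinearMap.fst ℝ H H + ContinuousLinearMap.snd ℝ H H) ∘L A.graph.subtypeL with hM
  have hMa : ∀ w : A.graph, M w = w.1.1 + w.1.2 := fun w => rfl
  have hnorm : ∀ w : A.graph, ‖w.1.1‖ ^ 2 + ‖w.1.2‖ ^ 2 ≤ ‖M w‖ ^ 2 := fun w => by
    have h1 : 0 ≤ ⟪w.1.2, w.1.1⟫_ℝ := hA.inner_nonneg w.2
    rw [hMa, norm_add_sq_real, real_inner_comm]
    linarith
  have hanti : AntilipschitzWith 1 M := by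
    refine M.antilipschitz_of_bound fun w => ?_
    have h1 := hnorm w
    rw [NNReal.coe_one, one_mul, Submodule.coe_norm, Prod.norm_def]
    refine max_le ?_ ?_ <;> refine le_of_sq_le_sq ?_ (norm_nonneg _)
    · linarith [sq_nonneg ‖w.1.2‖]
    · linarith [sq_nonneg ‖w.1.1‖]
  have hrc : IsClosed (Set.range M) := hanti.isClosed_range M.uniformContinuous
  have hrange : LinearMap.range M.toLinearMap = ⊤ := by
    have : CompleteSpace (LinearMap.range M.toLinearMap) := hrc.completeSpace_coe
    rw [← Submodule.orthogonal_eq_bot_iff, Submodule.eq_bot_iff]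
    intro y hy
    -- Orthogonality to the range of 1 + A puts (y, −y) in the graph of the adjoint, which is A;
    -- nonnegativity then gives −‖y‖² ≥ 0.
    have h1 : (y, -y) ∈ A.graph := by
      rw [mem_graph_iff_of_isSelfAdjoint hA.isSelfAdjoint]
      intro a b hab
      have h2 : ⟪a + b, y⟫_ℝ = 0 := hy _ ⟨⟨(a, b), hab⟩, rfl⟩
      rw [inner_add_left] at h2
      rw [inner_neg_right]; linarith
    have h2 := hA.inner_nonneg h1
    rw [inner_neg_left, real_inner_self_eq_norm_sq] at h2
    have h3 : ‖y‖ ^ 2 = 0 := le_antisymm (by linarith) (sq_nonneg _)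
    simpa using h3
  set e := ContinuousLinearEquiv.ofBijective M
    (LinearMap.ker_eq_bot.2 hanti.injective) hrange with he
  have hMe : ∀ w, e w = M w := fun w => rfl
  refine ⟨ContinuousLinearMap.fst ℝ H H ∘L A.graph.subtypeL ∘L e.symm.toContinuousLinearMap,
    fun x y => ⟨fun h => ⟨x + y, ?_, ?_⟩, ?_⟩⟩
  · have h1 : e.symm (x + y) = ⟨(x, y), h⟩ := by rw [e.symm_apply_eq]; rfl
    simp [h1]
  · have h1 : e.symm (x + y) = ⟨(x, y), h⟩ := by rw [e.symm_apply_eq]; rfl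
    simp [h1]
  · rintro ⟨z, rfl, rfl⟩
    have h1 : (e.symm z).1.1 + (e.symm z).1.2 = z := by
      rw [← hMa, ← hMe, e.apply_symm_apply]
    have h2 : ((e.symm z).1.1, z - (e.symm z).1.1) = (e.symm z).1 := by
      refine Prod.ext rfl ?_
      rw [sub_eq_iff_eq_add, add_comm]; exact h1.symm
    change ((e.symm z).1.1, z - (e.symm z).1.1) ∈ A.graph
    rw [h2]; exact (e.symm z).2

/-- Every nonnegative self-adjoint operator has a nonnegative self-adjoint square root. -/
theorem IsNonnegSelfAdjoint.exists_isNonnegSqrt {A : H →ₗ.[ℝ] H} (hA : IsNonnegSelfAdjoint A) :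
    ∃ B, IsNonnegSqrt A B := by
  obtain ⟨R, hR⟩ := hA.exists_resolvent
  have hgr : ∀ z, (R z, z - R z) ∈ A.graph := fun z => (hR _ _).2 ⟨z, rfl, rfl⟩
  have hn : ∀ z, ‖R z‖ ^ 2 + ‖z - R z‖ ^ 2 ≤ ‖z‖ ^ 2 := fun z => by
    have h1 := hA.inner_nonneg (hgr z)
    have h2 := norm_add_sq_real (z - R z) (R z)
    rw [sub_add_cancel] at h2
    linarith
  have hR1 : ‖R‖ ≤ 1 := R.opNorm_le_bound zero_le_one fun z => by
    rw [one_mul]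
    exact le_of_sq_le_sq (by linarith [hn z, sq_nonneg ‖z - R z‖]) (norm_nonneg _)
  have hR2 : ‖1 - R‖ ≤ 1 := (1 - R).opNorm_le_bound zero_le_one fun z => by
    rw [one_mul]
    exact le_of_sq_le_sq (by
      have := hn z
      simp only [sub_apply, one_apply_eq_self]
      linarith [sq_nonneg ‖R z‖]) (norm_nonneg _)
  have hRs : ∀ x y, ⟪R x, y⟫_ℝ = ⟪x, R y⟫_ℝ := fun x y => by
    have := (mem_graph_iff_of_isSelfAdjoint hA.isSelfAdjoint).1 (hgr y) _ _ (hgr x)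
    rw [inner_sub_left, inner_sub_right] at this
    linarith
  -- With R = (1 + A)⁻¹, S = √R and T = √(1 − R), the square root of A is T S⁻¹, whose graph is the
  -- set of pairs (Sz, Tz).
  obtain ⟨S, hSS, hSs, hS0, hS1, hSc⟩ := exists_sqrt_one_sub hR2 (fun x y => by
    simp only [sub_apply, one_apply_eq_self, inner_sub_left,
      inner_sub_right, hRs])
  obtain ⟨T, hTT, hTs, hT0, hT1, hTc⟩ := exists_sqrt_one_sub hR1 hRs
  rw [sub_sub_cancel] at hSS
  have hRS : S * R = R * S := by rw [← hSS, mul_assoc]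
  have hST : S * T = T * S := hTc S hRS
  -- P = √S gives nonnegativity of the new operator: ⟪Tz, Sz⟫ = ⟪T(Pz), Pz⟫ ≥ 0.
  obtain ⟨P, hPP, hPs, -, -, hPc⟩ := exists_sqrt_one_sub hS1 (fun x y => by
    simp only [sub_apply, one_apply_eq_self, inner_sub_left,
      inner_sub_right, hSs])
  rw [sub_sub_cancel] at hPP
  have hTP : T * P = P * T := hPc T (by rw [mul_sub, sub_mul, hST, mul_one, one_mul])
  have aSS : ∀ x, S (S x) = R x := fun x => DFunLike.congr_fun hSS x
  have aTT : ∀ x, T (T x) = x - R x := fun x => DFunLike.congr_fun hTT x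
  have aST : ∀ x, S (T x) = T (S x) := fun x => DFunLike.congr_fun hST x
  have aPP : ∀ x, P (P x) = S x := fun x => DFunLike.congr_fun hPP x
  have aTP : ∀ x, T (P x) = P (T x) := fun x => DFunLike.congr_fun hTP x
  have hRinj : ∀ z, R z = 0 → z = 0 := fun z hz => by
    have h1 := hgr z
    rw [hz, sub_zero] at h1
    exact A.graph_fst_eq_zero_snd h1 rfl
  have hSinj : ∀ z, S z = 0 → z = 0 := fun z hz => hRinj z (by rw [← aSS, hz, map_zero])
  set g : Submodule ℝ (H × H) := LinearMap.range (S.prod T).toLinearMap with hg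
  have hgm : ∀ x y, (x, y) ∈ g ↔ ∃ z, S z = x ∧ T z = y := fun x y => by
    rw [hg, LinearMap.mem_range]
    exact exists_congr fun z => Prod.ext_iff
  have hBg : g.toLinearPMap.graph = g := by
    refine Submodule.toLinearPMap_graph_eq g fun w hw h0 => ?_
    obtain ⟨z, h1, h2⟩ := (hgm w.1 w.2).1 hw
    rw [← h2, hSinj z (h1.trans h0), map_zero]
  have hBd : Dense (g.toLinearPMap.domain : Set H) := by
    refine hA.dense_domain.mono fun x hx => ?_
    obtain ⟨z, hz, -⟩ := (hR _ _).1 (A.mem_graph ⟨x, hx⟩)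
    refine ⟨(x, T (S z)), (hgm _ _).2 ⟨S z, ?_, rfl⟩, rfl⟩
    rw [aSS, ← hz]
  refine ⟨g.toLinearPMap, ⟨hBd, isSelfAdjoint_of_mem_graph_iff hBd fun y z => ?_, fun w => ?_⟩,
    fun x y => ?_⟩
  · rw [hBg]
    constructor
    · rintro hyz a b hab
      obtain ⟨x, rfl, rfl⟩ := (hgm _ _).1 hyz
      obtain ⟨w, rfl, rfl⟩ := (hgm _ _).1 hab
      rw [hTs, hSs, aST]
    · intro h
      have h1 : S z = T y := by
        refine ext_inner_left ℝ fun x => ?_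
        have := h (S x) (T x) ((hgm _ _).2 ⟨x, rfl, rfl⟩)
        rw [← hSs, ← hTs, this]
      -- This preimage comes from S² + T² = 1 together with Sz = Ty.
      refine (hgm _ _).2 ⟨S y + T z, ?_, ?_⟩
      · rw [map_add, aSS, aST, h1, aTT]; abel
      · rw [map_add, ← aST, ← h1, aSS, aTT]; abel
  · have hw := g.toLinearPMap.mem_graph w
    rw [hBg] at hw
    obtain ⟨z, h1, h2⟩ := (hgm _ _).1 hw
    rw [← h1, ← h2, ← aPP, ← hPs, ← aTP]
    exact hT0 _
  · rw [hBg, hR]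
    constructor
    · rintro ⟨z, rfl, rfl⟩
      exact ⟨T (S z), (hgm _ _).2 ⟨S z, aSS z, rfl⟩, (hgm _ _).2 ⟨T z, aST z, aTT z⟩⟩
    · rintro ⟨z, hxz, hzy⟩
      obtain ⟨a, rfl, rfl⟩ := (hgm _ _).1 hxz
      obtain ⟨w, h1, rfl⟩ := (hgm _ _).1 hzy
      have hq : S (S a + T w) = a := by rw [map_add, aSS, aST, h1, aTT]; abel
      have hq2 : T (S a + T w) = w := by rw [map_add, ← aST, ← h1, aSS, aTT]; abel
      refine ⟨S a + T w, ?_, ?_⟩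
      · rw [← aSS, hq]
      · rw [← aTT, hq2]

theorem IsNonnegSelfAdjoint.isNonnegSqrt_opSqrt {A : H →ₗ.[ℝ] H} (hA : IsNonnegSelfAdjoint A) :
    IsNonnegSqrt A (opSqrt A) := by
  rw [opSqrt, dif_pos hA.exists_isNonnegSqrt]
  exact hA.exists_isNonnegSqrt.choose_spec

end SquareRoot

/-! ### The Hilbert space D(A^{1/2}) and the spectral gap off the kernel. -/

section Domain
open Filter Topology

variable {H : Type*} [NormedAddCommGroup H] [InnerProductSpace ℝ H] [CompleteSpace H]
  {A : H →ₗ.[ℝ] H}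

namespace SqrtDomain

theorem inner_eq (u v : SqrtDomain A) : ⟪u, v⟫_ℝ = ⟪toH u, toH v⟫_ℝ + ⟪half u, half v⟫_ℝ := rfl

theorem norm_sq_eq (u : SqrtDomain A) : ‖u‖ ^ 2 = ‖toH u‖ ^ 2 + ‖half u‖ ^ 2 := by
  rw [norm_eq, Real.sq_sqrt (by positivity)]

theorem norm_toH_le (u : SqrtDomain A) : ‖toH u‖ ≤ ‖u‖ :=
  le_of_sq_le_sq (by rw [norm_sq_eq]; linarith [sq_nonneg ‖half u‖]) (norm_nonneg _)

theorem norm_half_le (u : SqrtDomain A) : ‖half u‖ ≤ ‖u‖ :=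
  le_of_sq_le_sq (by rw [norm_sq_eq]; linarith [sq_nonneg ‖toH u‖]) (norm_nonneg _)

theorem mem_graph (u : SqrtDomain A) : (toH u, half u) ∈ (opSqrt A).graph :=
  (opSqrt A).mem_graph u

theorem exists_of_mem_graph {x y : H} (h : (x, y) ∈ (opSqrt A).graph) :
    ∃ u : SqrtDomain A, toH u = x ∧ half u = y := by
  obtain ⟨u, h1, h2⟩ := (LinearPMap.mem_graph_iff _).1 h
  exact ⟨u, h1, h2⟩

/-- The inclusion of `D(A^{1/2})` in `H`, as a bounded operator. -/
def embed (A : H →ₗ.[ℝ] H) : SqrtDomain A →L[ℝ] H :=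
  (toH : SqrtDomain A →ₗ[ℝ] H).mkContinuous 1 fun u => by rw [one_mul]; exact norm_toH_le u

theorem embed_apply (u : SqrtDomain A) : embed A u = toH u := rfl

theorem embed_injective : Function.Injective (embed A) := toH_injective

theorem norm_embed_le (u : SqrtDomain A) : ‖embed A u‖ ≤ ‖u‖ := norm_toH_le u

theorem norm_sq_sub (u : SqrtDomain A) : ‖u‖ ^ 2 - ‖embed A u‖ ^ 2 = ‖half u‖ ^ 2 := by
  rw [norm_sq_eq, embed_apply]; ring

theorem denseRange_embed (hA : IsNonnegSelfAdjoint A) : DenseRange (embed A) := by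
  have h := hA.isNonnegSqrt_opSqrt.isNonnegSelfAdjoint.dense_domain
  refine h.mono fun x hx => ⟨(⟨x, hx⟩ : (opSqrt A).domain), rfl⟩

/-- A Cauchy sequence converges together with its image under A^{1/2}, and the graph of a
self-adjoint operator is closed. -/
theorem completeSpace (hA : IsNonnegSelfAdjoint A) : CompleteSpace (SqrtDomain A) := by
  have hcl : IsClosed ((opSqrt A).graph : Set (H × H)) :=
    hA.isNonnegSqrt_opSqrt.isNonnegSelfAdjoint.isSelfAdjoint.isClosed
  refine Metric.complete_of_cauchySeq_tendsto fun u hu => ?_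
  have hL : ∀ L : SqrtDomain A →ₗ[ℝ] H, (∀ u, ‖L u‖ ≤ ‖u‖) → ∃ x,
      Tendsto (fun n => L (u n)) atTop (𝓝 x) := fun L hL => by
    refine cauchySeq_tendsto_of_complete ?_
    exact ((L.mkContinuous 1 fun u => by
      rw [one_mul]; exact hL u).uniformContinuous.comp_cauchySeq hu)
  obtain ⟨x, hx⟩ := hL toH norm_toH_le
  obtain ⟨y, hy⟩ := hL half norm_half_le
  obtain ⟨w, rfl, rfl⟩ := exists_of_mem_graph
    (hcl.mem_of_tendsto (hx.prodMk_nhds hy) (Eventually.of_forall fun n => mem_graph (u n)))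
  refine ⟨w, ?_⟩
  rw [tendsto_iff_norm_sub_tendsto_zero]
  simp only [norm_eq, map_sub]
  have h1 := ((tendsto_iff_norm_sub_tendsto_zero.1 hx).pow 2).add
    ((tendsto_iff_norm_sub_tendsto_zero.1 hy).pow 2)
  simpa using h1.sqrt

end SqrtDomain

theorem mem_opKer_iff {x : H} : x ∈ opKer A ↔ (x, (0 : H)) ∈ A.graph := by
  rw [opKer, Submodule.mem_map, LinearPMap.mem_graph_iff]
  exact ⟨fun ⟨y, hy, hx⟩ => ⟨y, hx, hy⟩, fun ⟨y, hx, hy⟩ => ⟨y, hy, hx⟩⟩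

theorem isClosed_opKer (hA : IsNonnegSelfAdjoint A) : IsClosed (opKer A : Set H) := by
  have hcl : IsClosed (A.graph : Set (H × H)) := hA.isSelfAdjoint.isClosed
  have : (opKer A : Set H) = (fun x => (x, (0 : H))) ⁻¹' (A.graph : Set (H × H)) := by
    ext x; exact mem_opKer_iff
  rw [this]
  exact hcl.preimage (by fun_prop)

/-- If z = A^{1/2}x and A^{1/2}z = 0, then ‖z‖² = ⟪A^{1/2}x, z⟫ = ⟪x, A^{1/2}z⟫ = 0. -/
theorem exists_half_eq_zero (hA : IsNonnegSelfAdjoint A) {x : H} (hx : x ∈ opKer A) :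
    ∃ k : SqrtDomain A, k.toH = x ∧ k.half = 0 := by
  have hB := hA.isNonnegSqrt_opSqrt
  obtain ⟨z, h1, h2⟩ := (hB.sq_eq x 0).1 (mem_opKer_iff.1 hx)
  have h3 := (mem_graph_iff_of_isSelfAdjoint hB.isNonnegSelfAdjoint.isSelfAdjoint).1 h1 z 0 h2
  rw [inner_zero_left] at h3
  obtain rfl : z = 0 := inner_self_eq_zero.1 h3.symm
  exact SqrtDomain.exists_of_mem_graph h1

/-- Coercivity on the orthogonal complement of the kernel as a spectral gap. -/
theorem hasSpectralGap (hA : IsNonnegSelfAdjoint A) {ν : ℝ} (hν : 0 < ν)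
    (h : ∀ u : SqrtDomain A, u.toH ∈ (opKer A)ᗮ → ν * ‖u.toH‖ ^ 2 ≤ ‖u.half‖ ^ 2) :
    HasSpectralGap (SqrtDomain.embed A) (opKer A)ᗮ.starProjection ν := by
  have := (isClosed_opKer hA).completeSpace_coe
  -- The projection alters u by a vector of ker A, where A^{1/2} vanishes; so it stays in the domain
  -- with the same image under A^{1/2}.
  have hlift : ∀ u : SqrtDomain A, ∃ φ : SqrtDomain A,
      φ.toH = (opKer A)ᗮ.starProjection u.toH ∧ φ.half = u.half := fun u => by
    have h1 : u.toH - (opKer A)ᗮ.starProjection u.toH ∈ opKer A := by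
      have := Submodule.sub_starProjection_mem_orthogonal (K := (opKer A)ᗮ) u.toH
      rwa [Submodule.orthogonal_orthogonal] at this
    obtain ⟨k, hk, hk0⟩ := exists_half_eq_zero hA h1
    exact ⟨u - k, by rw [map_sub, hk, sub_sub_cancel], by rw [map_sub, hk0, sub_zero]⟩
  refine ⟨hν, fun x => ?_, fun u => ?_, fun u => ?_⟩
  · exact Submodule.norm_starProjection_apply_le _ x
  · obtain ⟨φ, h1, h2⟩ := hlift u
    refine ⟨φ, h1, ?_⟩
    rw [SqrtDomain.norm_sq_sub, SqrtDomain.inner_eq, h2, real_inner_self_eq_norm_sq]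
    exact add_sub_cancel_left _ _
  · obtain ⟨φ, h1, h2⟩ := hlift u
    rw [SqrtDomain.norm_sq_sub, SqrtDomain.embed_apply, ← h1, ← h2]
    exact h φ (h1 ▸ Submodule.starProjection_apply_mem _ _)

end Domain

/-! ### The power nonlinearity as a convex gradient. -/

section Power
open Filter Topology

/-- Young's inequality with exponents (r + 1)/r and r + 1. The case r = p gives the local Lipschitz
estimate, and r = p + 1 the convexity of the potential. -/
theorem rpow_young {r a b : ℝ} (hr : 0 < r) (ha : 0 ≤ a) (hb : 0 ≤ b) :
    (r + 1) * (a ^ r * b) ≤ r * a ^ (r + 1) + b ^ (r + 1) := by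
  have hpq : ((r + 1) / r).HolderConjugate (r + 1) := by
    rw [Real.holderConjugate_iff]
    constructor
    · rw [lt_div_iff₀ hr]; linarith
    · field_simp
  have h := Real.young_inequality_of_nonneg (Real.rpow_nonneg ha r) hb hpq
  rw [← Real.rpow_mul ha, mul_div_cancel₀ _ hr.ne'] at h
  have h1 : a ^ (r + 1) / ((r + 1) / r) + b ^ (r + 1) / (r + 1) =
      (r * a ^ (r + 1) + b ^ (r + 1)) / (r + 1) := by field_simp
  rw [h1, le_div_iff₀ (by positivity)] at h
  linarith

/-- For 0 ≤ b ≤ a, Young's inequality gives a^{p+1} − b^{p+1} ≤ (p + 1) a^p (a − b). Opposite signs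
are direct, and symmetry covers the rest. -/
theorem abs_rpow_mul_sub_le {p : ℝ} (hp : 0 < p) (a b : ℝ) :
    |(|a| ^ p * a - |b| ^ p * b)| ≤ (p + 1) * ((|a| ^ p + |b| ^ p) * |a - b|) := by
  have ordered : ∀ a b : ℝ, 0 ≤ b → b ≤ a →
      |(|a| ^ p * a - |b| ^ p * b)| ≤ (p + 1) * ((|a| ^ p + |b| ^ p) * |a - b|) := by
    intro a b hb hab
    have ha : 0 ≤ a := hb.trans hab
    have hy := rpow_young hp ha hb
    have h1 : ∀ x : ℝ, 0 ≤ x → x ^ (p + 1) = x ^ p * x := fun x hx =>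
      Real.rpow_add_one' hx (by positivity)
    rw [h1 a ha, h1 b hb] at hy
    have h2 : b ^ p * b ≤ a ^ p * a := by gcongr
    rw [abs_of_nonneg ha, abs_of_nonneg hb, abs_of_nonneg (sub_nonneg.2 h2),
      abs_of_nonneg (sub_nonneg.2 hab)]
    have h3 : 0 ≤ (p + 1) * (b ^ p * (a - b)) := by
      have := sub_nonneg.2 hab; positivity
    nlinarith
  have opposite : ∀ a b : ℝ, 0 ≤ a → b ≤ 0 →
      |(|a| ^ p * a - |b| ^ p * b)| ≤ (p + 1) * ((|a| ^ p + |b| ^ p) * |a - b|) := by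
    intro a b ha hb
    have h1 : 0 ≤ |a| ^ p := by positivity
    have h2 : 0 ≤ |b| ^ p := by positivity
    have h3 : |a - b| = a - b := abs_of_nonneg (by linarith)
    have h4 : |a| ^ p * a - |b| ^ p * b ≤ (|a| ^ p + |b| ^ p) * (a - b) := by nlinarith
    have h5 : 0 ≤ |a| ^ p * a - |b| ^ p * b := by nlinarith
    rw [abs_of_nonneg h5, h3]
    have h6 : 0 ≤ p * ((|a| ^ p + |b| ^ p) * (a - b)) := by
      have : 0 ≤ a - b := by linarith
      positivity
    linarith
  have swap : ∀ a b : ℝ,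
      |(|a| ^ p * a - |b| ^ p * b)| ≤ (p + 1) * ((|a| ^ p + |b| ^ p) * |a - b|) →
      |(|b| ^ p * b - |a| ^ p * a)| ≤ (p + 1) * ((|b| ^ p + |a| ^ p) * |b - a|) := by
    intro a b h
    rwa [abs_sub_comm, abs_sub_comm b a, add_comm (|b| ^ p)]
  have neg : ∀ a b : ℝ,
      |(|-a| ^ p * -a - |-b| ^ p * -b)| ≤ (p + 1) * ((|-a| ^ p + |-b| ^ p) * |-a - -b|) →
      |(|a| ^ p * a - |b| ^ p * b)| ≤ (p + 1) * ((|a| ^ p + |b| ^ p) * |a - b|) := by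
    intro a b h
    rw [abs_neg, abs_neg, show |a| ^ p * -a - |b| ^ p * -b = -(|a| ^ p * a - |b| ^ p * b) by ring,
      abs_neg, show -a - -b = -(a - b) by ring, abs_neg] at h
    exact h
  rcases le_total 0 a with ha | ha <;> rcases le_total 0 b with hb | hb
  · rcases le_total a b with h | h
    · exact swap _ _ (ordered b a ha h)
    · exact ordered a b hb h
  · exact opposite a b ha hb
  · exact swap _ _ (opposite b a hb ha)
  · refine neg _ _ ?_
    rcases le_total a b with h | h
    · exact ordered (-a) (-b) (by linarith) (by linarith)
    · exact swap _ _ (ordered (-b) (-a) (by linarith) (by linarith))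

theorem abs_rpow_mul_sq (p a : ℝ) :
    (|a| ^ p * a) ^ 2 = |a| ^ (2 * p) * a ^ 2 := by
  rw [mul_pow, ← Real.rpow_natCast (|a| ^ p), ← Real.rpow_mul (abs_nonneg _)]
  congr 2; push_cast; ring

theorem abs_rpow_mul_mul_self {p : ℝ} (hp : 0 < p) (a : ℝ) :
    |a| ^ p * a * a = |a| ^ (p + 2) := by
  rw [Real.rpow_add' (abs_nonneg _) (by positivity), mul_assoc, ← sq, ← sq_abs a]
  norm_cast

variable {X : Type*} [MeasurableSpace X] {μ : Measure X}

theorem integrable_of_eLpNorm_one_le {g : X → ℝ} (hg : AEStronglyMeasurable g μ) {C : ℝ}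
    (hC : 0 ≤ C) (h0 : ∀ x, 0 ≤ g x) (h : eLpNorm g 1 μ ≤ ENNReal.ofReal C) :
    Integrable g μ ∧ ∫ x, g x ∂μ ≤ C := by
  have hi : Integrable g μ := memLp_one_iff_integrable.1 ⟨hg, h.trans_lt ENNReal.ofReal_lt_top⟩
  refine ⟨hi, ?_⟩
  rw [eLpNorm_one_eq_lintegral_enorm, ← ofReal_integral_norm_eq_lintegral_enorm hi,
    ENNReal.ofReal_le_ofReal_iff hC] at h
  simpa only [Real.norm_of_nonneg (h0 _)] using h

theorem L2_norm_sq_eq_integral (u : Lp ℝ 2 μ) : ‖u‖ ^ 2 = ∫ x, u x ^ 2 ∂μ := by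
  rw [← real_inner_self_eq_norm_sq, L2.inner_def]
  refine integral_congr_ae (Eventually.of_forall fun x => ?_)
  simp [sq]

theorem L2_inner_eq_integral (u v : Lp ℝ 2 μ) : ⟪u, v⟫_ℝ = ∫ x, u x * v x ∂μ := by
  rw [L2.inner_def]
  refine integral_congr_ae (Eventually.of_forall fun x => ?_)
  simp [mul_comm]

theorem L2_integrable_mul (u v : Lp ℝ 2 μ) : Integrable (fun x => u x * v x) μ :=
  (Lp.memLp u).integrable_mul (Lp.memLp v)

variable {A : Lp ℝ 2 μ →ₗ.[ℝ] Lp ℝ 2 μ} {p : ℝ}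

/-- The nonlinearity `u ↦ |u|^p u` as a map from `D(A^{1/2})` to `L²`. -/
def powerMap (A : Lp ℝ 2 μ →ₗ.[ℝ] Lp ℝ 2 μ) (p : ℝ)
    (hmem : ∀ u : SqrtDomain A, MemLp (fun x => |u.toH x| ^ p * u.toH x) 2 μ)
    (u : SqrtDomain A) : Lp ℝ 2 μ := (hmem u).toLp _

theorem powerMap_coeFn (hmem : ∀ u : SqrtDomain A, MemLp (fun x => |u.toH x| ^ p * u.toH x) 2 μ)
    (u : SqrtDomain A) : powerMap A p hmem u =ᵐ[μ] fun x => |u.toH x| ^ p * u.toH x :=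
  (hmem u).coeFn_toLp

theorem aestronglyMeasurable_power_mul_sq {q : ℝ} (hq : 0 ≤ q) (u v : Lp ℝ 2 μ) :
    AEStronglyMeasurable (fun x => |u x| ^ q * v x ^ 2) μ := by
  have hu := (Lp.aestronglyMeasurable u)
  have h1 : AEStronglyMeasurable (fun x => |u x| ^ q) μ :=
    ((Real.continuous_rpow_const hq).comp continuous_abs).comp_aestronglyMeasurable hu
  exact h1.mul ((Lp.aestronglyMeasurable v).pow 2)

theorem aestronglyMeasurable_power_mul (hp : 0 ≤ p) (u : Lp ℝ 2 μ) :
    AEStronglyMeasurable (fun x => |u x| ^ p * u x) μ :=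
  (((Real.continuous_rpow_const hp).comp continuous_abs).comp_aestronglyMeasurable
    (Lp.aestronglyMeasurable u)).mul (Lp.aestronglyMeasurable u)

theorem weighted_integral_bound (hp : 0 < p) {K₂ : ℝ}
    (h : ∀ u v : SqrtDomain A, eLpNorm (fun x => |u.toH x| ^ (2 * p) * (v.toH x) ^ 2) 1 μ
        ≤ ENNReal.ofReal (K₂ * ‖u‖ ^ (2 * p) * ‖v‖ ^ 2)) (u v : SqrtDomain A) :
    Integrable (fun x => |u.toH x| ^ (2 * p) * (v.toH x) ^ 2) μ ∧
      ∫ x, |u.toH x| ^ (2 * p) * (v.toH x) ^ 2 ∂μ ≤ |K₂| * ‖u‖ ^ (2 * p) * ‖v‖ ^ 2 := by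
  refine integrable_of_eLpNorm_one_le (aestronglyMeasurable_power_mul_sq (by positivity) _ _)
    (by positivity) (fun x => by positivity) ((h u v).trans (ENNReal.ofReal_le_ofReal ?_))
  gcongr
  exact le_abs_self _

theorem memLp_power (hp : 0 < p) {K₂ : ℝ}
    (h : ∀ u v : SqrtDomain A, eLpNorm (fun x => |u.toH x| ^ (2 * p) * (v.toH x) ^ 2) 1 μ
        ≤ ENNReal.ofReal (K₂ * ‖u‖ ^ (2 * p) * ‖v‖ ^ 2)) (u : SqrtDomain A) :
    MemLp (fun x => |u.toH x| ^ p * u.toH x) 2 μ := by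
  rw [memLp_two_iff_integrable_sq (aestronglyMeasurable_power_mul hp.le _)]
  simp only [abs_rpow_mul_sq p]
  exact (weighted_integral_bound hp h u u).1

/-- The convex potential of `powerMap`. -/
def powerPotential (A : Lp ℝ 2 μ →ₗ.[ℝ] Lp ℝ 2 μ) (p : ℝ)
    (hmem : ∀ u : SqrtDomain A, MemLp (fun x => |u.toH x| ^ p * u.toH x) 2 μ)
    (u : SqrtDomain A) : ℝ := ⟪powerMap A p hmem u, u.toH⟫_ℝ / (p + 2)

theorem inner_powerMap (hmem : ∀ u : SqrtDomain A, MemLp (fun x => |u.toH x| ^ p * u.toH x) 2 μ)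
    (u : SqrtDomain A) (w : Lp ℝ 2 μ) :
    Integrable (fun x => |u.toH x| ^ p * u.toH x * w x) μ ∧
      ⟪powerMap A p hmem u, w⟫_ℝ = ∫ x, |u.toH x| ^ p * u.toH x * w x ∂μ := by
  have hae : (fun x => powerMap A p hmem u x * w x) =ᵐ[μ]
      fun x => |u.toH x| ^ p * u.toH x * w x := by
    filter_upwards [powerMap_coeFn hmem u] with x hx
    rw [hx]
  exact ⟨(L2_integrable_mul _ _).congr hae, by
    rw [L2_inner_eq_integral]; exact integral_congr_ae hae⟩

theorem inner_powerMap_self (hp : 0 < p)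
    (hmem : ∀ u : SqrtDomain A, MemLp (fun x => |u.toH x| ^ p * u.toH x) 2 μ)
    (u : SqrtDomain A) : Integrable (fun x => |u.toH x| ^ (p + 2)) μ ∧
      ⟪powerMap A p hmem u, u.toH⟫_ℝ = ∫ x, |u.toH x| ^ (p + 2) ∂μ := by
  have := inner_powerMap hmem u u.toH
  simpa only [abs_rpow_mul_mul_self hp] using this

/-- On a finite measure space the L² norm is dominated by the L^{p+2} norm. This follows by
splitting at a level s: pointwise s^p u² ≤ s^{p+2} + |u|^{p+2}. -/
theorem powerPotential_lower [IsFiniteMeasure μ] (hp : 0 < p)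
    (hmem : ∀ u : SqrtDomain A, MemLp (fun x => |u.toH x| ^ p * u.toH x) 2 μ) :
    ∃ c, 0 < c ∧ ∀ u : SqrtDomain A, c * ‖u.toH‖ ^ (p + 2) ≤ powerPotential A p hmem u := by
  -- The added 1 keeps m positive when μ = 0.
  set m := μ.real univ + 1 with hm
  have hmpos : 0 < m := by positivity
  refine ⟨(1 / (2 * m)) ^ (p / 2) / 2 / (p + 2), by positivity, fun u => ?_⟩
  obtain ⟨hint, hin⟩ := inner_powerMap_self hp hmem u
  rw [powerPotential, hin, div_mul_eq_mul_div]
  gcongr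
  rcases eq_or_ne u.toH 0 with h0 | h0
  · rw [h0, norm_zero, Real.zero_rpow (by positivity), mul_zero]
    exact integral_nonneg fun x => by positivity
  have hn : 0 < ‖u.toH‖ := norm_pos_iff.2 h0
  set y := ‖u.toH‖ with hy
  -- With s² m = ‖u‖²/2, the constant term absorbs at most half of s^p ‖u‖² after integration.
  set s := y * √(1 / (2 * m)) with hs
  have hspos : 0 < s := by positivity
  have hs2 : s ^ 2 = y ^ 2 / (2 * m) := by
    rw [hs, mul_pow, Real.sq_sqrt (by positivity)]; ring
  have hpt : ∀ x, s ^ p * u.toH x ^ 2 ≤ s ^ p * s ^ 2 + |u.toH x| ^ (p + 2) := by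
    intro x
    rcases le_total |u.toH x| s with h | h
    · have h1 : u.toH x ^ 2 ≤ s ^ 2 := by rw [← sq_abs]; gcongr
      have h2 := mul_le_mul_of_nonneg_left h1 (show 0 ≤ s ^ p by positivity)
      have : 0 ≤ |u.toH x| ^ (p + 2) := by positivity
      linarith
    · have h1 : s ^ p ≤ |u.toH x| ^ p := Real.rpow_le_rpow hspos.le h hp.le
      have h2 := mul_le_mul_of_nonneg_right h1 (sq_nonneg (u.toH x))
      have e : |u.toH x| ^ p * u.toH x ^ 2 = |u.toH x| ^ (p + 2) := by
        rw [← abs_rpow_mul_mul_self hp]; ring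
      have : 0 ≤ s ^ p * s ^ 2 := by positivity
      linarith
  have hI := integral_mono ((Lp.memLp u.toH).integrable_sq.const_mul (s ^ p))
    ((integrable_const (s ^ p * s ^ 2)).add hint) hpt
  rw [integral_const_mul, ← L2_norm_sq_eq_integral] at hI
  simp only [Pi.add_apply] at hI
  rw [integral_add (integrable_const _) hint, integral_const, smul_eq_mul, hs2] at hI
  have h3 : μ.real univ * (s ^ p * (y ^ 2 / (2 * m))) ≤ s ^ p * y ^ 2 / 2 := by
    have : μ.real univ ≤ m := by rw [hm]; linarith
    calc _ ≤ m * (s ^ p * (y ^ 2 / (2 * m))) := by gcongr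
      _ = _ := by field_simp
  have h4 : s ^ p = y ^ p * (1 / (2 * m)) ^ (p / 2) := by
    rw [hs, Real.mul_rpow hn.le (by positivity), Real.sqrt_eq_rpow, ← Real.rpow_mul (by positivity)]
    congr 2; ring
  have h5 : y ^ (p + 2) = y ^ p * y ^ 2 := by
    rw [Real.rpow_add hn]; norm_cast
  rw [h5]
  rw [h4] at hI h3
  linarith

/-- The bound on |u|^{2p} v² gives the Lipschitz estimate with v = u − w and the growth with v = u.
Convexity is Young's inequality under the integral. -/
theorem isPowerGradient_powerMap [IsFiniteMeasure μ] (hp : 0 < p) {K₂ : ℝ}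
    (h : ∀ u v : SqrtDomain A, eLpNorm (fun x => |u.toH x| ^ (2 * p) * (v.toH x) ^ 2) 1 μ
        ≤ ENNReal.ofReal (K₂ * ‖u‖ ^ (2 * p) * ‖v‖ ^ 2))
    (hmem : ∀ u : SqrtDomain A, MemLp (fun x => |u.toH x| ^ p * u.toH x) 2 μ) :
    IsPowerGradient (SqrtDomain.embed A) p (powerMap A p hmem) (powerPotential A p hmem) where
  lip R := by
    refine ⟨√(4 * (p + 1) ^ 2 * |K₂| * |R| ^ (2 * p)), by positivity, fun u w hu hw => ?_⟩
    refine le_of_sq_le_sq ?_ (by positivity)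
    rw [mul_pow, Real.sq_sqrt (by positivity), L2_norm_sq_eq_integral]
    obtain ⟨i1, b1⟩ := weighted_integral_bound hp h u (u - w)
    obtain ⟨i2, b2⟩ := weighted_integral_bound hp h w (u - w)
    have hle : ∫ x, (powerMap A p hmem u - powerMap A p hmem w : Lp ℝ 2 μ) x ^ 2 ∂μ ≤
        ∫ x, 2 * (p + 1) ^ 2 * (|u.toH x| ^ (2 * p) * (u - w).toH x ^ 2 +
          |w.toH x| ^ (2 * p) * (u - w).toH x ^ 2) ∂μ := by
      refine integral_mono_ae (Lp.memLp _).integrable_sq ((i1.add i2).const_mul _) ?_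
      filter_upwards [powerMap_coeFn hmem u, powerMap_coeFn hmem w,
        Lp.coeFn_sub (powerMap A p hmem u) (powerMap A p hmem w),
        Lp.coeFn_sub u.toH w.toH] with x hx1 hx2 hx3 hx4
      have e4 : (u - w).toH x = u.toH x - w.toH x := by rw [map_sub]; exact hx4
      have h1 := abs_rpow_mul_sub_le hp (u.toH x) (w.toH x)
      have h2 := pow_le_pow_left₀ (abs_nonneg _) h1 2
      rw [sq_abs, mul_pow, mul_pow, sq_abs] at h2
      have e5 : ∀ a : ℝ, |a| ^ (2 * p) = (|a| ^ p) ^ 2 := fun a => by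
        rw [← Real.rpow_natCast (|a| ^ p), ← Real.rpow_mul (abs_nonneg _)]
        congr 1; push_cast; ring
      rw [hx3, Pi.sub_apply, hx1, hx2, e4, e5, e5]
      refine h2.trans ?_
      have h3 : (|u.toH x| ^ p + |w.toH x| ^ p) ^ 2 ≤
          2 * ((|u.toH x| ^ p) ^ 2 + (|w.toH x| ^ p) ^ 2) := by
        nlinarith [sq_nonneg (|u.toH x| ^ p - |w.toH x| ^ p)]
      have h4 := mul_le_mul_of_nonneg_left h3
        (show 0 ≤ (p + 1) ^ 2 * (u.toH x - w.toH x) ^ 2 by positivity)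
      linarith
    refine hle.trans ?_
    rw [integral_const_mul, integral_add i1 i2]
    have hR : ∀ z : SqrtDomain A, ‖z‖ ≤ R → ‖z‖ ^ (2 * p) ≤ |R| ^ (2 * p) := fun z hz =>
      Real.rpow_le_rpow (norm_nonneg _) (hz.trans (le_abs_self R)) (by positivity)
    have c1 := mul_le_mul_of_nonneg_left (hR u hu)
      (show 0 ≤ |K₂| * ‖u - w‖ ^ 2 by positivity)
    have c2 := mul_le_mul_of_nonneg_left (hR w hw)
      (show 0 ≤ |K₂| * ‖u - w‖ ^ 2 by positivity)
    have c3 : ∫ x, |u.toH x| ^ (2 * p) * (u - w).toH x ^ 2 ∂μ +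
        ∫ x, |w.toH x| ^ (2 * p) * (u - w).toH x ^ 2 ∂μ ≤
        2 * (|K₂| * ‖u - w‖ ^ 2 * |R| ^ (2 * p)) := by linarith
    have c4 := mul_le_mul_of_nonneg_left c3 (show 0 ≤ 2 * (p + 1) ^ 2 by positivity)
    linarith
  convex u w := by
    obtain ⟨iu, eu⟩ := inner_powerMap_self hp hmem u
    obtain ⟨iw, ew⟩ := inner_powerMap_self hp hmem w
    obtain ⟨ii, ei⟩ := inner_powerMap hmem u w.toH
    rw [inner_sub_right, powerPotential, powerPotential, SqrtDomain.embed_apply,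
      SqrtDomain.embed_apply, ei, eu, ew]
    have hI := integral_mono (ii.const_mul (p + 2)) ((iu.const_mul (p + 1)).add iw) (fun x => by
      have h1 := rpow_young (show 0 < p + 1 by positivity) (abs_nonneg (u.toH x))
        (abs_nonneg (w.toH x))
      have e1 : p + 1 + 1 = p + 2 := by ring
      rw [e1, Real.rpow_add_one' (abs_nonneg _) (by positivity)] at h1
      have h2 : |u.toH x| ^ p * u.toH x * w.toH x ≤ |u.toH x| ^ p * |u.toH x| * |w.toH x| := by
        rw [mul_assoc, mul_assoc, ← abs_mul]
        gcongr
        exact le_abs_self _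
      have h3 := mul_le_mul_of_nonneg_left h2 (show 0 ≤ p + 2 by positivity)
      exact h3.trans h1)
    simp only [Pi.add_apply] at hI
    rw [integral_const_mul, integral_add (iu.const_mul _) iw, integral_const_mul] at hI
    rw [← sub_div, le_div_iff₀ (by positivity)]
    linarith
  euler u := by
    rw [powerPotential, SqrtDomain.embed_apply]; field_simp
  lower := powerPotential_lower hp hmem
  growth := by
    refine ⟨√|K₂|, by positivity, fun u => ?_⟩
    refine le_of_sq_le_sq ?_ (by positivity)
    have h1 := (weighted_integral_bound hp h u u).2
    have e1 : ∫ x, powerMap A p hmem u x ^ 2 ∂μ =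
        ∫ x, |u.toH x| ^ (2 * p) * u.toH x ^ 2 ∂μ := by
      refine integral_congr_ae ?_
      filter_upwards [powerMap_coeFn hmem u] with x hx
      rw [hx, abs_rpow_mul_sq p]
    rw [L2_norm_sq_eq_integral, e1, mul_pow, Real.sq_sqrt (abs_nonneg _),
      Real.rpow_add_one' (norm_nonneg _) (by positivity), mul_pow,
      ← Real.rpow_natCast (‖u‖ ^ p), ← Real.rpow_mul (norm_nonneg _)]
    rw [show p * ((2 : ℕ) : ℝ) = 2 * p by push_cast; ring, ← mul_assoc]
    exact h1

end Power

/-! ### Concrete and abstract weak solutions. -/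

section Equivalence

variable {X : Type*} [MeasurableSpace X] {μ : Measure X}
  {A : Lp ℝ 2 μ →ₗ.[ℝ] Lp ℝ 2 μ} {p : ℝ}

/-- The inner product of V contains that of L², which cancels the term ιu of the abstract force. -/
theorem weak_rhs_eq (hmem : ∀ u : SqrtDomain A, MemLp (fun x => |u.toH x| ^ p * u.toH x) 2 μ)
    (u φ : SqrtDomain A) (v : Lp ℝ 2 μ) :
    ⟪SqrtDomain.embed A u - v - powerMap A p hmem u, SqrtDomain.embed A φ⟫_ℝ - ⟪u, φ⟫_ℝ =
      -(⟪v, φ.toH⟫_ℝ + ⟪u.half, φ.half⟫_ℝ + ∫ x, |u.toH x| ^ p * u.toH x * φ.toH x ∂μ) := by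
  rw [← (inner_powerMap hmem u φ.toH).2, SqrtDomain.inner_eq, inner_sub_left, inner_sub_left,
    SqrtDomain.embed_apply, SqrtDomain.embed_apply]
  ring

/-- Global weak solutions are the solutions of the abstract damped equation. -/
theorem isGlobalWeakSolution_iff
    (hmem : ∀ u : SqrtDomain A, MemLp (fun x => |u.toH x| ^ p * u.toH x) 2 μ)
    (hc : Continuous (powerMap A p hmem)) (u₀ : SqrtDomain A) (u₁ : Lp ℝ 2 μ)
    (u : ℝ → SqrtDomain A) : IsGlobalWeakSolution A p u₀ u₁ u ↔
      u 0 = u₀ ∧ ∃ v, v 0 = u₁ ∧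
        IsDampedSolution (SqrtDomain.embed A) (powerMap A p hmem) u v := by
  constructor
  · rintro ⟨h1, h2, -, v, h3, h4, h5, h6⟩
    refine ⟨h2, v, h4, ⟨h1, h3, ?_, h5, fun φ t ht => ?_⟩⟩
    · exact (((SqrtDomain.embed A).continuous.comp_continuousOn h1).sub h3).sub
        (hc.comp_continuousOn h1)
    · rw [weak_rhs_eq hmem]; exact h6 φ t ht
  · rintro ⟨h2, v, h4, h⟩
    refine ⟨h.contU, h2, fun t _ => hmem _, v, h.contV, h4, h.deriv, fun φ t ht => ?_⟩
    rw [← weak_rhs_eq hmem]; exact h.weak φ t ht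

end Equivalence

end DampedWave

end

/-! ### The theorem. -/

open DampedWave in
theorem theorem4p1 {X : Type*} [MeasurableSpace X] (μ : Measure X) [IsFiniteMeasure μ]
    (A : Lp ℝ 2 μ →ₗ.[ℝ] Lp ℝ 2 μ) (hA : IsNonnegSelfAdjoint A)
    (hker : opKer A ≠ ⊥)
    (hcoer : ∃ ν : ℝ, 0 < ν ∧ ∀ u : SqrtDomain A, u.toH ∈ (opKer A)ᗮ →
      ν * ‖u.toH‖ ^ 2 ≤ ‖u.half‖ ^ 2)
    (p : ℝ) (hp : 0 < p)
    (hi : ∃ K₁ : ℝ, ∀ u : SqrtDomain A,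
      MemLp u.toH (ENNReal.ofReal (2 * (p + 1))) μ ∧
      eLpNorm u.toH (ENNReal.ofReal (2 * (p + 1))) μ ≤ ENNReal.ofReal (K₁ * ‖u‖))
    (hii : ∃ K₂ : ℝ, ∀ u v : SqrtDomain A,
      eLpNorm (fun x => |u.toH x| ^ p * (v.toH x) ^ 2) 1 μ
        ≤ ENNReal.ofReal (K₂ * ‖u‖ ^ p * ‖v‖ * ‖v.toH‖) ∧
      eLpNorm (fun x => |u.toH x| ^ (2 * p) * (v.toH x) ^ 2) 1 μ
        ≤ ENNReal.ofReal (K₂ * ‖u‖ ^ (2 * p) * ‖v‖ ^ 2)) :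
    (∀ (u₀ : SqrtDomain A) (u₁ : Lp ℝ 2 μ),
      ∃ u : ℝ → SqrtDomain A, IsGlobalWeakSolution A p u₀ u₁ u ∧
        (∀ w : ℝ → SqrtDomain A, IsGlobalWeakSolution A p u₀ u₁ w → EqOn w u (Ici 0)) ∧
        ∃ M₁ : ℝ, ∀ t : ℝ, 0 ≤ t → ‖(u t).toH‖ ≤ M₁ / (1 + t) ^ (1 / p)) ∧
    (∃ (S : Set (SqrtDomain A × Lp ℝ 2 μ)) (M₂ M₃ : ℝ),
      IsOpen S ∧ S.Nonempty ∧ 0 < M₂ ∧ 0 < M₃ ∧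
        ∀ d ∈ S, ∀ u : ℝ → SqrtDomain A, IsGlobalWeakSolution A p d.1 d.2 u →
          ∀ t : ℝ, 0 ≤ t →
            M₂ / (1 + t) ^ (1 / p) ≤ ‖(u t).toH‖ ∧
            ‖(u t).toH‖ ≤ M₃ / (1 + t) ^ (1 / p)) := by
  obtain ⟨ν, hν, hgap⟩ := hcoer
  obtain ⟨K₂, hK₂⟩ := hii
  have := SqrtDomain.completeSpace hA
  have hmem := memLp_power hp fun u v => (hK₂ u v).2
  have hf := isPowerGradient_powerMap hp (fun u v => (hK₂ u v).2) hmem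
  have hinj := SqrtDomain.embed_injective (A := A)
  have hdense := SqrtDomain.denseRange_embed hA
  have hle := SqrtDomain.norm_embed_le (A := A)
  have hiff := isGlobalWeakSolution_iff hmem hf.continuous
  refine ⟨fun u₀ u₁ => ?_, ?_⟩
  · obtain ⟨u, v, h, hu, hv⟩ := exists_isDampedSolution hinj hdense hle hp hf u₀ u₁
    obtain ⟨M, -, hM⟩ := exists_upper_bound hinj hdense hle hp hf
      -- The absolute value plus 1 is a positive threshold above the initial energy.
      (e := |energy (SqrtDomain.embed A) (powerPotential A p hmem) (u 0) (v 0)| + 1) (by positivity)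
    refine ⟨u, (hiff u₀ u₁ u).2 ⟨hu, v, hv, h⟩, fun w hw t ht => ?_, M, hM u v h ?_⟩
    · obtain ⟨hw0, v', hv', h'⟩ := (hiff u₀ u₁ w).1 hw
      exact h'.unique hinj hdense hle hp hf h (hw0.trans hu.symm) (hv'.trans hv.symm) ht
    · exact (le_abs_self _).trans (by linarith)
  -- The gap is lowered to at most 1, as the estimates for the modified energy require.
  · have hgap' := hasSpectralGap hA (ν := min ν 1) (by positivity) fun u hu =>
      (mul_le_mul_of_nonneg_right (min_le_left _ _) (sq_nonneg _)).trans (hgap u hu)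
    obtain ⟨x, hx, hx0⟩ := Submodule.exists_mem_ne_zero_of_ne_bot hker
    obtain ⟨k, rfl, hk⟩ := exists_half_eq_zero hA hx
    have hkn : ‖k‖ = ‖SqrtDomain.embed A k‖ := by
      rw [SqrtDomain.norm_eq, hk, SqrtDomain.embed_apply]; simp
    obtain ⟨S, M₂, M₃, hS, hne, h2, h3, hb⟩ := exists_slow_solutions hinj hdense hle hp hf hgap'
      (min_le_right _ _) ⟨k, fun h => hx0 (by rw [h, map_zero]), hkn⟩
    refine ⟨S, M₂, M₃, hS, hne, h2, h3, fun d hd u hu => ?_⟩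
    obtain ⟨h0, v, hv, h⟩ := (hiff d.1 d.2 u).1 hu
    exact hb u v h (by rw [h0, hv]; exact hd)
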